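/- Fix constants $\mu>1$, $L>0$ and $\kappa\ge 1$. There are positive constants $c_1,\dots,c_6$, depending only on $\mu,L,\kappa$, such that the following holds for all $n,p$. Let $x_1,\dots,x_n\in\mathbb R^p$ be random vectors all of whose $np$ entries are i.i.d. with $\mathbb E[x_i(l)]=0$, $\mathbb E[x_i(l)^2]=1$, $\mathbb E[x_i(l)^4]=\mu$ and sub-Gaussian norm $\|x_i(l)\|_{\psi_2}=\sup_{q\ge1}q^{-1/2}(\mathbb E|x_i(l)|^q)^{1/q}\le L$. Let $[n]=I_1\sqcup I_2$ be a fixed partition, $n_b=|I_b|$, with $n_1\le\kappa n_2$ and $n_2\le\kappa n_1$. Let $\beta_1^*,\beta_2^*\in\mathbb R^p$ be fixed, not both zero, and put $$\alpha=\frac{\|\beta_1^*-\beta_2^*\|_2^2}{\|\beta_1^*\|_2^2+\|\beta_2^*\|_2^2},\qquad K^*=\tfrac12\bigl(\beta_1^*\beta_2^{*\top}+\beta_2^*\beta_1^{*\top}\bigr),\qquad g^*=\tfrac12(\beta_1^*+\beta_2^*).$$ Assume $\alpha>0$ and $\min(n_1,n_2)\ge c_3\,p/\alpha$. Then with probability at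 least $1-c_1e^{-c_2n}$ over the $x_i$ the following holds simultaneously for every noise vector $e\in\mathbb R^n$ (which may therefore depend on the $x_i$ and on $\beta_1^*,\beta_2^*$) and every $\eta$ with $$\eta\ge c_4\sqrt n\,\|e\|_2\|\beta_2^*-\beta_1^*\|_2,\qquad \|e\|_2\le\frac{\sqrt\alpha}{c_5}\sqrt n\,\bigl(\|\beta_1^*\|_2+\|\beta_2^*\|_2\bigr).$$ Let $y_i=\langle x_i,\beta_b^*\rangle+e_i$ for $i\in I_b$, $b=1,2$. Every optimal solution $(\hat K,\hat g)$ of the convex program $$\min_{K,g}\ \|K\|_*\quad\text{subject to}\quad\sum_{i=1}^n\bigl|-\langle x_ix_i^\top,K\rangle+2y_i\langle x_i,g\rangle-y_i^2\bigr|\le\eta,$$ over symmetric $K\in\mathbb R^{p\times p}$ and $g\in\mathbb R^p$ ($\|\cdot\|_*$ being the nuclear norm), satisfies $$\|\hat K-K^*\|_F\le c_6\frac{\eta}{\sqrt\alpha\,n},\qquad \|\hat g-g^*\|_2\le c_6\frac{\eta}{\sqrt\alpha\,n\,(\|\beta_1^*\|_2+\|\beta_2^*\|_2)}.$$ If the program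 is taken over all $K\in\mathbb R^{p\times p}$ instead, every optimal solution satisfies the same two bounds with $\hat K$ replaced by its symmetric part $\tfrac12(\hat K+\hat K^\top)$. -/

import Mathlib

open MeasureTheory ProbabilityTheory
open scoped NNReal ENNReal RealInnerProductSpace

noncomputable section

/-- The outer product `u vᵀ`. -/
def outer {p : ℕ} (u v : EuclideanSpace ℝ (Fin p)) : Matrix (Fin p) (Fin p) ℝ :=
  Matrix.of fun j k => u j * v k

/-- The entrywise (trace) inner product `⟨A, B⟩` of matrices. -/
def matInner {p : ℕ} (A B : Matrix (Fin p) (Fin p) ℝ) : ℝ :=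
  ∑ j, ∑ k, A j k * B j k

/-- The Frobenius norm `‖A‖_F`. -/
def frobNorm {p : ℕ} (A : Matrix (Fin p) (Fin p) ℝ) : ℝ :=
  √(∑ j, ∑ k, A j k ^ 2)

/-- The nuclear norm `‖A‖_*`: the sum of the singular values of `A`, acting on Euclidean space. -/
def nuclearNorm {p : ℕ} (A : Matrix (Fin p) (Fin p) ℝ) : ℝ :=
  ∑ i ∈ Finset.range p, (Matrix.toLpLin 2 2 A).singularValues i

/-- The sub-Gaussian norm `‖Y‖_{ψ₂} = sup_{q ≥ 1} q^{-1/2} (E|Y|^q)^{1/q}`, with values in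
`[0, ∞]`. -/
def subGaussianNorm {Ω : Type*} [MeasurableSpace Ω] (Y : Ω → ℝ) (P : Measure Ω) : ℝ≥0∞ :=
  ⨆ (q : ℝ≥0) (_ : 1 ≤ q), eLpNorm Y (q : ℝ≥0∞) P / (NNReal.sqrt q : ℝ≥0∞)

/-- All entries of the covariates `x₁, …, xₙ ∈ ℝᵖ` are i.i.d. with mean zero, unit variance,
fourth moment `μ` and sub-Gaussian norm at most `L`. -/
structure IsCovariateModel {Ω : Type*} [MeasurableSpace Ω] (P : Measure Ω) {n p : ℕ}
    (x : Fin n → Ω → EuclideanSpace ℝ (Fin p)) (μ : ℝ) (L : ℝ≥0) : Prop where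
  measurable : ∀ i l, Measurable fun ω => x i ω l
  indep : iIndepFun (fun (q : Fin n × Fin p) (ω : Ω) => x q.1 ω q.2) P
  identDistrib : ∀ i l i' l', IdentDistrib (fun ω => x i ω l) (fun ω => x i' ω l') P P
  mean : ∀ i l, ∫ ω, x i ω l ∂P = 0
  secondMoment : ∀ i l, ∫ ω, x i ω l ^ 2 ∂P = 1
  fourthMoment : ∀ i l, ∫ ω, x i ω l ^ 4 ∂P = μ
  subGaussian : ∀ i l, subGaussianNorm (fun ω => x i ω l) P ≤ L

/-- The mixed regression responses: `yᵢ = ⟨xᵢ, β₁⟩ + eᵢ` for `i ∈ I₁` and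
`yᵢ = ⟨xᵢ, β₂⟩ + eᵢ` for `i ∉ I₁`. -/
def response {n p : ℕ} (I₁ : Finset (Fin n)) (β₁ β₂ : EuclideanSpace ℝ (Fin p))
    (x : Fin n → EuclideanSpace ℝ (Fin p)) (e : EuclideanSpace ℝ (Fin n)) (i : Fin n) : ℝ :=
  (if i ∈ I₁ then ⟪x i, β₁⟫ else ⟪x i, β₂⟫) + e i

/-- `K* = (β₁ β₂ᵀ + β₂ β₁ᵀ) / 2`. -/
def Kstar {p : ℕ} (β₁ β₂ : EuclideanSpace ℝ (Fin p)) : Matrix (Fin p) (Fin p) ℝ :=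
  (1 / 2 : ℝ) • (outer β₁ β₂ + outer β₂ β₁)

/-- `g* = (β₁ + β₂) / 2`. -/
def gstar {p : ℕ} (β₁ β₂ : EuclideanSpace ℝ (Fin p)) : EuclideanSpace ℝ (Fin p) :=
  (1 / 2 : ℝ) • (β₁ + β₂)

/-- `α = ‖β₁ - β₂‖² / (‖β₁‖² + ‖β₂‖²)`. -/
def separation {p : ℕ} (β₁ β₂ : EuclideanSpace ℝ (Fin p)) : ℝ :=
  ‖β₁ - β₂‖ ^ 2 / (‖β₁‖ ^ 2 + ‖β₂‖ ^ 2)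

/-- The `ℓ¹` loss `∑ᵢ |-⟨xᵢ xᵢᵀ, K⟩ + 2 yᵢ ⟨xᵢ, g⟩ - yᵢ²|`. -/
def l1Loss {n p : ℕ} (x : Fin n → EuclideanSpace ℝ (Fin p)) (y : Fin n → ℝ)
    (K : Matrix (Fin p) (Fin p) ℝ) (g : EuclideanSpace ℝ (Fin p)) : ℝ :=
  ∑ i, |-matInner (outer (x i) (x i)) K + 2 * y i * ⟪x i, g⟫ - y i ^ 2|

/-- `(K, g)` is an optimal solution of the program: minimize `‖K‖_*` over `K ∈ S` and `g ∈ ℝᵖ`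
subject to the loss being at most `η`. -/
structure IsOptimal {n p : ℕ} (S : Set (Matrix (Fin p) (Fin p) ℝ))
    (x : Fin n → EuclideanSpace ℝ (Fin p)) (y : Fin n → ℝ) (η : ℝ)
    (K : Matrix (Fin p) (Fin p) ℝ) (g : EuclideanSpace ℝ (Fin p)) : Prop where
  mem : K ∈ S
  feasible : l1Loss x y K g ≤ η
  optimal : ∀ K' ∈ S, ∀ g', l1Loss x y K' g' ≤ η → nuclearNorm K ≤ nuclearNorm K'

/-- The symmetric part `(K + Kᵀ) / 2`. -/
def symPart {p : ℕ} (K : Matrix (Fin p) (Fin p) ℝ) : Matrix (Fin p) (Fin p) ℝ :=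
  (1 / 2 : ℝ) • (K + K.transpose)

end

/-- A square matrix which does not increase Euclidean norms. -/
def IsContraction {p : ℕ} (W : Matrix (Fin p) (Fin p) ℝ) : Prop :=
  ∀ v : EuclideanSpace ℝ (Fin p), ‖Matrix.toLpLin 2 2 W v‖ ≤ ‖v‖

section Nuclear

variable {p : ℕ}

local notation "𝓔" => EuclideanSpace ℝ (Fin p)
local notation "𝓜" => Matrix (Fin p) (Fin p) ℝ

theorem inner_toLpLin (W : 𝓜) (u v : 𝓔) :
    ⟪u, Matrix.toLpLin 2 2 W v⟫ = ∑ j, ∑ k, u j * W j k * v k := by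
  simp only [PiLp.inner_apply, Matrix.toLpLin_apply, Matrix.mulVec, dotProduct]
  refine Finset.sum_congr rfl fun j _ => ?_
  simp [Finset.mul_sum, mul_comm, mul_left_comm, mul_assoc]

theorem inner_toLpLin_transpose (W : 𝓜) (u v : 𝓔) :
    ⟪u, Matrix.toLpLin 2 2 W.transpose v⟫ = ⟪Matrix.toLpLin 2 2 W u, v⟫ := by
  rw [inner_toLpLin, real_inner_comm, inner_toLpLin, Finset.sum_comm]
  simp [mul_comm, mul_left_comm, mul_assoc]

theorem adjoint_toLpLin (W : 𝓜) :
    LinearMap.adjoint (Matrix.toLpLin 2 2 W) = Matrix.toLpLin 2 2 W.transpose := by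
  symm
  rw [LinearMap.eq_adjoint_iff]
  intro x y
  rw [real_inner_comm, inner_toLpLin_transpose, real_inner_comm]

theorem matInner_eq_sum_inner {ι : Type*} [Fintype ι] (b : OrthonormalBasis ι ℝ 𝓔) (W A : 𝓜) :
    matInner W A = ∑ i, ⟪Matrix.toLpLin 2 2 W (b i), Matrix.toLpLin 2 2 A (b i)⟫ := by
  have key : ∀ {κ : Type _} [Fintype κ] (b : OrthonormalBasis κ ℝ 𝓔),
      LinearMap.trace ℝ 𝓔 (LinearMap.adjoint (Matrix.toLpLin 2 2 W) ∘ₗ Matrix.toLpLin 2 2 A) =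
      ∑ i, ⟪Matrix.toLpLin 2 2 W (b i), Matrix.toLpLin 2 2 A (b i)⟫ := by
    intro κ _ b
    rw [LinearMap.trace_eq_sum_inner _ b]
    simp [LinearMap.adjoint_inner_right]
  rw [← key b, LinearMap.trace_eq_sum_inner _ (EuclideanSpace.basisFun (Fin p) ℝ)]
  simp only [LinearMap.comp_apply, LinearMap.adjoint_inner_right]
  rw [matInner, Finset.sum_comm]
  refine Finset.sum_congr rfl fun j _ => ?_
  simp [PiLp.inner_apply, Matrix.toLpLin_apply, mul_comm]

theorem matInner_comm (A B : 𝓜) : matInner A B = matInner B A := by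
  simp [matInner, mul_comm]

theorem matInner_add_right (A B C : 𝓜) : matInner A (B + C) = matInner A B + matInner A C := by
  simp [matInner, mul_add, Finset.sum_add_distrib]

theorem matInner_add_left (A B C : 𝓜) : matInner (A + B) C = matInner A C + matInner B C := by
  simp [matInner, add_mul, Finset.sum_add_distrib]

theorem matInner_sub_right (A B C : 𝓜) : matInner A (B - C) = matInner A B - matInner A C := by
  simp [matInner, mul_sub, Finset.sum_sub_distrib]

theorem matInner_smul_right (c : ℝ) (A B : 𝓜) : matInner A (c • B) = c * matInner A B := by
  simp [matInner, Finset.mul_sum, mul_left_comm]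

theorem matInner_eq_trace (A B : 𝓜) : matInner A B = (A.transpose * B).trace := by
  rw [matInner, Finset.sum_comm]
  simp [Matrix.trace, Matrix.mul_apply]

theorem matInner_transpose (A B : 𝓜) : matInner A.transpose B = matInner A B.transpose := by
  rw [matInner, matInner, Finset.sum_comm]; simp

theorem matInner_mul_right (A B C : 𝓜) :
    matInner A (B * C) = matInner (B.transpose * A) C := by
  rw [matInner_eq_trace, matInner_eq_trace, Matrix.transpose_mul, Matrix.transpose_transpose,
    Matrix.mul_assoc]

theorem matInner_mul_right' (A B C : 𝓜) :
    matInner A (B * C) = matInner (A * C.transpose) B := by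
  rw [matInner_eq_trace, matInner_eq_trace, Matrix.transpose_mul, Matrix.transpose_transpose,
    ← Matrix.mul_assoc, Matrix.trace_mul_comm, Matrix.mul_assoc]

theorem matInner_outer_right (W : 𝓜) (u v : 𝓔) :
    matInner W (outer u v) = ⟪u, Matrix.toLpLin 2 2 W v⟫ := by
  rw [inner_toLpLin]
  simp [matInner, outer, mul_left_comm, mul_assoc]

theorem frobNorm_nonneg (A : 𝓜) : 0 ≤ frobNorm A := Real.sqrt_nonneg _

theorem frobNorm_sq (A : 𝓜) : frobNorm A ^ 2 = matInner A A := by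
  rw [frobNorm, Real.sq_sqrt (by positivity)]
  simp [matInner, sq]

theorem matInner_le_frobNorm_mul (A B : 𝓜) : matInner A B ≤ frobNorm A * frobNorm B := by
  have := Real.sum_mul_le_sqrt_mul_sqrt (Finset.univ : Finset (Fin p × Fin p))
    (fun q => A q.1 q.2) (fun q => B q.1 q.2)
  simpa [Fintype.sum_prod_type, matInner, frobNorm] using this

theorem frobNorm_add_le (A B : 𝓜) : frobNorm (A + B) ≤ frobNorm A + frobNorm B := by
  refine abs_le_of_sq_le_sq' ?_ (add_nonneg (frobNorm_nonneg _) (frobNorm_nonneg _)) |>.2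
  rw [frobNorm_sq, matInner_add_left, matInner_add_right, matInner_add_right, matInner_comm B A,
    add_sq, frobNorm_sq, frobNorm_sq]
  linarith [matInner_le_frobNorm_mul A B]

theorem frobNorm_smul (c : ℝ) (A : 𝓜) : frobNorm (c • A) = |c| * frobNorm A := by
  rw [frobNorm, frobNorm, ← Real.sqrt_sq_eq_abs, ← Real.sqrt_mul (sq_nonneg _)]
  simp [Finset.mul_sum, mul_pow]

theorem frobNorm_neg (A : 𝓜) : frobNorm (-A) = frobNorm A := by
  simp [frobNorm]

theorem frobNorm_transpose (A : 𝓜) : frobNorm A.transpose = frobNorm A := by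
  rw [frobNorm, frobNorm, Finset.sum_comm]; simp

theorem frobNorm_outer (u v : 𝓔) : frobNorm (outer u v) = ‖u‖ * ‖v‖ := by
  rw [frobNorm, EuclideanSpace.norm_eq, EuclideanSpace.norm_eq, ← Real.sqrt_mul (by positivity)]
  congr 1
  simp [outer, Finset.sum_mul_sum, mul_pow]

theorem IsContraction.transpose {W : 𝓜} (hW : IsContraction W) : IsContraction W.transpose := by
  intro v
  by_contra! h
  have h1 : ‖Matrix.toLpLin 2 2 W.transpose v‖ ^ 2 ≤ ‖Matrix.toLpLin 2 2 W.transpose v‖ * ‖v‖ := by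
    rw [← real_inner_self_eq_norm_sq, inner_toLpLin_transpose]
    exact (real_inner_le_norm _ _).trans (mul_le_mul_of_nonneg_right (hW _) (norm_nonneg _))
  nlinarith [norm_nonneg v, norm_nonneg (Matrix.toLpLin 2 2 W.transpose v)]

theorem isContraction_neg {W : 𝓜} (hW : IsContraction W) : IsContraction (-W) := by
  intro v; simpa using hW v

section SVD

variable (A : Matrix (Fin p) (Fin p) ℝ)

/-- The right singular basis of `A`. -/
noncomputable def rightSingularBasis : OrthonormalBasis (Fin p) ℝ 𝓔 :=
  (Matrix.toLpLin 2 2 A).isSymmetric_adjoint_comp_self.eigenvectorBasis finrank_euclideanSpace_fin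

theorem adjoint_toLpLin_rightSingularBasis (j : Fin p) :
    LinearMap.adjoint (Matrix.toLpLin 2 2 A) (Matrix.toLpLin 2 2 A (rightSingularBasis A j)) =
      ((Matrix.toLpLin 2 2 A).singularValues j ^ 2) • rightSingularBasis A j := by
  have h : Module.finrank ℝ (EuclideanSpace ℝ (Fin p)) = p := finrank_euclideanSpace_fin
  rw [(Matrix.toLpLin 2 2 A).sq_singularValues_fin h j]
  exact (Matrix.toLpLin 2 2 A).isSymmetric_adjoint_comp_self.apply_eigenvectorBasis h j

theorem inner_toLpLin_rightSingularBasis (i j : Fin p) :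
    ⟪Matrix.toLpLin 2 2 A (rightSingularBasis A i), Matrix.toLpLin 2 2 A (rightSingularBasis A j)⟫ =
      if i = j then (Matrix.toLpLin 2 2 A).singularValues i ^ 2 else 0 := by
  rw [← LinearMap.adjoint_inner_right, adjoint_toLpLin_rightSingularBasis, inner_smul_right,
    orthonormal_iff_ite.mp (OrthonormalBasis.orthonormal _)]
  split_ifs with h <;> simp [h]

theorem norm_toLpLin_rightSingularBasis (i : Fin p) :
    ‖Matrix.toLpLin 2 2 A (rightSingularBasis A i)‖ = (Matrix.toLpLin 2 2 A).singularValues i := by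
  rw [← sq_eq_sq₀ (norm_nonneg _) (LinearMap.singularValues_nonneg _ _),
    ← real_inner_self_eq_norm_sq, inner_toLpLin_rightSingularBasis, if_pos rfl]

theorem nuclearNorm_eq_sum_fin :
    nuclearNorm A = ∑ i : Fin p, (Matrix.toLpLin 2 2 A).singularValues i := by
  rw [nuclearNorm, Finset.sum_range]

end SVD

theorem matInner_le_mul_nuclearNorm {W : 𝓜} {r : ℝ}
    (hW : ∀ v : 𝓔, ‖Matrix.toLpLin 2 2 W v‖ ≤ r * ‖v‖) (A : 𝓜) :
    matInner W A ≤ r * nuclearNorm A := by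
  rw [matInner_eq_sum_inner (rightSingularBasis A), nuclearNorm_eq_sum_fin, Finset.mul_sum]
  refine Finset.sum_le_sum fun i _ => (real_inner_le_norm _ _).trans ?_
  rw [norm_toLpLin_rightSingularBasis]
  refine mul_le_mul_of_nonneg_right ?_ (LinearMap.singularValues_nonneg _ _)
  simpa using hW (rightSingularBasis A i)

theorem IsContraction.matInner_le {W : 𝓜} (hW : IsContraction W) (A : 𝓜) :
    matInner W A ≤ nuclearNorm A := by
  simpa using matInner_le_mul_nuclearNorm (r := 1) (fun v => by simpa using hW v) A

theorem exists_isContraction_matInner_eq (A : 𝓜) :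
    ∃ W, IsContraction W ∧ matInner W A = nuclearNorm A := by
  set b := rightSingularBasis A with hb
  set σ : Fin p → ℝ := fun i => (Matrix.toLpLin 2 2 A).singularValues i with hσ
  let T : 𝓔 →ₗ[ℝ] 𝓔 := b.toBasis.constr ℝ fun i => (σ i)⁻¹ • Matrix.toLpLin 2 2 A (b i)
  have hT : ∀ i, T (b i) = (σ i)⁻¹ • Matrix.toLpLin 2 2 A (b i) := by
    intro i
    have := b.toBasis.constr_basis ℝ (fun i => (σ i)⁻¹ • Matrix.toLpLin 2 2 A (b i)) i
    rwa [OrthonormalBasis.coe_toBasis] at this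
  have hor : ∀ i j, ⟪T (b i), T (b j)⟫ = if i = j then (σ i)⁻¹ ^ 2 * σ i ^ 2 else 0 := by
    intro i j
    rw [hT, hT, inner_smul_left, inner_smul_right, inner_toLpLin_rightSingularBasis]
    split_ifs with h
    · subst h; simp [hσ]; ring
    · simp
  refine ⟨(Matrix.toLpLin 2 2).symm T, fun v => ?_, ?_⟩
  · rw [LinearEquiv.apply_symm_apply]
    refine abs_le_of_sq_le_sq' ?_ (norm_nonneg _) |>.2
    have hv : T v = ∑ i, ⟪b i, v⟫ • T (b i) := by
      conv_lhs => rw [← b.sum_repr' v]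
      simp
    rw [← real_inner_self_eq_norm_sq, hv, ← b.sum_sq_norm_inner_right v]
    simp only [inner_sum, sum_inner, inner_smul_left, inner_smul_right, hor]
    refine Finset.sum_le_sum fun i _ => ?_
    simp only [mul_ite, mul_zero, Finset.sum_ite_eq', Finset.mem_univ, if_true, Real.norm_eq_abs,
      sq_abs, RCLike.conj_to_real]
    have : (σ i)⁻¹ ^ 2 * σ i ^ 2 ≤ 1 := by
      by_cases h : σ i = 0
      · simp [h]
      · rw [← mul_pow, inv_mul_cancel₀ h, one_pow]
    nlinarith [sq_nonneg ⟪b i, v⟫]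
  · rw [matInner_eq_sum_inner b, nuclearNorm_eq_sum_fin]
    refine Finset.sum_congr rfl fun i _ => ?_
    rw [LinearEquiv.apply_symm_apply, hT, inner_smul_left, inner_toLpLin_rightSingularBasis]
    simp only [if_true, RCLike.conj_to_real]
    by_cases h : σ i = 0
    · simp only [hσ] at h; simp [h]
    · rw [sq, ← mul_assoc, inv_mul_cancel₀ h, one_mul]

theorem nuclearNorm_le_of_forall {A : 𝓜} {r : ℝ}
    (h : ∀ W, IsContraction W → matInner W A ≤ r) : nuclearNorm A ≤ r := by
  obtain ⟨W, hW, hWA⟩ := exists_isContraction_matInner_eq A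
  exact hWA ▸ h W hW

theorem nuclearNorm_add_le (A B : 𝓜) : nuclearNorm (A + B) ≤ nuclearNorm A + nuclearNorm B :=
  nuclearNorm_le_of_forall fun W hW => by
    rw [matInner_add_right]; exact add_le_add (hW.matInner_le A) (hW.matInner_le B)

theorem nuclearNorm_smul_le {c : ℝ} (hc : 0 ≤ c) (A : 𝓜) :
    nuclearNorm (c • A) ≤ c * nuclearNorm A :=
  nuclearNorm_le_of_forall fun W hW => by
    rw [matInner_smul_right]; exact mul_le_mul_of_nonneg_left (hW.matInner_le A) hc

theorem nuclearNorm_neg_le (A : 𝓜) : nuclearNorm (-A) ≤ nuclearNorm A :=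
  nuclearNorm_le_of_forall fun W hW => by
    have := (isContraction_neg hW).matInner_le A
    simpa [matInner] using this

theorem nuclearNorm_transpose_le (A : 𝓜) : nuclearNorm A.transpose ≤ nuclearNorm A :=
  nuclearNorm_le_of_forall fun W hW => by
    rw [← matInner_transpose]; exact hW.transpose.matInner_le A

theorem nuclearNorm_symPart_le (A : 𝓜) : nuclearNorm (symPart A) ≤ nuclearNorm A := by
  refine (nuclearNorm_smul_le (by norm_num) _).trans ?_
  linarith [nuclearNorm_add_le A A.transpose, nuclearNorm_transpose_le A]

theorem nuclearNorm_outer_le (u v : 𝓔) : nuclearNorm (outer u v) ≤ ‖u‖ * ‖v‖ :=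
  nuclearNorm_le_of_forall fun W hW => by
    rw [matInner_outer_right]
    exact (real_inner_le_norm _ _).trans (mul_le_mul_of_nonneg_left (hW v) (norm_nonneg _))

section Projection

variable {P : Matrix (Fin p) (Fin p) ℝ}

/-- `‖P W‖_F ≤ √(tr P)` for a contraction `W` and an orthogonal projection `P`. -/
theorem frobNorm_projection_mul_sq_le (hs : P.transpose = P) (hP : P * P = P) {W : 𝓜}
    (hW : IsContraction W) : frobNorm (P * W) ^ 2 ≤ P.trace := by
  have h1 : P.trace = ∑ i, ‖Matrix.toLpLin 2 2 P (EuclideanSpace.basisFun (Fin p) ℝ i)‖ ^ 2 := by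
    simp_rw [← real_inner_self_eq_norm_sq]
    rw [← matInner_eq_sum_inner, matInner_eq_trace, hs, hP]
  rw [← frobNorm_transpose, frobNorm_sq, matInner_eq_sum_inner (EuclideanSpace.basisFun (Fin p) ℝ),
    h1]
  refine Finset.sum_le_sum fun i _ => ?_
  rw [real_inner_self_eq_norm_sq, Matrix.transpose_mul, hs, Matrix.toLpLin_mul_same,
    LinearMap.comp_apply]
  exact pow_le_pow_left₀ (norm_nonneg _) (hW.transpose _) 2

theorem nuclearNorm_projection_mul_le (hs : P.transpose = P) (hP : P * P = P) (A : 𝓜) :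
    nuclearNorm (P * A) ≤ √P.trace * frobNorm A :=
  nuclearNorm_le_of_forall fun W hW => by
    rw [matInner_mul_right, hs]
    refine (matInner_le_frobNorm_mul _ _).trans
      (mul_le_mul_of_nonneg_right ?_ (frobNorm_nonneg _))
    exact Real.le_sqrt_of_sq_le (frobNorm_projection_mul_sq_le hs hP hW)

theorem nuclearNorm_mul_projection_le (hs : P.transpose = P) (hP : P * P = P) (A : 𝓜) :
    nuclearNorm (A * P) ≤ √P.trace * frobNorm A := by
  have := nuclearNorm_projection_mul_le hs hP A.transpose
  rw [frobNorm_transpose] at this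
  refine le_trans ?_ this
  have h := nuclearNorm_transpose_le (P * A.transpose)
  rwa [Matrix.transpose_mul, Matrix.transpose_transpose, hs] at h

theorem norm_sq_add_norm_sq_projection (hs : P.transpose = P) (hP : P * P = P) (v : 𝓔) :
    ‖Matrix.toLpLin 2 2 P v‖ ^ 2 + ‖Matrix.toLpLin 2 2 (1 - P) v‖ ^ 2 = ‖v‖ ^ 2 := by
  have h1 : ⟪Matrix.toLpLin 2 2 P v, v⟫ = ‖Matrix.toLpLin 2 2 P v‖ ^ 2 := by
    rw [← real_inner_self_eq_norm_sq, ← inner_toLpLin_transpose, hs]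
    conv_lhs => rw [← hP]
    rw [Matrix.toLpLin_mul_same, LinearMap.comp_apply]
    conv_lhs => rw [← hs]
    rw [inner_toLpLin_transpose, hs]
  rw [map_sub, LinearMap.sub_apply, Matrix.toLpLin_one, LinearMap.id_apply, norm_sub_sq_real,
    real_inner_comm, h1]
  ring

/-- Pinching by an orthogonal projection does not increase the nuclear norm. -/
theorem nuclearNorm_pinching_le (hs : P.transpose = P) (hP : P * P = P) (A : 𝓜) :
    nuclearNorm (P * A * P) + nuclearNorm ((1 - P) * A * (1 - P)) ≤ nuclearNorm A := by
  obtain ⟨W₁, hW₁, h₁⟩ := exists_isContraction_matInner_eq (P * A * P)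
  obtain ⟨W₂, hW₂, h₂⟩ := exists_isContraction_matInner_eq ((1 - P) * A * (1 - P))
  have hs' : (1 - P).transpose = 1 - P := by simp [hs]
  have hQ : (1 - P) * (1 - P) = 1 - P := by
    rw [Matrix.mul_sub, Matrix.sub_mul, Matrix.sub_mul, hP]; simp
  have hPQ : P * (1 - P) = 0 := by rw [Matrix.mul_sub, hP]; simp
  rw [← h₁, ← h₂, matInner_mul_right', matInner_mul_right, matInner_mul_right',
    matInner_mul_right, hs, hs', ← matInner_add_left]
  refine IsContraction.matInner_le (fun v => ?_) A
  refine abs_le_of_sq_le_sq' ?_ (norm_nonneg _) |>.2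
  rw [map_add, LinearMap.add_apply, norm_add_sq_real]
  have h0 : ⟪Matrix.toLpLin 2 2 (P * (W₁ * P)) v, Matrix.toLpLin 2 2 ((1 - P) * (W₂ * (1 - P))) v⟫
      = 0 := by
    rw [← inner_toLpLin_transpose, ← LinearMap.comp_apply, ← Matrix.toLpLin_mul_same,
      Matrix.transpose_mul, hs, Matrix.mul_assoc, ← Matrix.mul_assoc P, hPQ]
    simp
  have hproj : ∀ {R : 𝓜}, R.transpose = R → R * R = R → ∀ w : 𝓔,
      ‖Matrix.toLpLin 2 2 R w‖ ^ 2 ≤ ‖w‖ ^ 2 := by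
    intro R h h' w
    have := norm_sq_add_norm_sq_projection h h' w
    nlinarith [sq_nonneg ‖Matrix.toLpLin 2 2 (1 - R) w‖]
  have hb : ∀ {R W : 𝓜}, R.transpose = R → R * R = R → IsContraction W →
      ‖Matrix.toLpLin 2 2 (R * (W * R)) v‖ ^ 2 ≤ ‖Matrix.toLpLin 2 2 R v‖ ^ 2 := by
    intro R W h h' hW
    rw [Matrix.toLpLin_mul_same, LinearMap.comp_apply]
    refine (hproj h h' _).trans ?_
    rw [Matrix.toLpLin_mul_same, LinearMap.comp_apply]
    exact pow_le_pow_left₀ (norm_nonneg _) (hW _) 2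
  rw [h0, ← norm_sq_add_norm_sq_projection hs hP v]
  linarith [hb hs hP hW₁, hb hs' hQ hW₂]

/-- If `A + H` has nuclear norm at most that of `A` and `A` lives on the range of the orthogonal
projection `P`, then the nuclear norm of `H` is controlled by its Frobenius norm. -/
theorem nuclearNorm_le_of_nuclearNorm_add_le (hs : P.transpose = P) (hP : P * P = P) {A H : 𝓜}
    (hPA : P * A = A) (hAP : A * P = A) (h : nuclearNorm (A + H) ≤ nuclearNorm A) :
    nuclearNorm H ≤ 3 * √P.trace * frobNorm H := by
  have hQA : (1 - P) * A = 0 := by rw [Matrix.sub_mul, hPA]; simp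
  have h1 := nuclearNorm_pinching_le hs hP (A + H)
  have h2 := nuclearNorm_pinching_le hs hP H
  rw [Matrix.mul_add, Matrix.add_mul, hPA, hAP, Matrix.mul_add, hQA, zero_add] at h1
  have h3 : nuclearNorm A ≤ nuclearNorm (A + P * H * P) + nuclearNorm (P * H * P) := by
    have := nuclearNorm_add_le (A + P * H * P) (-(P * H * P))
    rw [add_neg_cancel_right] at this
    linarith [nuclearNorm_neg_le (P * H * P)]
  have hfr : ∀ A : 𝓜, frobNorm (P * A) ≤ frobNorm A := by
    intro A
    refine abs_le_of_sq_le_sq' ?_ (frobNorm_nonneg _) |>.2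
    rw [frobNorm_sq, frobNorm_sq, matInner_eq_sum_inner (EuclideanSpace.basisFun (Fin p) ℝ),
      matInner_eq_sum_inner (EuclideanSpace.basisFun (Fin p) ℝ)]
    refine Finset.sum_le_sum fun i _ => ?_
    rw [real_inner_self_eq_norm_sq, real_inner_self_eq_norm_sq, Matrix.toLpLin_mul_same,
      LinearMap.comp_apply]
    have := norm_sq_add_norm_sq_projection hs hP
      (Matrix.toLpLin 2 2 A (EuclideanSpace.basisFun (Fin p) ℝ i))
    nlinarith [sq_nonneg ‖Matrix.toLpLin 2 2 (1 - P)
      (Matrix.toLpLin 2 2 A (EuclideanSpace.basisFun (Fin p) ℝ i))‖]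
  have hs' : (1 - P).transpose = 1 - P := by simp [hs]
  have hQ : (1 - P) * (1 - P) = 1 - P := by
    rw [Matrix.mul_sub, Matrix.sub_mul, Matrix.sub_mul, hP]; simp
  have hfr' : frobNorm ((1 - P) * H) ≤ frobNorm H := by
    refine abs_le_of_sq_le_sq' ?_ (frobNorm_nonneg _) |>.2
    rw [frobNorm_sq, frobNorm_sq, matInner_eq_sum_inner (EuclideanSpace.basisFun (Fin p) ℝ),
      matInner_eq_sum_inner (EuclideanSpace.basisFun (Fin p) ℝ)]
    refine Finset.sum_le_sum fun i _ => ?_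
    rw [real_inner_self_eq_norm_sq, real_inner_self_eq_norm_sq, Matrix.toLpLin_mul_same,
      LinearMap.comp_apply]
    have := norm_sq_add_norm_sq_projection hs hP
      (Matrix.toLpLin 2 2 H (EuclideanSpace.basisFun (Fin p) ℝ i))
    nlinarith [sq_nonneg ‖Matrix.toLpLin 2 2 P
      (Matrix.toLpLin 2 2 H (EuclideanSpace.basisFun (Fin p) ℝ i))‖]
  have h4 : nuclearNorm (P * H * P) ≤ √P.trace * frobNorm H :=
    (nuclearNorm_mul_projection_le hs hP _).trans
      (mul_le_mul_of_nonneg_left (hfr H) (Real.sqrt_nonneg _))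
  have h5 : nuclearNorm (P * H) ≤ √P.trace * frobNorm H := nuclearNorm_projection_mul_le hs hP H
  have h6 : nuclearNorm ((1 - P) * H * P) ≤ √P.trace * frobNorm H :=
    (nuclearNorm_mul_projection_le hs hP _).trans
      (mul_le_mul_of_nonneg_left hfr' (Real.sqrt_nonneg _))
  have hdec : H = P * H + ((1 - P) * H * P + (1 - P) * H * (1 - P)) := by
    rw [← Matrix.mul_add, add_sub_cancel, Matrix.mul_one, ← Matrix.add_mul, add_sub_cancel,
      Matrix.one_mul]
  have h7 : nuclearNorm H ≤ nuclearNorm (P * H) +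
      (nuclearNorm ((1 - P) * H * P) + nuclearNorm ((1 - P) * H * (1 - P))) := by
    conv_lhs => rw [hdec]
    exact (nuclearNorm_add_le _ _).trans (add_le_add le_rfl (nuclearNorm_add_le _ _))
  linarith

end Projection

end Nuclear

section Deterministic

variable {n p : ℕ}

local notation "𝓔" => EuclideanSpace ℝ (Fin p)
local notation "𝓜" => Matrix (Fin p) (Fin p) ℝ

theorem exists_projection (u v : 𝓔) : ∃ P : 𝓜, P.transpose = P ∧ P * P = P ∧ P.trace ≤ 2 ∧
    Matrix.toLpLin 2 2 P u = u ∧ Matrix.toLpLin 2 2 P v = v := by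
  set V : Submodule ℝ 𝓔 := Submodule.span ℝ {u, v} with hV
  set T : 𝓔 →ₗ[ℝ] 𝓔 := V.starProjection.toLinearMap with hT
  have hTs : Matrix.toLpLin 2 2 ((Matrix.toLpLin 2 2).symm T) = T := LinearEquiv.apply_symm_apply _ _
  refine ⟨(Matrix.toLpLin 2 2).symm T, ?_, ?_, ?_, ?_, ?_⟩
  · apply (Matrix.toLpLin 2 2).injective
    rw [← adjoint_toLpLin, hTs, eq_comm, LinearMap.eq_adjoint_iff]
    exact Submodule.starProjection_isSymmetric V
  · apply (Matrix.toLpLin 2 2).injective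
    rw [Matrix.toLpLin_mul_same, hTs]
    ext1 x
    exact Submodule.starProjection_eq_self_iff.mpr (Submodule.starProjection_apply_mem V x)
  · have h1 : ((Matrix.toLpLin 2 2).symm T).trace = LinearMap.trace ℝ 𝓔 T := by
      rw [LinearMap.trace_eq_sum_inner _ (EuclideanSpace.basisFun (Fin p) ℝ)]
      conv_rhs => rw [← hTs]
      generalize (Matrix.toLpLin 2 2).symm T = Q
      simp [Matrix.trace, Matrix.toLpLin_apply, PiLp.inner_apply]
    have h2 : LinearMap.trace ℝ 𝓔 T = Module.finrank ℝ V := by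
      apply LinearMap.IsProj.trace
      exact ⟨fun x => Submodule.starProjection_apply_mem V x,
        fun x hx => Submodule.starProjection_eq_self_iff.mpr hx⟩
    rw [h1, h2]
    have h3 := finrank_span_finset_le_card (R := ℝ) ({u, v} : Finset 𝓔)
    rw [Finset.coe_pair] at h3
    exact_mod_cast h3.trans Finset.card_le_two
  · rw [hTs]
    exact Submodule.starProjection_eq_self_iff.mpr (Submodule.subset_span (by simp))
  · rw [hTs]
    exact Submodule.starProjection_eq_self_iff.mpr (Submodule.subset_span (by simp))

theorem mul_outer (P : 𝓜) (u v : 𝓔) : P * outer u v = outer (Matrix.toLpLin 2 2 P u) v := by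
  ext j k
  simp [Matrix.mul_apply, outer, Matrix.toLpLin_apply, Matrix.mulVec, dotProduct, Finset.sum_mul,
    mul_assoc]

theorem outer_transpose (u v : 𝓔) : (outer u v).transpose = outer v u := by
  ext j k; simp [outer, mul_comm]

theorem outer_mul (P : 𝓜) (hP : P.transpose = P) (u v : 𝓔) :
    outer u v * P = outer u (Matrix.toLpLin 2 2 P v) := by
  rw [← outer_transpose (Matrix.toLpLin 2 2 P v), ← mul_outer, Matrix.transpose_mul,
    outer_transpose, hP]

theorem matInner_outer_outer (x u v : 𝓔) : matInner (outer x x) (outer u v) = ⟪x, u⟫ * ⟪x, v⟫ := by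
  rw [matInner_comm, matInner_outer_right]
  rw [inner_toLpLin]
  simp only [PiLp.inner_apply, outer, Finset.sum_mul_sum, Matrix.of_apply]
  refine Finset.sum_congr rfl fun j _ => Finset.sum_congr rfl fun k _ => ?_
  simp; ring

/-- The tangent perturbation `β hᵀ + h βᵀ`. -/
def symOuter (β h : 𝓔) : 𝓜 := outer β h + outer h β

theorem matInner_symOuter (x β h : 𝓔) :
    matInner (outer x x) (symOuter β h) = 2 * (⟪x, β⟫ * ⟪x, h⟫) := by
  rw [symOuter, matInner_add_right, matInner_outer_outer, matInner_outer_outer]; ring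

theorem frobNorm_symOuter_le (β h : 𝓔) : frobNorm (symOuter β h) ≤ 2 * (‖β‖ * ‖h‖) := by
  refine (frobNorm_add_le _ _).trans ?_
  rw [frobNorm_outer, frobNorm_outer]; linarith [mul_comm ‖β‖ ‖h‖]

theorem nuclearNorm_symOuter_le (β h : 𝓔) : nuclearNorm (symOuter β h) ≤ 2 * (‖β‖ * ‖h‖) := by
  refine (nuclearNorm_add_le _ _).trans ?_
  linarith [mul_comm ‖β‖ ‖h‖, nuclearNorm_outer_le β h, nuclearNorm_outer_le h β]

theorem le_frobNorm_symOuter (β h : 𝓔) : √2 * (‖β‖ * ‖h‖) ≤ frobNorm (symOuter β h) := by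
  refine abs_le_of_sq_le_sq' ?_ (frobNorm_nonneg _) |>.2
  have h1 : matInner (outer β h) (outer h β) = ⟪β, h⟫ * ⟪β, h⟫ := by
    rw [matInner_outer_right, inner_toLpLin]
    simp only [PiLp.inner_apply, outer, Finset.sum_mul_sum, Matrix.of_apply]
    refine Finset.sum_congr rfl fun j _ => Finset.sum_congr rfl fun k _ => ?_
    simp; ring
  rw [frobNorm_sq, symOuter, matInner_add_left, matInner_add_right, matInner_add_right,
    ← frobNorm_sq, ← frobNorm_sq, frobNorm_outer, frobNorm_outer, matInner_comm (outer h β), h1,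
    mul_pow, Real.sq_sqrt (by norm_num)]
  nlinarith [mul_self_nonneg ⟪β, h⟫]

theorem symOuter_sub (β β' h : 𝓔) : symOuter (β - β') h = symOuter β h - symOuter β' h := by
  ext j k; simp [symOuter, outer]; ring

theorem isSymm_symOuter (β h : 𝓔) : (symOuter β h).IsSymm := by
  rw [Matrix.IsSymm, symOuter, Matrix.transpose_add, outer_transpose, outer_transpose, add_comm]

theorem Kstar_eq (β₁ β₂ : 𝓔) : Kstar β₁ β₂ = (1 / 2 : ℝ) • symOuter β₁ β₂ := rfl

/-- The sum of squares of the empirical linear forms is at most `C² n ‖u‖²`. -/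
def LinearFormBound (C : ℝ) (x : Fin n → 𝓔) : Prop :=
  ∀ u : 𝓔, ∑ i, ⟪x i, u⟫ ^ 2 ≤ C ^ 2 * n * ‖u‖ ^ 2

/-- On the samples in `I`, the `ℓ¹` loss of a symmetric matrix of nuclear norm at most `5` and
Frobenius norm at least `s` is at least `c s |I|`. -/
def QuadraticLowerBound (c s : ℝ) (I : Finset (Fin n)) (x : Fin n → 𝓔) : Prop :=
  ∀ A : 𝓜, A.IsSymm → nuclearNorm A ≤ 5 → s ≤ frobNorm A →
    c * s * I.card ≤ ∑ i ∈ I, |matInner (outer (x i) (x i)) A|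

theorem QuadraticLowerBound.scale {c s : ℝ} {I : Finset (Fin n)} {x : Fin n → 𝓔}
    (h : QuadraticLowerBound c s I x) {A : 𝓜} (hA : A.IsSymm) {N : ℝ} (hN : 0 < N)
    (h5 : nuclearNorm A ≤ 5 * N) (hs : s * N ≤ frobNorm A) :
    c * s * I.card * N ≤ ∑ i ∈ I, |matInner (outer (x i) (x i)) A| := by
  have h1 := h (N⁻¹ • A) (by rw [Matrix.IsSymm, Matrix.transpose_smul, hA])
    ((nuclearNorm_smul_le (by positivity) A).trans (by
      rw [inv_mul_le_iff₀ hN]; linarith))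
    (by rw [frobNorm_smul, abs_of_pos (by positivity), le_inv_mul_iff₀ hN]; linarith)
  simp only [matInner_smul_right, abs_mul, abs_of_pos (inv_pos.mpr hN), ← Finset.mul_sum] at h1
  rw [le_inv_mul_iff₀ hN] at h1
  linarith

theorem separation_denominator_pos {β₁ β₂ : 𝓔} (h : 0 < separation β₁ β₂) :
    0 < ‖β₁‖ ^ 2 + ‖β₂‖ ^ 2 := by
  by_contra! h'
  have : ‖β₁‖ ^ 2 + ‖β₂‖ ^ 2 = 0 := le_antisymm h' (by positivity)
  simp [separation, this] at h

theorem separation_le_two (β₁ β₂ : 𝓔) : separation β₁ β₂ ≤ 2 := by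
  refine div_le_of_le_mul₀ (by positivity) (by norm_num) ?_
  nlinarith [norm_sub_le β₁ β₂, norm_nonneg (β₁ - β₂), sq_nonneg (‖β₁‖ - ‖β₂‖)]

theorem sqrt_separation_mul_le {β₁ β₂ : 𝓔} (h : 0 < separation β₁ β₂) :
    √(separation β₁ β₂) * (‖β₁‖ + ‖β₂‖) ≤ √2 * ‖β₁ - β₂‖ := by
  have hD := separation_denominator_pos h
  refine abs_le_of_sq_le_sq' ?_ (by positivity) |>.2
  rw [mul_pow, mul_pow, Real.sq_sqrt h.le, Real.sq_sqrt (by norm_num), separation,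
    div_mul_eq_mul_div, div_le_iff₀ hD]
  nlinarith [mul_nonneg (sq_nonneg ‖β₁ - β₂‖) (sq_nonneg (‖β₁‖ - ‖β₂‖))]

theorem norm_add_norm_pos {β₁ β₂ : 𝓔} (h : 0 < separation β₁ β₂) : 0 < ‖β₁‖ + ‖β₂‖ := by
  by_contra! h'
  have := separation_denominator_pos h
  have h1 : ‖β₁‖ = 0 := by linarith [norm_nonneg β₁, norm_nonneg β₂]
  have h2 : ‖β₂‖ = 0 := by linarith [norm_nonneg β₁, norm_nonneg β₂]
  simp [h1, h2] at this

/-- One of the two perturbed matrices is not much smaller than the total error. -/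
theorem le_frobNorm_sub_symOuter {β₁ β₂ : 𝓔} (hα : 0 < separation β₁ β₂) (H : 𝓜) (h : 𝓔) :
    √(separation β₁ β₂) / 6 * (frobNorm H + (‖β₁‖ + ‖β₂‖) * ‖h‖) ≤
        frobNorm (H - symOuter β₁ h) ∨
      √(separation β₁ β₂) / 6 * (frobNorm H + (‖β₁‖ + ‖β₂‖) * ‖h‖) ≤
        frobNorm (H - symOuter β₂ h) := by
  by_contra! hcon
  obtain ⟨hc1, hc2⟩ := hcon
  have hB := sqrt_separation_mul_le hα
  set a := √(separation β₁ β₂) with ha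
  have ha0 : 0 ≤ a := Real.sqrt_nonneg _
  have ha2 : a ≤ 3 / 2 := by
    rw [ha, Real.sqrt_le_left (by norm_num)]
    linarith [separation_le_two β₁ β₂]
  have h1 : √2 * (‖β₁ - β₂‖ * ‖h‖) ≤
      frobNorm (H - symOuter β₁ h) + frobNorm (H - symOuter β₂ h) := by
    refine (le_frobNorm_symOuter _ _).trans ?_
    have := frobNorm_add_le (H - symOuter β₂ h) (-(H - symOuter β₁ h))
    rw [frobNorm_neg] at this
    rw [symOuter_sub, show symOuter β₁ h - symOuter β₂ h =
      H - symOuter β₂ h + -(H - symOuter β₁ h) by abel]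
    linarith
  have h2 : ∀ β : 𝓔, frobNorm H ≤ frobNorm (H - symOuter β h) + 2 * (‖β‖ * ‖h‖) := by
    intro β
    have := frobNorm_add_le (H - symOuter β h) (symOuter β h)
    rw [sub_add_cancel] at this
    linarith [frobNorm_symOuter_le β h]
  have h3 : a * (‖β₁‖ + ‖β₂‖) * ‖h‖ ≤ √2 * (‖β₁ - β₂‖ * ‖h‖) := by
    rw [← mul_assoc]; exact mul_le_mul_of_nonneg_right hB (norm_nonneg _)
  have h4 := h2 β₁
  have h5 := h2 β₂
  have h6 := frobNorm_nonneg (H - symOuter β₁ h)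
  have h7 := frobNorm_nonneg (H - symOuter β₂ h)
  set S := frobNorm (H - symOuter β₁ h) + frobNorm (H - symOuter β₂ h) with hS
  have h8 : a * frobNorm H ≤ a * (S / 2 + (‖β₁‖ + ‖β₂‖) * ‖h‖) :=
    mul_le_mul_of_nonneg_left (by linarith) ha0
  nlinarith

theorem LinearFormBound.sum_abs_mul_le {C : ℝ} (hC : 0 ≤ C) {x : Fin n → 𝓔}
    (hx : LinearFormBound C x) (e : EuclideanSpace ℝ (Fin n)) (u : 𝓔) :
    ∑ i, |e i * ⟪x i, u⟫| ≤ C * √n * ‖e‖ * ‖u‖ := by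
  have h1 := Real.sum_mul_le_sqrt_mul_sqrt Finset.univ (fun i => |e i|) (fun i => |⟪x i, u⟫|)
  simp only [← abs_mul, sq_abs] at h1
  refine h1.trans ?_
  have h2 : √(∑ i, ⟪x i, u⟫ ^ 2) ≤ C * √n * ‖u‖ := by
    rw [Real.sqrt_le_left (by positivity), mul_pow, mul_pow, Real.sq_sqrt (by positivity)]
    exact hx u
  have h3 : √(∑ i, e i ^ 2) = ‖e‖ := by rw [EuclideanSpace.norm_eq]; simp
  rw [h3]
  calc ‖e‖ * √(∑ i, ⟪x i, u⟫ ^ 2) ≤ ‖e‖ * (C * √n * ‖u‖) :=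
        mul_le_mul_of_nonneg_left h2 (norm_nonneg _)
    _ = _ := by ring

/-- The `ℓ¹` loss at the planted pair `(K*, g*)`. -/
theorem l1Loss_star_le {C : ℝ} (hC : 0 ≤ C) {x : Fin n → 𝓔} (hx : LinearFormBound C x)
    (I₁ : Finset (Fin n)) (β₁ β₂ : 𝓔) (e : EuclideanSpace ℝ (Fin n)) :
    l1Loss x (response I₁ β₁ β₂ x e) (Kstar β₁ β₂) (gstar β₁ β₂) ≤
      C * √n * ‖e‖ * ‖β₁ - β₂‖ + ‖e‖ ^ 2 := by
  have h1 := hx.sum_abs_mul_le hC e (β₁ - β₂)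
  have h3 : ∑ i, e i ^ 2 = ‖e‖ ^ 2 := by rw [EuclideanSpace.norm_sq_eq]; simp
  rw [← h3]
  refine le_trans ?_ (add_le_add h1 le_rfl)
  rw [l1Loss, ← Finset.sum_add_distrib]
  refine Finset.sum_le_sum fun i _ => ?_
  rw [Kstar_eq, matInner_smul_right, matInner_symOuter, gstar, inner_smul_right, inner_add_right,
    inner_sub_right, response, ← abs_of_nonneg (sq_nonneg (e i))]
  by_cases hi : i ∈ I₁
  · rw [if_pos hi]
    have : -(1 / 2 * (2 * (⟪x i, β₁⟫ * ⟪x i, β₂⟫))) +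
        2 * (⟪x i, β₁⟫ + e i) * (1 / 2 * (⟪x i, β₁⟫ + ⟪x i, β₂⟫)) - (⟪x i, β₁⟫ + e i) ^ 2 =
        -(e i * (⟪x i, β₁⟫ - ⟪x i, β₂⟫) + e i ^ 2) := by ring
    rw [this, abs_neg]
    exact abs_add_le _ _
  · rw [if_neg hi]
    have : -(1 / 2 * (2 * (⟪x i, β₁⟫ * ⟪x i, β₂⟫))) +
        2 * (⟪x i, β₂⟫ + e i) * (1 / 2 * (⟪x i, β₁⟫ + ⟪x i, β₂⟫)) - (⟪x i, β₂⟫ + e i) ^ 2 =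
        e i * (⟪x i, β₁⟫ - ⟪x i, β₂⟫) + -e i ^ 2 := by ring
    rw [this, ← abs_neg (e i ^ 2)]
    exact abs_add_le _ _

/-- Two feasible pairs have close fitted values on each of the two groups. -/
theorem sum_abs_matInner_sub_symOuter_le {C η : ℝ} (hC : 0 ≤ C) {x : Fin n → 𝓔}
    (hx : LinearFormBound C x) (I₁ I : Finset (Fin n)) (β₁ β₂ β : 𝓔)
    (e : EuclideanSpace ℝ (Fin n)) {K K' : 𝓜} {g g' : 𝓔}
    (hK : l1Loss x (response I₁ β₁ β₂ x e) K g ≤ η)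
    (hK' : l1Loss x (response I₁ β₁ β₂ x e) K' g' ≤ η)
    (hI : ∀ i ∈ I, response I₁ β₁ β₂ x e i = ⟪x i, β⟫ + e i) :
    ∑ i ∈ I, |matInner (outer (x i) (x i)) (K - K' - symOuter β (g - g'))| ≤
      2 * η + 2 * (C * √n * ‖e‖ * ‖g - g'‖) := by
  have h1 := hx.sum_abs_mul_le hC e (g - g')
  set y := response I₁ β₁ β₂ x e with hy
  set r : 𝓜 → 𝓔 → Fin n → ℝ :=
    fun K g i => -matInner (outer (x i) (x i)) K + 2 * y i * ⟪x i, g⟫ - y i ^ 2 with hr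
  calc ∑ i ∈ I, |matInner (outer (x i) (x i)) (K - K' - symOuter β (g - g'))|
      ≤ ∑ i ∈ I, (|r K g i| + |r K' g' i| + 2 * |e i * ⟪x i, g - g'⟫|) := by
        refine Finset.sum_le_sum fun i hi => ?_
        have hi' := hI i hi
        have : matInner (outer (x i) (x i)) (K - K' - symOuter β (g - g')) =
            -r K g i + r K' g' i + 2 * (e i * ⟪x i, g - g'⟫) := by
          rw [matInner_sub_right, matInner_sub_right, matInner_symOuter, inner_sub_right]
          simp only [hr, hi']
          ring
        rw [this]
        refine (abs_add_le _ _).trans ?_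
        rw [abs_mul, abs_of_nonneg (zero_le_two (α := ℝ))]
        refine add_le_add ((abs_add_le _ _).trans ?_) le_rfl
        rw [abs_neg]
    _ ≤ ∑ i, (|r K g i| + |r K' g' i| + 2 * |e i * ⟪x i, g - g'⟫|) :=
        Finset.sum_le_univ_sum_of_nonneg fun i => by positivity
    _ ≤ _ := by
        rw [Finset.sum_add_distrib, Finset.sum_add_distrib, ← Finset.mul_sum]
        rw [l1Loss] at hK hK'
        linarith

/-- The deterministic part of the analysis of the convex program. -/
theorem error_le_of_isOptimal {C c k η : ℝ} (hC : 0 < C) (hc : 0 < c) (hk : 0 < k) (hn : 0 < n)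
    {x : Fin n → 𝓔} {I₁ : Finset (Fin n)} {β₁ β₂ : 𝓔} (hα : 0 < separation β₁ β₂)
    (hx : LinearFormBound C x)
    (h₁ : QuadraticLowerBound c (√(separation β₁ β₂) / 6) I₁ x)
    (h₂ : QuadraticLowerBound c (√(separation β₁ β₂) / 6) I₁ᶜ x)
    (hn₁ : (n : ℝ) ≤ k * I₁.card) (hn₂ : (n : ℝ) ≤ k * I₁ᶜ.card)
    {e : EuclideanSpace ℝ (Fin n)}
    (hη : (C + 2 / (24 * C * k / c)) * √n * ‖e‖ * ‖β₂ - β₁‖ ≤ η)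
    (he : ‖e‖ ≤ √(separation β₁ β₂) / (24 * C * k / c) * √n * (‖β₁‖ + ‖β₂‖))
    {K : 𝓜} {g : 𝓔} (hK : IsOptimal {A | A.IsSymm} x (response I₁ β₁ β₂ x e) η K g) :
    frobNorm (K - Kstar β₁ β₂) + (‖β₁‖ + ‖β₂‖) * ‖g - gstar β₁ β₂‖ ≤
      24 * k / c * (η / (√(separation β₁ β₂) * n)) := by
  have hBpos := norm_add_norm_pos hα
  have hB := sqrt_separation_mul_le hα
  have hmain := le_frobNorm_sub_symOuter hα (K - Kstar β₁ β₂) (g - gstar β₁ β₂)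
  have hc5 : 0 < 24 * C * k / c := by positivity
  have hn' : (0 : ℝ) < n := by exact_mod_cast hn
  have hsn : √(n : ℝ) * √(n : ℝ) = n := Real.mul_self_sqrt hn'.le
  have hstar : l1Loss x (response I₁ β₁ β₂ x e) (Kstar β₁ β₂) (gstar β₁ β₂) ≤ η := by
    refine ((l1Loss_star_le hC.le hx I₁ β₁ β₂ e).trans ?_).trans hη
    have h2 : √2 ≤ 2 := by rw [Real.sqrt_le_left] <;> norm_num
    have : ‖e‖ ≤ 2 / (24 * C * k / c) * √n * ‖β₁ - β₂‖ := by
      refine he.trans ?_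
      calc √(separation β₁ β₂) / (24 * C * k / c) * √n * (‖β₁‖ + ‖β₂‖) =
          (√(separation β₁ β₂) * (‖β₁‖ + ‖β₂‖)) * (√n / (24 * C * k / c)) := by ring
        _ ≤ (2 * ‖β₁ - β₂‖) * (√n / (24 * C * k / c)) := by
          refine mul_le_mul_of_nonneg_right (hB.trans ?_) (by positivity)
          exact mul_le_mul_of_nonneg_right h2 (norm_nonneg _)
        _ = _ := by ring
    rw [norm_sub_rev β₂ β₁]
    have := mul_le_mul_of_nonneg_left this (norm_nonneg e)
    nlinarith
  have hKs : (Kstar β₁ β₂).IsSymm := by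
    rw [Kstar_eq, Matrix.IsSymm, Matrix.transpose_smul, isSymm_symOuter]
  have hHs : (K - Kstar β₁ β₂).IsSymm := by
    have : K.IsSymm := hK.mem
    rw [Matrix.IsSymm, Matrix.transpose_sub, hKs, this]
  have hnuc : nuclearNorm (K - Kstar β₁ β₂) ≤ 5 * frobNorm (K - Kstar β₁ β₂) := by
    obtain ⟨P, hPs, hP, hPt, hP₁, hP₂⟩ := exists_projection β₁ β₂
    have h1 := nuclearNorm_le_of_nuclearNorm_add_le hPs hP (A := Kstar β₁ β₂)
      (H := K - Kstar β₁ β₂)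
      (by rw [Kstar_eq, symOuter, Matrix.mul_smul, Matrix.mul_add, mul_outer, mul_outer, hP₁, hP₂])
      (by rw [Kstar_eq, symOuter, Matrix.smul_mul, Matrix.add_mul, outer_mul P hPs,
        outer_mul P hPs, hP₁, hP₂])
      (by rw [add_sub_cancel]; exact hK.optimal _ hKs _ hstar)
    refine h1.trans (mul_le_mul_of_nonneg_right ?_ (frobNorm_nonneg _))
    have : √P.trace ≤ 5 / 3 := by
      rw [Real.sqrt_le_left (by norm_num)]; linarith
    linarith
  set H := K - Kstar β₁ β₂ with hH
  set h := g - gstar β₁ β₂ with hh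
  set N := frobNorm H + (‖β₁‖ + ‖β₂‖) * ‖h‖ with hN
  have hN0 : 0 ≤ N := add_nonneg (frobNorm_nonneg _) (by positivity)
  have hη0 : 0 ≤ η := le_trans (by positivity) hη
  set a := √(separation β₁ β₂) with ha
  have ha0 : 0 < a := Real.sqrt_pos.mpr hα
  rcases hN0.eq_or_lt with h0 | h0
  · rw [← h0]; positivity
  have hnucA : ∀ β : 𝓔, ‖β‖ ≤ ‖β₁‖ + ‖β₂‖ → nuclearNorm (H - symOuter β h) ≤ 5 * N := by
    intro β hβ
    have h1 := nuclearNorm_add_le H (-symOuter β h)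
    rw [← sub_eq_add_neg] at h1
    have h2 := nuclearNorm_neg_le (symOuter β h)
    have h3 := nuclearNorm_symOuter_le β h
    have h4 := mul_le_mul_of_nonneg_right hβ (norm_nonneg h)
    have h5 : 0 ≤ (‖β₁‖ + ‖β₂‖) * ‖h‖ := by positivity
    rw [hN]
    linarith
  have hfin : ∀ (β : 𝓔) (I : Finset (Fin n)), ‖β‖ ≤ ‖β₁‖ + ‖β₂‖ → (n : ℝ) ≤ k * I.card →
      QuadraticLowerBound c (a / 6) I x →
      (∀ i ∈ I, response I₁ β₁ β₂ x e i = ⟪x i, β⟫ + e i) →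
      a / 6 * N ≤ frobNorm (H - symOuter β h) → N ≤ 24 * k / c * (η / (a * n)) := by
    intro β I hβ hI hq hr hf
    have hs : (H - symOuter β h).IsSymm := by
      rw [Matrix.IsSymm, Matrix.transpose_sub, hHs, isSymm_symOuter]
    have h1 := hq.scale hs h0 (hnucA β hβ) hf
    have h2 := sum_abs_matInner_sub_symOuter_le hC.le hx I₁ I β₁ β₂ β e hK.feasible hstar hr
    have h3 := h1.trans h2
    have h4 : C * √n * ‖e‖ * ‖h‖ ≤ c / (24 * k) * (a * n) * N := by
      calc C * √n * ‖e‖ * ‖h‖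
          ≤ C * √n * (a / (24 * C * k / c) * √n * (‖β₁‖ + ‖β₂‖)) * ‖h‖ := by gcongr
        _ = c / (24 * k) * (a * (√n * √n)) * ((‖β₁‖ + ‖β₂‖) * ‖h‖) := by
            field_simp
        _ = c / (24 * k) * (a * n) * ((‖β₁‖ + ‖β₂‖) * ‖h‖) := by rw [hsn]
        _ ≤ c / (24 * k) * (a * n) * N := by
            refine mul_le_mul_of_nonneg_left ?_ (by positivity)
            rw [hN]; linarith [frobNorm_nonneg H]
    have h5 : c / (6 * k) * (a * n) * N ≤ c * (a / 6) * I.card * N := by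
      have : c / (6 * k) * (a * n) ≤ c * (a / 6) * I.card := by
        calc c / (6 * k) * (a * n) ≤ c / (6 * k) * (a * (k * I.card)) := by gcongr
          _ = _ := by field_simp
      exact mul_le_mul_of_nonneg_right this hN0
    have h6 : c / (12 * k) * (a * n) * N ≤ 2 * η := by
      have e1 : c / (6 * k) * (a * n) * N = 2 * (c / (12 * k) * (a * n) * N) := by
        field_simp; norm_num
      have e2 : 2 * (c / (24 * k) * (a * n) * N) = c / (12 * k) * (a * n) * N := by
        field_simp; norm_num
      linarith
    have e3 : 24 * k / c * (η / (a * n)) = 2 * η / (c / (12 * k) * (a * n)) := by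
      field_simp; ring
    rw [e3, le_div_iff₀ (by positivity)]
    linarith
  rcases hmain with hm | hm
  · exact hfin β₁ I₁ (by linarith [norm_nonneg β₂]) hn₁ h₁
      (fun i hi => by simp [response, hi]) hm
  · exact hfin β₂ I₁ᶜ (by linarith [norm_nonneg β₁]) hn₂ h₂
      (fun i hi => by simp [response, Finset.mem_compl.mp hi]) hm

theorem isSymm_symPart (K : 𝓜) : (symPart K).IsSymm := by
  rw [Matrix.IsSymm, symPart, Matrix.transpose_smul, Matrix.transpose_add,
    Matrix.transpose_transpose, add_comm]

theorem matInner_outer_symPart (x : 𝓔) (K : 𝓜) :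
    matInner (outer x x) (symPart K) = matInner (outer x x) K := by
  rw [symPart, matInner_smul_right, matInner_add_right, ← matInner_transpose, outer_transpose]
  ring

/-- The symmetric part of an optimal solution over all matrices is optimal over the symmetric
matrices. -/
theorem IsOptimal.symPart {x : Fin n → 𝓔} {y : Fin n → ℝ} {η : ℝ} {K : 𝓜} {g : 𝓔}
    (h : IsOptimal Set.univ x y η K g) : IsOptimal {A | A.IsSymm} x y η (symPart K) g where
  mem := isSymm_symPart K
  feasible := by simpa only [l1Loss, matInner_outer_symPart] using h.feasible
  optimal K' _ g' hf := (nuclearNorm_symPart_le K).trans (h.optimal K' (Set.mem_univ _) g' hf)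

end Deterministic

section ProductIntegrals

variable {X : Type*} [MeasurableSpace X] (ρ : Measure X) [IsProbabilityMeasure ρ]

theorem measurePreserving_finCons (m : ℕ) :
    MeasurePreserving (fun q : X × (Fin m → X) => (Fin.cons q.1 q.2 : Fin (m + 1) → X))
      (ρ.prod (Measure.pi fun _ => ρ)) (Measure.pi fun _ => ρ) := by
  have h := (measurePreserving_piFinSuccAbove (fun _ : Fin (m + 1) => ρ) 0).symm
  convert h using 1
  ext q i
  simp [MeasurableEquiv.piFinSuccAbove]

theorem integral_pi_succ {m : ℕ} {f : (Fin (m + 1) → X) → ℝ}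
    (hf : Integrable f (Measure.pi fun _ => ρ)) :
    ∫ x, f x ∂(Measure.pi fun _ => ρ) =
      ∫ t, ∫ y, f (Fin.cons t y) ∂(Measure.pi fun _ => ρ) ∂ρ := by
  have hmp := measurePreserving_finCons ρ m
  rw [← hmp.map_eq, integral_map hmp.measurable.aemeasurable
    (by rw [hmp.map_eq]; exact hf.aestronglyMeasurable)]
  exact integral_prod _ (hmp.integrable_comp_of_integrable hf)

theorem integrable_finCons {m : ℕ} {f : (Fin (m + 1) → X) → ℝ}
    (hf : Integrable f (Measure.pi fun _ => ρ)) :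
    Integrable (fun q : X × (Fin m → X) => f (Fin.cons q.1 q.2))
      (ρ.prod (Measure.pi fun _ => ρ)) :=
  (measurePreserving_finCons ρ m).integrable_comp_of_integrable hf

end ProductIntegrals

section BoundedDifferences

variable {X : Type*} [MeasurableSpace X] (ρ : Measure X) [IsProbabilityMeasure ρ]

theorem integrable_of_abs_le {Y : Type*} [MeasurableSpace Y] (ν : Measure Y) [IsFiniteMeasure ν]
    {f : Y → ℝ} (hf : Measurable f) {B : ℝ} (hB : ∀ y, |f y| ≤ B) : Integrable f ν :=
  Integrable.of_bound hf.aestronglyMeasurable B (Filter.Eventually.of_forall hB)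

/-- Hoeffding's lemma for a function of bounded oscillation. -/
theorem integral_exp_le_of_oscillation {g : X → ℝ} (hg : Measurable g) {c : ℝ} (hc : 0 ≤ c)
    (h : ∀ t t', g t ≤ g t' + c) (l : ℝ) :
    Integrable (fun t => Real.exp (l * (g t - ∫ s, g s ∂ρ))) ρ ∧
    ∫ t, Real.exp (l * (g t - ∫ s, g s ∂ρ)) ∂ρ ≤ Real.exp (l ^ 2 * c ^ 2 / 8) := by
  have : Nonempty X := nonempty_of_isProbabilityMeasure ρ
  have hbdd : BddBelow (Set.range g) := by
    obtain ⟨t₀⟩ := this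
    exact ⟨g t₀ - c, by rintro _ ⟨t, rfl⟩; linarith [h t₀ t]⟩
  have hmem : ∀ t, g t ∈ Set.Icc (⨅ s, g s) ((⨅ s, g s) + c) := fun t =>
    ⟨ciInf_le hbdd t, by
      rw [← sub_le_iff_le_add]
      exact le_ciInf fun s => by linarith [h t s]⟩
  have hsub := hasSubgaussianMGF_of_mem_Icc (μ := ρ) hg.aemeasurable
    (Filter.Eventually.of_forall hmem)
  refine ⟨hsub.integrable_exp_mul l, (hsub.mgf_le l).trans (le_of_eq ?_)⟩
  congr 1
  push_cast
  rw [add_sub_cancel_left, Real.norm_of_nonneg hc]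
  ring

theorem integral_exp_le_of_boundedDifferences {c : ℝ} (hc : 0 ≤ c) (l : ℝ) (m : ℕ) :
    ∀ (f : (Fin m → X) → ℝ), Measurable f → (∃ B, ∀ x, |f x| ≤ B) →
      (∀ x i t, f (Function.update x i t) ≤ f x + c) →
      ∫ x, Real.exp (l * (f x - ∫ y, f y ∂(Measure.pi fun _ => ρ))) ∂(Measure.pi fun _ => ρ) ≤
        Real.exp (m * (l ^ 2 * c ^ 2 / 8)) := by
  induction m with
  | zero =>
    intro f _ _ _
    have : ∀ x, f x = f default := fun x => congrArg f (Subsingleton.elim _ _)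
    simp [this]
  | succ m ih =>
    rintro f hf ⟨B, hB⟩ hd
    have hfi := integrable_of_abs_le (Measure.pi fun _ : Fin (m + 1) => ρ) hf hB
    have hcons := (measurePreserving_finCons ρ m).measurable
    have hfc : Measurable fun q : X × (Fin m → X) => f (Fin.cons q.1 q.2) := hf.comp hcons
    have hfct : ∀ t, Measurable fun y : Fin m → X => f (Fin.cons t y) :=
      fun t => hfc.comp measurable_prodMk_left
    set g : X → ℝ := fun t => ∫ y, f (Fin.cons t y) ∂(Measure.pi fun _ => ρ) with hg
    have hgm : Measurable g := (hfc.stronglyMeasurable.integral_prod_right).measurable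
    have hint : ∀ t, Integrable (fun y : Fin m → X => f (Fin.cons t y)) (Measure.pi fun _ => ρ) :=
      fun t => integrable_of_abs_le _ (hfct t) fun y => hB _
    have hEf : ∫ x, f x ∂(Measure.pi fun _ => ρ) = ∫ t, g t ∂ρ := integral_pi_succ ρ hfi
    have hosc : ∀ t t', g t ≤ g t' + c := by
      intro t t'
      have h1 : ∀ y : Fin m → X, f (Fin.cons t y) ≤ f (Fin.cons t' y) + c := by
        intro y
        have := hd (Fin.cons t' y) 0 t
        rwa [Fin.update_cons_zero] at this
      have h2 := integral_mono (hint t) ((hint t').add (integrable_const c)) h1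
      simp only [Pi.add_apply] at h2
      rw [integral_add (hint t') (integrable_const c)] at h2
      simpa using h2
    obtain ⟨hgi, hge⟩ := integral_exp_le_of_oscillation ρ hgm hc hosc l
    have hbd : ∀ x, |Real.exp (l * (f x - ∫ t, g t ∂ρ))| ≤
        Real.exp (|l| * (B + |∫ t, g t ∂ρ|)) := by
      intro x
      rw [abs_of_pos (Real.exp_pos _), Real.exp_le_exp]
      refine (le_abs_self _).trans ?_
      rw [abs_mul]
      refine mul_le_mul_of_nonneg_left ((abs_sub _ _).trans ?_) (abs_nonneg _)
      exact add_le_add (hB x) le_rfl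
    have hexpi := integrable_of_abs_le (Measure.pi fun _ : Fin (m + 1) => ρ)
      (f := fun x => Real.exp (l * (f x - ∫ t, g t ∂ρ))) (by fun_prop) hbd
    rw [hEf, integral_pi_succ ρ hexpi]
    have hstep : ∀ t, ∫ y, Real.exp (l * (f (Fin.cons t y) - ∫ t, g t ∂ρ))
        ∂(Measure.pi fun _ : Fin m => ρ) ≤
        Real.exp (l * (g t - ∫ s, g s ∂ρ)) * Real.exp (m * (l ^ 2 * c ^ 2 / 8)) := by
      intro t
      have h1 := ih (fun y => f (Fin.cons t y)) (hfct t) ⟨B, fun y => hB _⟩ (by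
        intro y i s
        have := hd (Fin.cons t y) i.succ s
        rwa [← Fin.cons_update] at this)
      have h2 : ∀ y : Fin m → X, Real.exp (l * (f (Fin.cons t y) - ∫ t, g t ∂ρ)) =
          Real.exp (l * (g t - ∫ s, g s ∂ρ)) * Real.exp (l * (f (Fin.cons t y) - g t)) := by
        intro y; rw [← Real.exp_add]; congr 1; ring
      simp_rw [h2]
      rw [integral_const_mul]
      exact mul_le_mul_of_nonneg_left h1 (Real.exp_pos _).le
    calc _ ≤ ∫ t, Real.exp (l * (g t - ∫ s, g s ∂ρ)) * Real.exp (m * (l ^ 2 * c ^ 2 / 8)) ∂ρ :=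
          integral_mono (integrable_finCons ρ hexpi).integral_prod_left (hgi.mul_const _) hstep
      _ ≤ Real.exp (l ^ 2 * c ^ 2 / 8) * Real.exp (m * (l ^ 2 * c ^ 2 / 8)) := by
          rw [integral_mul_const]
          exact mul_le_mul_of_nonneg_right hge (Real.exp_pos _).le
      _ = _ := by rw [← Real.exp_add]; congr 1; push_cast; ring

/-- McDiarmid's bounded difference inequality. -/
theorem measureReal_ge_le_of_boundedDifferences {c : ℝ} (hc : 0 < c) {m : ℕ} (hm : 0 < m)
    {f : (Fin m → X) → ℝ} (hf : Measurable f) (hB : ∃ B, ∀ x, |f x| ≤ B)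
    (hd : ∀ x i t, f (Function.update x i t) ≤ f x + c) {t : ℝ} (ht : 0 ≤ t) :
    (Measure.pi fun _ => ρ).real {x | ∫ y, f y ∂(Measure.pi fun _ => ρ) + t ≤ f x} ≤
      Real.exp (-(2 * t ^ 2 / (m * c ^ 2))) := by
  have hm' : (0 : ℝ) < m := by exact_mod_cast hm
  set l : ℝ := 4 * t / (m * c ^ 2) with hl
  have hl0 : 0 ≤ l := by positivity
  set E := ∫ y, f y ∂(Measure.pi fun _ => ρ) with hE
  have h1 := integral_exp_le_of_boundedDifferences ρ hc.le l m f hf hB hd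
  obtain ⟨B, hB⟩ := hB
  have hbd : ∀ x, |Real.exp (l * (f x - E))| ≤ Real.exp (|l| * (B + |E|)) := by
    intro x
    rw [abs_of_pos (Real.exp_pos _), Real.exp_le_exp]
    refine (le_abs_self _).trans ?_
    rw [abs_mul]
    refine mul_le_mul_of_nonneg_left ((abs_sub _ _).trans ?_) (abs_nonneg _)
    exact add_le_add (hB x) le_rfl
  have hexpi := integrable_of_abs_le (Measure.pi fun _ : Fin m => ρ)
    (f := fun x => Real.exp (l * (f x - E))) (by fun_prop) hbd
  have h2 := mul_meas_ge_le_integral_of_nonneg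
    (Filter.Eventually.of_forall fun x => (Real.exp_pos (l * (f x - E))).le) hexpi
    (Real.exp (l * t))
  have h3 : {x | E + t ≤ f x} ⊆ {x | Real.exp (l * t) ≤ Real.exp (l * (f x - E))} := by
    intro x hx
    simp only [Set.mem_ofPred_eq] at hx ⊢
    exact Real.exp_le_exp.mpr (mul_le_mul_of_nonneg_left (by linarith) hl0)
  have h4 := measureReal_mono (μ := Measure.pi fun _ : Fin m => ρ) h3
  refine h4.trans ?_
  rw [← hE] at h1
  have h5 := h2.trans h1
  rw [mul_comm, ← le_div_iff₀ (Real.exp_pos _), ← Real.exp_sub] at h5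
  refine h5.trans (le_of_eq ?_)
  congr 1
  rw [hl]; field_simp; ring

end BoundedDifferences

section Symmetrization

variable {κ : Type*} {D : Finset κ} (hD : D.Nonempty)

theorem integrable_sup' {Y : Type*} [MeasurableSpace Y] {ν : Measure Y} {F : κ → Y → ℝ}
    (hF : ∀ A, Integrable (F A) ν) : Integrable (fun y => D.sup' hD fun A => F A y) ν := by
  have : (fun y => D.sup' hD fun A => F A y) = D.sup' hD F := by
    ext y; rw [Finset.sup'_apply]
  rw [this]
  exact Finset.sup'_induction hD F (p := fun f => Integrable f ν)
    (fun _ h _ h' => Integrable.sup h h') fun A _ => hF A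

theorem integrable_sum_pi {X : Type*} [MeasurableSpace X] (ρ : Measure X) [IsProbabilityMeasure ρ]
    {m : ℕ} {F : X → ℝ} (hF : Integrable F ρ) (a : ℝ) :
    Integrable (fun x : Fin m → X => a + ∑ i, F (x i)) (Measure.pi fun _ => ρ) :=
  (integrable_const a).add (integrable_finsetSum _ fun i _ =>
    (measurePreserving_eval (fun _ : Fin m => ρ) i).integrable_comp_of_integrable hF)

/-- A one-coordinate comparison of expected suprema tensorizes. -/
theorem integral_sup'_pi_le {X X' : Type*} [MeasurableSpace X] [MeasurableSpace X']
    (ρ : Measure X) (ρ' : Measure X') [IsProbabilityMeasure ρ] [IsProbabilityMeasure ρ']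
    {F : κ → X → ℝ} {G : κ → X' → ℝ} (hF : ∀ A, Integrable (F A) ρ)
    (hG : ∀ A, Integrable (G A) ρ')
    (h : ∀ a : κ → ℝ, ∫ x, D.sup' hD (fun A => a A + F A x) ∂ρ ≤
      ∫ x, D.sup' hD (fun A => a A + G A x) ∂ρ') (m : ℕ) :
    ∀ a : κ → ℝ, ∫ x, D.sup' hD (fun A => a A + ∑ i, F A (x i)) ∂(Measure.pi fun _ : Fin m => ρ) ≤
      ∫ x, D.sup' hD (fun A => a A + ∑ i, G A (x i)) ∂(Measure.pi fun _ : Fin m => ρ') := by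
  induction m with
  | zero => intro a; simp
  | succ m ih =>
    intro a
    have hiF : ∀ k : ℕ, Integrable (fun x : Fin k → X => D.sup' hD fun A => a A + ∑ i, F A (x i))
        (Measure.pi fun _ => ρ) :=
      fun k => integrable_sup' hD fun A => integrable_sum_pi ρ (hF A) (a A)
    have hiG : ∀ k : ℕ, Integrable (fun x : Fin k → X' => D.sup' hD fun A => a A + ∑ i, G A (x i))
        (Measure.pi fun _ => ρ') :=
      fun k => integrable_sup' hD fun A => integrable_sum_pi ρ' (hG A) (a A)
    rw [integral_pi_succ ρ (hiF _), integral_pi_succ ρ' (hiG _)]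
    have hmix : Integrable (fun q : X × (Fin m → X') =>
        D.sup' hD fun A => a A + F A q.1 + ∑ i, G A (q.2 i)) (ρ.prod (Measure.pi fun _ => ρ')) := by
      refine integrable_sup' hD fun A => ?_
      have h1 : Integrable (fun q : X × (Fin m → X') => F A q.1)
          (ρ.prod (Measure.pi fun _ => ρ')) := (hF A).comp_fst _
      have h2 : Integrable (fun q : X × (Fin m → X') => a A + ∑ i, G A (q.2 i))
          (ρ.prod (Measure.pi fun _ => ρ')) := (integrable_sum_pi ρ' (hG A) (a A)).comp_snd _
      refine (h1.add h2).congr (Filter.Eventually.of_forall fun q => ?_)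
      simp only [Pi.add_apply]; ring
    have hiF' := integrable_finCons ρ (hiF (m + 1))
    have hiG' := integrable_finCons ρ' (hiG (m + 1))
    simp only [Fin.sum_univ_succ, Fin.cons_zero, Fin.cons_succ, ← add_assoc] at hiF' hiG' ⊢
    calc ∫ t, ∫ y, D.sup' hD (fun A => a A + F A t + ∑ i, F A (y i))
          ∂(Measure.pi fun _ : Fin m => ρ) ∂ρ
        ≤ ∫ t, ∫ y, D.sup' hD (fun A => a A + F A t + ∑ i, G A (y i))
          ∂(Measure.pi fun _ : Fin m => ρ') ∂ρ :=
          integral_mono hiF'.integral_prod_left hmix.integral_prod_left fun t =>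
            ih fun A => a A + F A t
      _ = ∫ y, ∫ t, D.sup' hD (fun A => a A + F A t + ∑ i, G A (y i))
          ∂ρ ∂(Measure.pi fun _ : Fin m => ρ') := integral_integral_swap hmix
      _ ≤ ∫ y, ∫ t, D.sup' hD (fun A => a A + G A t + ∑ i, G A (y i))
          ∂ρ' ∂(Measure.pi fun _ : Fin m => ρ') := by
          refine integral_mono hmix.integral_prod_right hiG'.integral_prod_right fun y => ?_
          have := h fun A => a A + ∑ i, G A (y i)
          simpa only [add_right_comm] using this
      _ = _ := (integral_integral_swap hiG').symm

/-- The law of `(x, ε)` with `x` distributed as `ρ` and `ε` an independent random sign. -/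
noncomputable def signed {X : Type*} [MeasurableSpace X] (ρ : Measure X) : Measure (X × ℝ) :=
  (2⁻¹ : ℝ≥0∞) • ρ.map (fun x => (x, 1)) + (2⁻¹ : ℝ≥0∞) • ρ.map (fun x => (x, -1))

section Signed

variable {X : Type*} [MeasurableSpace X] (ρ : Measure X)

instance [IsProbabilityMeasure ρ] : IsProbabilityMeasure (signed ρ) := by
  constructor
  have h1 : Measurable fun x : X => (x, (1 : ℝ)) := by fun_prop
  have h2 : Measurable fun x : X => (x, (-1 : ℝ)) := by fun_prop
  simp [signed, Measure.map_apply h1 MeasurableSet.univ, Measure.map_apply h2 MeasurableSet.univ,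
    ENNReal.inv_two_add_inv_two]

theorem integrable_signed {f : X × ℝ → ℝ} (hf : Measurable f)
    (h1 : Integrable (fun x => f (x, 1)) ρ) (h2 : Integrable (fun x => f (x, -1)) ρ) :
    Integrable f (signed ρ) := by
  refine Integrable.add_measure (Integrable.smul_measure ?_ (by simp))
    (Integrable.smul_measure ?_ (by simp))
  · exact (integrable_map_measure hf.aestronglyMeasurable (by fun_prop)).mpr h1
  · exact (integrable_map_measure hf.aestronglyMeasurable (by fun_prop)).mpr h2

theorem integral_signed {f : X × ℝ → ℝ} (hf : Measurable f)
    (h1 : Integrable (fun x => f (x, 1)) ρ) (h2 : Integrable (fun x => f (x, -1)) ρ) :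
    ∫ q, f q ∂(signed ρ) = 2⁻¹ * ∫ x, f (x, 1) ∂ρ + 2⁻¹ * ∫ x, f (x, -1) ∂ρ := by
  rw [signed, integral_add_measure, integral_smul_measure, integral_smul_measure, integral_map,
    integral_map]
  · simp
  · fun_prop
  · exact hf.aestronglyMeasurable
  · fun_prop
  · exact hf.aestronglyMeasurable
  · exact Integrable.smul_measure
      ((integrable_map_measure hf.aestronglyMeasurable (by fun_prop)).mpr h1) (by simp)
  · exact Integrable.smul_measure
      ((integrable_map_measure hf.aestronglyMeasurable (by fun_prop)).mpr h2) (by simp)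

/-- One-coordinate symmetrization together with contraction. -/
theorem integral_sup'_sub_le_signed [IsProbabilityMeasure ρ] {φ ψ : κ → X → ℝ}
    (hφ : ∀ A, Integrable (φ A) ρ) (hψm : ∀ A, Measurable (ψ A)) (hψ : ∀ A, Integrable (ψ A) ρ)
    (hcon : ∀ A B x, |φ A x - φ B x| ≤ |ψ A x - ψ B x|) (a : κ → ℝ) :
    ∫ x, D.sup' hD (fun A => a A + (∫ y, φ A y ∂ρ - φ A x)) ∂ρ ≤
      ∫ q, D.sup' hD (fun A => a A + 2 * (q.2 * ψ A q.1)) ∂(signed ρ) := by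
  have hip : Integrable (fun x => D.sup' hD fun A => a A + 2 * φ A x) ρ :=
    integrable_sup' hD fun A => (integrable_const _).add ((hφ A).const_mul 2)
  have him : Integrable (fun x => D.sup' hD fun A => a A - 2 * φ A x) ρ :=
    integrable_sup' hD fun A => (integrable_const _).sub ((hφ A).const_mul 2)
  have hjp : Integrable (fun x => D.sup' hD fun A => a A + 2 * (1 * ψ A x)) ρ :=
    integrable_sup' hD fun A => (integrable_const _).add (((hψ A).const_mul 1).const_mul 2)
  have hjm : Integrable (fun x => D.sup' hD fun A => a A + 2 * (-1 * ψ A x)) ρ :=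
    integrable_sup' hD fun A => (integrable_const _).add (((hψ A).const_mul (-1)).const_mul 2)
  have hmeas : Measurable fun q : X × ℝ => D.sup' hD fun A => a A + 2 * (q.2 * ψ A q.1) := by
    have : (fun q : X × ℝ => D.sup' hD fun A => a A + 2 * (q.2 * ψ A q.1)) =
        D.sup' hD fun A (q : X × ℝ) => a A + 2 * (q.2 * ψ A q.1) := by
      ext y; rw [Finset.sup'_apply]
    rw [this]
    refine Finset.measurable_sup' hD fun A _ => ?_
    have := hψm A
    fun_prop
  rw [integral_signed ρ hmeas hjp hjm]
  have h1 : ∀ x, D.sup' hD (fun A => a A + (∫ y, φ A y ∂ρ - φ A x)) ≤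
      2⁻¹ * ∫ y, D.sup' hD (fun A => a A + 2 * φ A y) ∂ρ +
        2⁻¹ * D.sup' hD (fun A => a A - 2 * φ A x) := by
    intro x
    refine Finset.sup'_le hD _ fun A hA => ?_
    have h2 : a A + 2 * ∫ y, φ A y ∂ρ ≤ ∫ y, D.sup' hD (fun A => a A + 2 * φ A y) ∂ρ := by
      have : a A + 2 * ∫ y, φ A y ∂ρ = ∫ y, (a A + 2 * φ A y) ∂ρ := by
        rw [integral_add (integrable_const _) ((hφ A).const_mul 2), integral_const_mul]
        simp
      rw [this]
      exact integral_mono ((integrable_const _).add ((hφ A).const_mul 2)) hip fun y =>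
        Finset.le_sup' (fun A => a A + 2 * φ A y) hA
    have h3 := Finset.le_sup' (fun A => a A - 2 * φ A x) hA
    linarith
  have h2 : ∀ x, D.sup' hD (fun A => a A + 2 * φ A x) + D.sup' hD (fun A => a A - 2 * φ A x) ≤
      D.sup' hD (fun A => a A + 2 * (1 * ψ A x)) + D.sup' hD (fun A => a A + 2 * (-1 * ψ A x)) := by
    intro x
    obtain ⟨A, hA, hA'⟩ := Finset.exists_mem_eq_sup' hD fun A => a A + 2 * φ A x
    obtain ⟨B, hB, hB'⟩ := Finset.exists_mem_eq_sup' hD fun A => a A - 2 * φ A x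
    rw [hA', hB']
    have e1 := Finset.le_sup' (fun A => a A + 2 * (1 * ψ A x)) hA
    have e2 := Finset.le_sup' (fun A => a A + 2 * (1 * ψ A x)) hB
    have e3 := Finset.le_sup' (fun A => a A + 2 * (-1 * ψ A x)) hA
    have e4 := Finset.le_sup' (fun A => a A + 2 * (-1 * ψ A x)) hB
    have hc := (le_abs_self _).trans (hcon A B x)
    rcases abs_cases (ψ A x - ψ B x) with ⟨h, _⟩ | ⟨h, _⟩ <;> rw [h] at hc <;> linarith
  have hi1 : Integrable (fun x => D.sup' hD (fun A => a A + (∫ y, φ A y ∂ρ - φ A x))) ρ :=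
    integrable_sup' hD fun A => (integrable_const _).add ((integrable_const _).sub (hφ A))
  calc _ ≤ ∫ x, (2⁻¹ * ∫ y, D.sup' hD (fun A => a A + 2 * φ A y) ∂ρ +
        2⁻¹ * D.sup' hD (fun A => a A - 2 * φ A x)) ∂ρ :=
        integral_mono hi1 ((integrable_const _).add (him.const_mul _)) h1
    _ = 2⁻¹ * ∫ x, (D.sup' hD (fun A => a A + 2 * φ A x) +
        D.sup' hD (fun A => a A - 2 * φ A x)) ∂ρ := by
        rw [integral_add (integrable_const _) (him.const_mul _), integral_const_mul,
          integral_const_mul, integral_add hip him]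
        simp only [integral_const, probReal_univ, one_smul]
        ring
    _ ≤ 2⁻¹ * ∫ x, (D.sup' hD (fun A => a A + 2 * (1 * ψ A x)) +
        D.sup' hD (fun A => a A + 2 * (-1 * ψ A x))) ∂ρ :=
        mul_le_mul_of_nonneg_left (integral_mono (hip.add him) (hjp.add hjm) h2) (by norm_num)
    _ = _ := by rw [integral_add hjp hjm]; ring

/-- Symmetrization and contraction for the expected supremum of a centered empirical process. -/
theorem integral_sup'_sum_sub_le_signed [IsProbabilityMeasure ρ] {φ ψ : κ → X → ℝ}
    (hφ : ∀ A, Integrable (φ A) ρ) (hψm : ∀ A, Measurable (ψ A)) (hψ : ∀ A, Integrable (ψ A) ρ)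
    (hcon : ∀ A B x, |φ A x - φ B x| ≤ |ψ A x - ψ B x|) (m : ℕ) :
    ∫ x, D.sup' hD (fun A => ∑ i, (∫ y, φ A y ∂ρ - φ A (x i))) ∂(Measure.pi fun _ : Fin m => ρ) ≤
      ∫ q, D.sup' hD (fun A => ∑ i, 2 * ((q i).2 * ψ A (q i).1))
        ∂(Measure.pi fun _ : Fin m => signed ρ) := by
  have h := integral_sup'_pi_le hD ρ (signed ρ) (F := fun A x => ∫ y, φ A y ∂ρ - φ A x)
    (G := fun A q => 2 * (q.2 * ψ A q.1)) (fun A => (integrable_const _).sub (hφ A))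
    (fun A => by
      have := hψm A
      refine integrable_signed ρ (by fun_prop) ?_ ?_
      · exact ((hψ A).const_mul 1).const_mul 2
      · exact ((hψ A).const_mul (-1)).const_mul 2)
    (integral_sup'_sub_le_signed hD ρ hφ hψm hψ hcon) m 0
  simpa using h

end Signed

end Symmetrization

section SubGaussian

variable {Ω : Type*} [MeasurableSpace Ω] {P : Measure Ω}

/-- Factorially bounded even moments give exponential integrability of the square. -/
theorem integral_exp_sq_le_two_of_moments {Z : Ω → ℝ} (hZ : Measurable Z) {R : ℝ} (hR : 0 < R)
    (h : ∀ k : ℕ, ∫⁻ ω, ENNReal.ofReal (Z ω ^ (2 * k)) ∂P ≤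
      ENNReal.ofReal (k.factorial * R ^ k)) :
    Integrable (fun ω => Real.exp (Z ω ^ 2 / (2 * R))) P ∧
      ∫ ω, Real.exp (Z ω ^ 2 / (2 * R)) ∂P ≤ 2 := by
  have hseries : ∀ t : ℝ, 0 ≤ t → ENNReal.ofReal (Real.exp t) =
      ∑' k : ℕ, ENNReal.ofReal (t ^ k / k.factorial) := by
    intro t ht
    have h1 := NormedSpace.expSeries_div_hasSum_exp t
    rw [← Real.exp_eq_exp_ℝ] at h1
    rw [← h1.tsum_eq, ENNReal.ofReal_tsum_of_nonneg (fun k => by positivity) h1.summable]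
  have hlin : ∫⁻ ω, ENNReal.ofReal (Real.exp (Z ω ^ 2 / (2 * R))) ∂P ≤ ENNReal.ofReal 2 := by
    calc ∫⁻ ω, ENNReal.ofReal (Real.exp (Z ω ^ 2 / (2 * R))) ∂P
        = ∫⁻ ω, ∑' k : ℕ, ENNReal.ofReal ((Z ω ^ 2 / (2 * R)) ^ k / k.factorial) ∂P := by
          refine lintegral_congr fun ω => hseries _ (by positivity)
      _ = ∑' k : ℕ, ∫⁻ ω, ENNReal.ofReal ((Z ω ^ 2 / (2 * R)) ^ k / k.factorial) ∂P :=
          lintegral_tsum fun k => by fun_prop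
      _ ≤ ∑' k : ℕ, ENNReal.ofReal ((1 / 2 : ℝ) ^ k) := by
          refine ENNReal.tsum_le_tsum fun k => ?_
          have hk : (0 : ℝ) < k.factorial := by exact_mod_cast k.factorial_pos
          have e1 : ∀ ω, ENNReal.ofReal ((Z ω ^ 2 / (2 * R)) ^ k / k.factorial) =
              ENNReal.ofReal (1 / ((2 * R) ^ k * k.factorial)) * ENNReal.ofReal (Z ω ^ (2 * k)) := by
            intro ω
            rw [← ENNReal.ofReal_mul (by positivity), pow_mul, div_pow]
            congr 1
            field_simp
          simp_rw [e1]
          rw [lintegral_const_mul _ (by fun_prop)]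
          refine (mul_le_mul_right (h k) _).trans (le_of_eq ?_)
          rw [← ENNReal.ofReal_mul (by positivity)]
          congr 1
          rw [mul_pow, div_pow, one_pow]
          field_simp
      _ = ENNReal.ofReal 2 := by
          rw [← ENNReal.ofReal_tsum_of_nonneg (fun k => by positivity) summable_geometric_two,
            tsum_geometric_two]
  have hmeas : Measurable fun ω => Real.exp (Z ω ^ 2 / (2 * R)) := by fun_prop
  have hint : Integrable (fun ω => Real.exp (Z ω ^ 2 / (2 * R))) P :=
    ⟨hmeas.aestronglyMeasurable, by
      rw [hasFiniteIntegral_iff_ofReal (Filter.Eventually.of_forall fun ω => (Real.exp_pos _).le)]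
      exact hlin.trans_lt ENNReal.ofReal_lt_top⟩
  refine ⟨hint, ?_⟩
  rw [← ofReal_integral_eq_lintegral_ofReal hint
    (Filter.Eventually.of_forall fun ω => (Real.exp_pos _).le)] at hlin
  exact (ENNReal.ofReal_le_ofReal_iff (by norm_num)).mp hlin

theorem pow_self_le_factorial_mul_exp (k : ℕ) : (k : ℝ) ^ k ≤ k.factorial * Real.exp 1 ^ k := by
  have h := Real.pow_div_factorial_le_exp (k : ℝ) (by positivity) k
  rw [div_le_iff₀ (by exact_mod_cast k.factorial_pos)] at h
  rwa [← Real.exp_nat_mul, mul_one, mul_comm]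

/-- Even moments of a variable with a sub-Gaussian moment generating function. -/
theorem lintegral_even_pow_le {Z : Ω → ℝ} [IsProbabilityMeasure P] {v : ℝ}
    (hv : 0 < v) (hi : ∀ t, Integrable (fun ω => Real.exp (t * Z ω)) P)
    (hm : ∀ t, mgf Z P t ≤ Real.exp (v * t ^ 2 / 2)) (k : ℕ) :
    ∫⁻ ω, ENNReal.ofReal (Z ω ^ (2 * k)) ∂P ≤
      ENNReal.ofReal (k.factorial * (2 * (Real.exp 1 * v)) ^ k) := by
  rcases Nat.eq_zero_or_pos k with rfl | hk
  · simp
  have hk' : (0 : ℝ) < k := by exact_mod_cast hk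
  set s : ℝ := √(2 * k / v) with hs
  have hs0 : 0 < s := Real.sqrt_pos.mpr (by positivity)
  have hs2 : s ^ 2 = 2 * k / v := Real.sq_sqrt (by positivity)
  set C : ℝ := (2 * k).factorial / s ^ (2 * k) with hC
  have hpt : ∀ ω, Z ω ^ (2 * k) ≤ C * (Real.exp (s * Z ω) + Real.exp (-s * Z ω)) := by
    intro ω
    have h1 := Real.pow_div_factorial_le_exp |s * Z ω| (abs_nonneg _) (2 * k)
    rw [Even.pow_abs (by simp), mul_pow, div_le_iff₀ (by exact_mod_cast Nat.factorial_pos _)] at h1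
    have h2 : Real.exp |s * Z ω| ≤ Real.exp (s * Z ω) + Real.exp (-s * Z ω) := by
      rcases abs_cases (s * Z ω) with ⟨h, _⟩ | ⟨h, _⟩ <;> rw [h]
      · linarith [Real.exp_pos (-s * Z ω)]
      · rw [← neg_mul]; linarith [Real.exp_pos (s * Z ω)]
    rw [hC, div_mul_eq_mul_div, le_div_iff₀ (by positivity)]
    have h3 := mul_le_mul_of_nonneg_right h2
      (Nat.cast_nonneg (α := ℝ) (2 * k).factorial)
    linarith
  have hint : Integrable (fun ω => C * (Real.exp (s * Z ω) + Real.exp (-s * Z ω))) P :=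
    ((hi s).add (hi (-s))).const_mul C
  calc ∫⁻ ω, ENNReal.ofReal (Z ω ^ (2 * k)) ∂P
      ≤ ∫⁻ ω, ENNReal.ofReal (C * (Real.exp (s * Z ω) + Real.exp (-s * Z ω))) ∂P :=
        lintegral_mono fun ω => ENNReal.ofReal_le_ofReal (hpt ω)
    _ = ENNReal.ofReal (∫ ω, C * (Real.exp (s * Z ω) + Real.exp (-s * Z ω)) ∂P) := by
        rw [ofReal_integral_eq_lintegral_ofReal hint]
        exact Filter.Eventually.of_forall fun ω => by simp only [Pi.zero_apply]; positivity
    _ ≤ _ := by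
        refine ENNReal.ofReal_le_ofReal ?_
        rw [integral_const_mul, integral_add (hi s) (hi (-s))]
        have h1 := hm s
        have h2 := hm (-s)
        rw [mgf] at h1 h2
        rw [neg_sq] at h2
        have e1 : v * s ^ 2 / 2 = k := by rw [hs2]; field_simp
        rw [e1] at h1 h2
        have hfac : ((2 * k).factorial : ℝ) ≤ k.factorial * (2 * k) ^ k := by
          have e2 := Nat.factorial_mul_descFactorial (n := 2 * k) (k := k) (by omega)
          have e3 := Nat.descFactorial_le_pow (2 * k) k
          rw [show 2 * k - k = k by omega] at e2
          rw [← e2]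
          push_cast
          refine mul_le_mul_of_nonneg_left ?_ (by positivity)
          exact_mod_cast e3
        have hC' : C ≤ k.factorial * v ^ k := by
          rw [hC, pow_mul, hs2, div_pow, div_div_eq_mul_div, div_le_iff₀ (by positivity)]
          calc _ ≤ (k.factorial * (2 * k) ^ k) * v ^ k :=
                mul_le_mul_of_nonneg_right hfac (by positivity)
            _ = _ := by ring
        calc C * (∫ ω, Real.exp (s * Z ω) ∂P + ∫ ω, Real.exp (-s * Z ω) ∂P)
            ≤ (k.factorial * v ^ k) * (2 * Real.exp k) :=
              mul_le_mul hC' (by linarith)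
                (add_nonneg (integral_nonneg fun _ => (Real.exp_pos _).le)
                  (integral_nonneg fun _ => (Real.exp_pos _).le)) (by positivity)
          _ ≤ (k.factorial * v ^ k) * (2 ^ k * Real.exp k) := by
              gcongr
              exact le_self_pow₀ (by norm_num) (by omega)
          _ = _ := by
              rw [mul_pow, mul_pow, ← Real.exp_nat_mul, mul_one]; ring

theorem exp_le_self_add_exp_sq (z : ℝ) : Real.exp z ≤ z + Real.exp (z ^ 2) := by
  have h1 := Real.add_one_le_exp (z ^ 2)
  by_cases hz : |z| ≤ 1
  · have h2 := (abs_le.mp (Real.abs_exp_sub_one_sub_id_le hz)).2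
    linarith
  · push Not at hz
    rcases lt_abs.mp hz with h | h
    · have : Real.exp z ≤ Real.exp (z ^ 2) := Real.exp_le_exp.mpr (by nlinarith)
      linarith
    · have : Real.exp z ≤ 1 := Real.exp_le_one_iff.mpr (by linarith)
      nlinarith

theorem exp_mul_le_of_mem_Icc {θ t : ℝ} (h0 : 0 ≤ θ) (h1 : θ ≤ 1) :
    Real.exp (θ * t) ≤ 1 + θ * (Real.exp t - 1) := by
  have := convexOn_exp.2 (Set.mem_univ 0) (Set.mem_univ t) (sub_nonneg.mpr h1) h0 (by ring)
  simp only [smul_eq_mul, mul_zero, zero_add, Real.exp_zero, mul_one] at this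
  linarith

/-- A centered variable whose square is exponentially integrable has a sub-Gaussian moment
generating function. -/
theorem hasSubgaussianMGF_of_integral_exp_sq [IsProbabilityMeasure P] {Y : Ω → ℝ}
    (hY : Measurable Y) {c : ℝ≥0} (hc : 0 < c) (hi : Integrable (fun ω => Real.exp (c * Y ω ^ 2)) P)
    (h2 : ∫ ω, Real.exp (c * Y ω ^ 2) ∂P ≤ 2) (hYi : Integrable Y P) (h0 : ∫ ω, Y ω ∂P = 0) :
    HasSubgaussianMGF Y (4 / c) P := by
  have hc' : (0 : ℝ) < c := by exact_mod_cast hc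
  have hle : ∀ t ω, Real.exp (t * Y ω) ≤ Real.exp (t ^ 2 / (4 * c)) * Real.exp (c * Y ω ^ 2) := by
    intro t ω
    rw [← Real.exp_add, Real.exp_le_exp]
    have : t ^ 2 / (4 * c) + c * Y ω ^ 2 - t * Y ω = c * (Y ω - t / (2 * c)) ^ 2 := by
      field_simp; ring
    nlinarith [mul_nonneg hc'.le (sq_nonneg (Y ω - t / (2 * c)))]
  have hint : ∀ t, Integrable (fun ω => Real.exp (t * Y ω)) P := fun t =>
    (hi.const_mul (Real.exp (t ^ 2 / (4 * c)))).mono' (by fun_prop)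
      (Filter.Eventually.of_forall fun ω => by
        rw [Real.norm_of_nonneg (Real.exp_pos _).le]; exact hle t ω)
  refine ⟨hint, fun t => ?_⟩
  rw [mgf]
  have hgoal : ((4 / c : ℝ≥0) : ℝ) * t ^ 2 / 2 = 2 * t ^ 2 / c := by
    push_cast; ring
  rw [hgoal]
  by_cases ht : t ^ 2 ≤ c
  · set θ : ℝ := t ^ 2 / c with hθ
    have hθ0 : 0 ≤ θ := by positivity
    have hθ1 : θ ≤ 1 := by rw [hθ, div_le_one hc']; exact ht
    have hpt : ∀ ω, Real.exp (t * Y ω) ≤ t * Y ω + (1 + θ * (Real.exp (c * Y ω ^ 2) - 1)) := by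
      intro ω
      refine (exp_le_self_add_exp_sq _).trans (add_le_add le_rfl ?_)
      refine le_trans (le_of_eq ?_) (exp_mul_le_of_mem_Icc hθ0 hθ1)
      congr 1
      rw [hθ]; field_simp
    have hi1 : Integrable (fun ω => θ * (Real.exp (c * Y ω ^ 2) - 1)) P :=
      (hi.sub (integrable_const 1)).const_mul θ
    have hi2 : Integrable (fun ω => 1 + θ * (Real.exp (c * Y ω ^ 2) - 1)) P :=
      (integrable_const 1).add hi1
    calc ∫ ω, Real.exp (t * Y ω) ∂P
        ≤ ∫ ω, (t * Y ω + (1 + θ * (Real.exp (c * Y ω ^ 2) - 1))) ∂P :=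
          integral_mono (hint t) ((hYi.const_mul t).add hi2) hpt
      _ = 1 + θ * (∫ ω, Real.exp (c * Y ω ^ 2) ∂P - 1) := by
          rw [integral_add (hYi.const_mul t) hi2, integral_const_mul, h0,
            integral_add (integrable_const 1) hi1, integral_const_mul,
            integral_sub hi (integrable_const 1)]
          simp
      _ ≤ 1 + θ := by nlinarith
      _ ≤ Real.exp θ := by linarith [Real.add_one_le_exp θ]
      _ ≤ _ := by
          rw [Real.exp_le_exp, hθ]
          gcongr
          nlinarith [sq_nonneg t]
  · push Not at ht
    have hθ : 1 ≤ t ^ 2 / c := by rw [le_div_iff₀ hc']; linarith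
    calc ∫ ω, Real.exp (t * Y ω) ∂P
        ≤ ∫ ω, Real.exp (t ^ 2 / (4 * c)) * Real.exp (c * Y ω ^ 2) ∂P :=
          integral_mono (hint t) (hi.const_mul _) (hle t)
      _ ≤ Real.exp (t ^ 2 / (4 * c)) * 2 := by
          rw [integral_const_mul]
          exact mul_le_mul_of_nonneg_left h2 (Real.exp_pos _).le
      _ ≤ Real.exp (t ^ 2 / (4 * c)) * Real.exp (t ^ 2 / c) := by
          refine mul_le_mul_of_nonneg_left ?_ (Real.exp_pos _).le
          linarith [Real.add_one_le_exp (t ^ 2 / c)]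
      _ ≤ _ := by
          rw [← Real.exp_add, Real.exp_le_exp]
          have : t ^ 2 / (4 * c) = (t ^ 2 / c) / 4 := by field_simp
          rw [this]
          have : 2 * t ^ 2 / c = 2 * (t ^ 2 / c) := by ring
          rw [this]; linarith

theorem lintegral_even_pow_le_of_subGaussianNorm_le {Y : Ω → ℝ} {L : ℝ≥0}
    (h : subGaussianNorm Y P ≤ L) [IsProbabilityMeasure P] (k : ℕ) :
    ∫⁻ ω, ENNReal.ofReal (Y ω ^ (2 * k)) ∂P ≤
      ENNReal.ofReal (k.factorial * (2 * (Real.exp 1 * L ^ 2)) ^ k) := by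
  rcases Nat.eq_zero_or_pos k with rfl | hk
  · simp
  have hq : (1 : ℝ≥0) ≤ ((2 * k : ℕ) : ℝ≥0) := by exact_mod_cast (by omega : 1 ≤ 2 * k)
  have h1 : eLpNorm Y (((2 * k : ℕ) : ℝ≥0) : ℝ≥0∞) P /
      (NNReal.sqrt ((2 * k : ℕ) : ℝ≥0) : ℝ≥0∞) ≤ L :=
    (le_iSup₂ (f := fun (q : ℝ≥0) (_ : 1 ≤ q) =>
      eLpNorm Y (q : ℝ≥0∞) P / (NNReal.sqrt q : ℝ≥0∞)) _ hq).trans h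
  have hs0 : (NNReal.sqrt ((2 * k : ℕ) : ℝ≥0)) ≠ 0 := by
    rw [Ne, NNReal.sqrt_eq_zero]; positivity
  rw [ENNReal.div_le_iff (by exact_mod_cast hs0) ENNReal.coe_ne_top] at h1
  have h2 := eLpNorm_nnreal_pow_eq_lintegral (f := Y) (μ := P) (p := ((2 * k : ℕ) : ℝ≥0))
    (by positivity)
  simp only [NNReal.coe_natCast, ENNReal.rpow_natCast] at h2
  have h3 : ∀ ω, ENNReal.ofReal (Y ω ^ (2 * k)) = ‖Y ω‖ₑ ^ (2 * k) := by
    intro ω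
    rw [← ofReal_norm, ← ENNReal.ofReal_pow (norm_nonneg _), Real.norm_eq_abs,
      Even.pow_abs (by simp)]
  simp_rw [h3]
  rw [← h2]
  refine (pow_le_pow_left₀ (by positivity) h1 _).trans ?_
  rw [← ENNReal.coe_mul, ← ENNReal.coe_pow, ← ENNReal.ofReal_coe_nnreal]
  refine ENNReal.ofReal_le_ofReal ?_
  push_cast
  rw [mul_pow, pow_mul, pow_mul, Real.sq_sqrt (by positivity), mul_pow, mul_pow, mul_pow]
  have := pow_self_le_factorial_mul_exp k
  calc ((L : ℝ) ^ 2) ^ k * (2 ^ k * k ^ k)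
      ≤ ((L : ℝ) ^ 2) ^ k * (2 ^ k * (k.factorial * Real.exp 1 ^ k)) := by gcongr
    _ = _ := by ring

end SubGaussian

section Moments

variable {Ω : Type*} [MeasurableSpace Ω]

/-- All absolute moments are finite. -/
def HasMoments (f : Ω → ℝ) (P : Measure Ω) : Prop := ∀ q : ℝ≥0, MemLp f q P

variable {P : Measure Ω}

namespace HasMoments

theorem add {f g : Ω → ℝ} (hf : HasMoments f P) (hg : HasMoments g P) :
    HasMoments (fun ω => f ω + g ω) P := fun q => (hf q).add (hg q)

theorem sub {f g : Ω → ℝ} (hf : HasMoments f P) (hg : HasMoments g P) :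
    HasMoments (fun ω => f ω - g ω) P := fun q => (hf q).sub (hg q)

theorem mul {f g : Ω → ℝ} (hf : HasMoments f P) (hg : HasMoments g P) :
    HasMoments (fun ω => f ω * g ω) P := fun q => by
  have : ENNReal.HolderTriple ((2 * q : ℝ≥0) : ℝ≥0∞) ((2 * q : ℝ≥0) : ℝ≥0∞) (q : ℝ≥0∞) := by
    constructor
    push_cast
    rw [ENNReal.mul_inv (by simp) (by simp), ← add_mul, ENNReal.inv_two_add_inv_two, one_mul]
  exact (hg (2 * q)).mul (hf (2 * q))

theorem const [IsFiniteMeasure P] (c : ℝ) : HasMoments (fun _ : Ω => c) P := fun _ => memLp_const c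

theorem const_mul {f : Ω → ℝ} (hf : HasMoments f P) (c : ℝ) : HasMoments (fun ω => c * f ω) P :=
  fun q => (hf q).const_mul c

theorem pow [IsFiniteMeasure P] {f : Ω → ℝ} (hf : HasMoments f P) (k : ℕ) :
    HasMoments (fun ω => f ω ^ k) P := by
  induction k with
  | zero => simpa using const 1
  | succ k ih => simpa only [pow_succ] using ih.mul hf

theorem sum {ι : Type*} (S : Finset ι) {f : ι → Ω → ℝ} (hf : ∀ i ∈ S, HasMoments (f i) P) :
    HasMoments (fun ω => ∑ i ∈ S, f i ω) P := fun q =>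
  memLp_finsetSum S fun i hi => hf i hi q

theorem integrable {f : Ω → ℝ} (hf : HasMoments f P) : Integrable f P := by
  rw [← memLp_one_iff_integrable]; exact_mod_cast hf 1

end HasMoments

/-- Fourth moment of a martingale increment. -/
theorem integral_add_pow_four_le [IsProbabilityMeasure P] {W D : Ω → ℝ} (hW : HasMoments W P)
    (hD : HasMoments D P) (h0 : ∫ ω, W ω ^ 3 * D ω ∂P = 0) {a b : ℝ} (ha : 0 ≤ a) (hb : 0 ≤ b)
    (hWa : ∫ ω, W ω ^ 4 ∂P ≤ a ^ 2) (hDb : ∫ ω, D ω ^ 4 ∂P ≤ b ^ 2) :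
    ∫ ω, (W ω + D ω) ^ 4 ∂P ≤ (a + 4 * b) ^ 2 := by
  have hW4 := (hW.pow 4).integrable
  have hD4 := (hD.pow 4).integrable
  have hW3D := ((hW.pow 3).mul hD).integrable
  have hW2D2 := ((hW.pow 2).mul (hD.pow 2)).integrable
  have hWD4 := ((hW.add hD).pow 4).integrable
  have hcs : ∫ ω, W ω ^ 2 * D ω ^ 2 ∂P ≤ a * b := by
    refine le_of_forall_pos_le_add fun ε hε => ?_
    obtain ⟨δ, hδ, hδ'⟩ : ∃ δ : ℝ, 0 < δ ∧ δ * (a + b) ≤ 2 * ε :=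
      ⟨2 * ε / (a + b + 1), by positivity, by
        rw [div_mul_eq_mul_div, div_le_iff₀ (by positivity)]; nlinarith⟩
    have ha' : 0 < a + δ := by positivity
    have hb' : 0 < b + δ := by positivity
    set t := (b + δ) / (a + δ) with ht
    have ht0 : 0 < t := by positivity
    have h1 : ∫ ω, W ω ^ 2 * D ω ^ 2 ∂P ≤ ∫ ω, (t / 2 * W ω ^ 4 + t⁻¹ / 2 * D ω ^ 4) ∂P := by
      refine integral_mono hW2D2 ((hW4.const_mul _).add (hD4.const_mul _)) fun ω => ?_
      have h2 : t / 2 * W ω ^ 4 + t⁻¹ / 2 * D ω ^ 4 - W ω ^ 2 * D ω ^ 2 =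
          (t * W ω ^ 2 - D ω ^ 2) ^ 2 / (2 * t) := by field_simp; ring
      have h3 : 0 ≤ (t * W ω ^ 2 - D ω ^ 2) ^ 2 / (2 * t) := by positivity
      simp only
      linarith
    rw [integral_add (hW4.const_mul _) (hD4.const_mul _), integral_const_mul,
      integral_const_mul] at h1
    have h2 : t / 2 * ∫ ω, W ω ^ 4 ∂P ≤ t / 2 * (a * (a + δ)) :=
      mul_le_mul_of_nonneg_left (by nlinarith) (by positivity)
    have h3 : t⁻¹ / 2 * ∫ ω, D ω ^ 4 ∂P ≤ t⁻¹ / 2 * (b * (b + δ)) :=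
      mul_le_mul_of_nonneg_left (by nlinarith) (by positivity)
    have h4 : t / 2 * (a * (a + δ)) = a * (b + δ) / 2 := by rw [ht]; field_simp
    have h5 : t⁻¹ / 2 * (b * (b + δ)) = b * (a + δ) / 2 := by rw [ht]; field_simp
    linarith
  have hpt : ∀ ω, (W ω + D ω) ^ 4 ≤
      W ω ^ 4 + 4 * (W ω ^ 3 * D ω) + (8 * (W ω ^ 2 * D ω ^ 2) + 3 * D ω ^ 4) := by
    intro ω
    nlinarith [mul_nonneg (sq_nonneg (D ω)) (sq_nonneg (W ω - D ω))]
  have hi1 : Integrable (fun ω => W ω ^ 4 + 4 * (W ω ^ 3 * D ω)) P := hW4.add (hW3D.const_mul 4)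
  have hi2 : Integrable (fun ω => 8 * (W ω ^ 2 * D ω ^ 2) + 3 * D ω ^ 4) P :=
    (hW2D2.const_mul 8).add (hD4.const_mul 3)
  have := integral_mono hWD4 (hi1.add hi2) hpt
  simp only [Pi.add_apply] at this
  rw [integral_add hi1 hi2, integral_add hW4 (hW3D.const_mul 4), integral_add (hW2D2.const_mul 8) (hD4.const_mul 3),
    integral_const_mul, integral_const_mul, integral_const_mul, h0] at this
  nlinarith

end Moments

/-- Independent standardized sub-Gaussian coordinates. -/
structure IsEntryModel {Ω : Type*} [MeasurableSpace Ω] (P : Measure Ω) {p : ℕ}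
    (Y : Fin p → Ω → ℝ) (μ : ℝ) (v : ℝ≥0) : Prop where
  measurable : ∀ l, Measurable (Y l)
  indep : iIndepFun Y P
  subgaussian : ∀ l, HasSubgaussianMGF (Y l) v P
  mean : ∀ l, ∫ ω, Y l ω ∂P = 0
  secondMoment : ∀ l, ∫ ω, Y l ω ^ 2 ∂P = 1
  fourthMoment : ∀ l, ∫ ω, Y l ω ^ 4 ∂P = μ

namespace IsEntryModel

variable {Ω : Type*} [MeasurableSpace Ω] {P : Measure Ω} {p : ℕ} {Y : Fin p → Ω → ℝ} {μ : ℝ}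
  {v : ℝ≥0}

theorem hasMoments (h : IsEntryModel P Y μ v) (l : Fin p) : HasMoments (Y l) P :=
  fun q => (h.subgaussian l).memLp q

/-- A function of the coordinates in `S` is independent of a coordinate outside `S`. -/
theorem indepFun_of_notMem (h : IsEntryModel P Y μ v) {S : Finset (Fin p)} {j : Fin p} (hj : j ∉ S)
    {F : (Fin p → ℝ) → ℝ} (hF : Measurable F) (hS : ∀ x x', (∀ k ∈ S, x k = x' k) → F x = F x') :
    IndepFun (fun ω => F fun k => Y k ω) (Y j) P := by
  have h1 := h.indep.indepFun_finset S {j} (by simpa using hj) h.measurable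
  let ext : (S → ℝ) → Fin p → ℝ := fun y k => if hk : k ∈ S then y ⟨k, hk⟩ else 0
  have hext : Measurable ext := by
    refine measurable_pi_lambda _ fun k => ?_
    by_cases hk : k ∈ S
    · simp only [ext, hk, dif_pos]; fun_prop
    · simp only [ext, hk, dif_neg, not_false_eq_true]; fun_prop
  have h2 := h1.comp (hF.comp hext)
    (measurable_pi_apply (⟨j, Finset.mem_singleton_self j⟩ : ({j} : Finset (Fin p))))
  refine h2.congr (Filter.Eventually.of_forall fun ω => ?_) (Filter.Eventually.of_forall fun ω => rfl)
  exact hS _ _ fun k hk => by simp [ext, hk]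

theorem integral_mul_comp_of_notMem (h : IsEntryModel P Y μ v) {S : Finset (Fin p)} {j : Fin p}
    (hj : j ∉ S) {F : (Fin p → ℝ) → ℝ} (hF : Measurable F)
    (hS : ∀ x x', (∀ k ∈ S, x k = x' k) → F x = F x') {G : ℝ → ℝ} (hG : Measurable G) :
    ∫ ω, F (fun k => Y k ω) * G (Y j ω) ∂P =
      (∫ ω, F (fun k => Y k ω) ∂P) * ∫ ω, G (Y j ω) ∂P := by
  have h1 := (h.indepFun_of_notMem hj hF hS).comp measurable_id hG
  have hY : Measurable fun ω => fun k => Y k ω := measurable_pi_lambda _ h.measurable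
  exact h1.integral_fun_mul_eq_mul_integral (hF.comp hY).aestronglyMeasurable
    (hG.comp (h.measurable j)).aestronglyMeasurable

theorem hasSubgaussianMGF_linear (h : IsEntryModel P Y μ v) (S : Finset (Fin p)) (u : Fin p → ℝ) :
    HasSubgaussianMGF (fun ω => ∑ k ∈ S, u k * Y k ω)
      (∑ k ∈ S, (u k ^ 2).toNNReal * v) P := by
  have h1 : iIndepFun (fun k ω => u k * Y k ω) P :=
    h.indep.comp (fun k y => u k * y) fun k => by fun_prop
  exact HasSubgaussianMGF.sum_of_iIndepFun h1 fun k _ => by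
    rw [Real.toNNReal_of_nonneg (sq_nonneg (u k))]
    exact (h.subgaussian k).const_mul (u k)

variable [IsProbabilityMeasure P]

theorem lintegral_linear_pow_le (h : IsEntryModel P Y μ v) (hv : 0 < v) (S : Finset (Fin p))
    (u : Fin p → ℝ) {r : ℝ} (hr : 0 < r) (hur : ∑ k ∈ S, u k ^ 2 ≤ r) (k : ℕ) :
    ∫⁻ ω, ENNReal.ofReal ((∑ k ∈ S, u k * Y k ω) ^ (2 * k)) ∂P ≤
      ENNReal.ofReal (k.factorial * (2 * (Real.exp 1 * (r * v))) ^ k) := by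
  have h1 := h.hasSubgaussianMGF_linear S u
  have hv' : (0 : ℝ) < v := by exact_mod_cast hv
  refine lintegral_even_pow_le (by positivity) h1.integrable_exp_mul (fun t => ?_) k
  refine (h1.mgf_le t).trans ?_
  rw [Real.exp_le_exp]
  push_cast
  simp_rw [Real.coe_toNNReal _ (sq_nonneg _)]
  rw [← Finset.sum_mul]
  gcongr

theorem integral_linear_pow_four_le (h : IsEntryModel P Y μ v) (hv : 0 < v) (S : Finset (Fin p))
    (u : Fin p → ℝ) :
    ∫ ω, (∑ k ∈ S, u k * Y k ω) ^ 4 ∂P ≤ 2 * (2 * (Real.exp 1 * v)) ^ 2 * (∑ k ∈ S, u k ^ 2) ^ 2 := by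
  have hnn : 0 ≤ ∑ k ∈ S, u k ^ 2 := Finset.sum_nonneg fun _ _ => sq_nonneg _
  rcases hnn.eq_or_lt with h0 | h0
  · have : ∀ k ∈ S, u k = 0 := fun k hk => by
      have := (Finset.sum_eq_zero_iff_of_nonneg fun _ _ => sq_nonneg _).mp h0.symm k hk
      exact pow_eq_zero_iff (two_ne_zero) |>.mp this
    have h2 : ∀ ω, ∑ k ∈ S, u k * Y k ω = 0 := fun ω =>
      Finset.sum_eq_zero fun k hk => by rw [this k hk, zero_mul]
    simp only [h2, ← h0]
    simp
  · have h1 := h.lintegral_linear_pow_le hv S u h0 le_rfl 2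
    have hm : HasMoments (fun ω => ∑ k ∈ S, u k * Y k ω) P :=
      HasMoments.sum S fun k _ => (h.hasMoments k).const_mul _
    rw [← ofReal_integral_eq_lintegral_ofReal (hm.pow _).integrable
      (Filter.Eventually.of_forall fun ω => by
        simp only [Pi.zero_apply]; exact (even_two_mul 2).pow_nonneg _)] at h1
    rw [ENNReal.ofReal_le_ofReal_iff (by positivity)] at h1
    refine h1.trans (le_of_eq ?_)
    simp [Nat.factorial]; ring

theorem integral_exp_linear_sq_le (h : IsEntryModel P Y μ v) (hv : 0 < v) {u : Fin p → ℝ}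
    (hu : ∑ k, u k ^ 2 ≤ 1) :
    Integrable (fun ω => Real.exp ((∑ k, u k * Y k ω) ^ 2 / (2 * (2 * (Real.exp 1 * v))))) P ∧
      ∫ ω, Real.exp ((∑ k, u k * Y k ω) ^ 2 / (2 * (2 * (Real.exp 1 * v)))) ∂P ≤ 2 := by
  have hv' : (0 : ℝ) < v := by exact_mod_cast hv
  refine integral_exp_sq_le_two_of_moments ?_ (by positivity) fun k => ?_
  · exact Finset.measurable_fun_sum _ fun k _ => (h.measurable k).const_mul _
  · simpa using h.lintegral_linear_pow_le hv Finset.univ u one_pos hu k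

theorem integral_linear (h : IsEntryModel P Y μ v) (S : Finset (Fin p)) (u : Fin p → ℝ) :
    ∫ ω, ∑ k ∈ S, u k * Y k ω ∂P = 0 := by
  rw [integral_finsetSum _ fun k _ => ((h.hasMoments k).const_mul _).integrable]
  simp [integral_const_mul, h.mean]

theorem integral_linear_sq (h : IsEntryModel P Y μ v) (S : Finset (Fin p)) (u : Fin p → ℝ) :
    ∫ ω, (∑ k ∈ S, u k * Y k ω) ^ 2 ∂P = ∑ k ∈ S, u k ^ 2 := by
  have hpair : ∀ k l, ∫ ω, Y k ω * Y l ω ∂P = if k = l then 1 else 0 := by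
    intro k l
    by_cases hkl : k = l
    · subst hkl; simp [← sq, h.secondMoment]
    · rw [if_neg hkl, (h.indep.indepFun hkl).integral_fun_mul_eq_mul_integral
        (h.measurable k).aestronglyMeasurable (h.measurable l).aestronglyMeasurable, h.mean,
        zero_mul]
  have e1 : ∀ ω, (∑ k ∈ S, u k * Y k ω) ^ 2 =
      ∑ k ∈ S, ∑ l ∈ S, (u k * u l) * (Y k ω * Y l ω) := by
    intro ω
    rw [sq, Finset.sum_mul_sum]
    exact Finset.sum_congr rfl fun k _ => Finset.sum_congr rfl fun l _ => by ring
  simp_rw [e1]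
  have hi : ∀ k l, Integrable (fun ω => (u k * u l) * (Y k ω * Y l ω)) P := fun k l =>
    (((h.hasMoments k).mul (h.hasMoments l)).const_mul _).integrable
  rw [integral_finsetSum _ fun k _ => integrable_finsetSum _ fun l _ => hi k l]
  refine Finset.sum_congr rfl fun k hk => ?_
  rw [integral_finsetSum _ fun l _ => hi k l]
  simp only [integral_const_mul, hpair, mul_ite, mul_one, mul_zero]
  rw [Finset.sum_ite_eq, if_pos hk, sq]

end IsEntryModel

/-- The constant in the fourth moment bound of an increment. -/
noncomputable def incrementConst (v : ℝ≥0) : ℝ := 2048 * (2 * (Real.exp 1 * v)) ^ 4 + 64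

/-- The centered quadratic form restricted to the coordinates in `S`. -/
def centeredForm {p : ℕ} (A : Matrix (Fin p) (Fin p) ℝ) (S : Finset (Fin p)) (x : Fin p → ℝ) : ℝ :=
  ∑ j ∈ S, ∑ k ∈ S, A j k * (x j * x k) - ∑ j ∈ S, A j j

section CenteredForm

variable {p : ℕ} {A : Matrix (Fin p) (Fin p) ℝ}

theorem centeredForm_insert (hA : A.IsSymm) {S : Finset (Fin p)} {j : Fin p} (hj : j ∉ S)
    (x : Fin p → ℝ) :
    centeredForm A (insert j S) x = centeredForm A S x +
      (2 * ((∑ k ∈ S, A j k * x k) * x j) + A j j * (x j ^ 2 - 1)) := by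
  simp only [centeredForm, Finset.sum_insert hj, Finset.sum_add_distrib]
  have e1 : ∑ k ∈ S, A k j * (x k * x j) = (∑ k ∈ S, A j k * x k) * x j := by
    rw [Finset.sum_mul]
    exact Finset.sum_congr rfl fun k _ => by rw [hA.apply j k]; ring
  have e2 : ∑ k ∈ S, A j k * (x j * x k) = (∑ k ∈ S, A j k * x k) * x j := by
    rw [Finset.sum_mul]
    exact Finset.sum_congr rfl fun k _ => by ring
  rw [e1, e2]; ring

theorem measurable_centeredForm (A : Matrix (Fin p) (Fin p) ℝ) (S : Finset (Fin p)) :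
    Measurable (centeredForm A S) := by
  unfold centeredForm; fun_prop

theorem centeredForm_congr (S : Finset (Fin p)) {x x' : Fin p → ℝ} (h : ∀ k ∈ S, x k = x' k) :
    centeredForm A S x = centeredForm A S x' := by
  unfold centeredForm
  congr 1
  exact Finset.sum_congr rfl fun j hj => Finset.sum_congr rfl fun k hk => by rw [h j hj, h k hk]

end CenteredForm

namespace IsEntryModel

variable {Ω : Type*} [MeasurableSpace Ω] {P : Measure Ω} [IsProbabilityMeasure P] {p : ℕ}
  {Y : Fin p → Ω → ℝ} {μ : ℝ} {v : ℝ≥0} {A : Matrix (Fin p) (Fin p) ℝ}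

theorem hasMoments_centeredForm (h : IsEntryModel P Y μ v) (A : Matrix (Fin p) (Fin p) ℝ)
    (S : Finset (Fin p)) : HasMoments (fun ω => centeredForm A S fun k => Y k ω) P := by
  unfold centeredForm
  refine HasMoments.sub (HasMoments.sum _ fun j _ => HasMoments.sum _ fun k _ => ?_)
    (HasMoments.const _)
  exact ((h.hasMoments j).mul (h.hasMoments k)).const_mul _

theorem hasMoments_linear (h : IsEntryModel P Y μ v) (S : Finset (Fin p)) (u : Fin p → ℝ) :
    HasMoments (fun ω => ∑ k ∈ S, u k * Y k ω) P :=
  HasMoments.sum S fun k _ => (h.hasMoments k).const_mul _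

/-- The increment is orthogonal to every function of the previous coordinates. -/
theorem integral_mul_increment (h : IsEntryModel P Y μ v) {S : Finset (Fin p)} {j : Fin p}
    (hj : j ∉ S) {F : (Fin p → ℝ) → ℝ} (hF : Measurable F)
    (hS : ∀ x x', (∀ k ∈ S, x k = x' k) → F x = F x') (hFm : HasMoments (fun ω => F fun k => Y k ω) P)
    (u : Fin p → ℝ) (d : ℝ) :
    ∫ ω, F (fun k => Y k ω) *
      (2 * ((∑ k ∈ S, u k * Y k ω) * Y j ω) + d * (Y j ω ^ 2 - 1)) ∂P = 0 := by
  have hlm := h.hasMoments_linear S u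
  have e1 : ∀ ω, F (fun k => Y k ω) *
      (2 * ((∑ k ∈ S, u k * Y k ω) * Y j ω) + d * (Y j ω ^ 2 - 1)) =
      2 * ((F (fun k => Y k ω) * ∑ k ∈ S, u k * Y k ω) * Y j ω) +
        d * (F (fun k => Y k ω) * (Y j ω ^ 2 - 1)) := fun ω => by ring
  simp_rw [e1]
  have hY2 : HasMoments (fun ω => Y j ω ^ 2 - 1) P := ((h.hasMoments j).pow 2).sub (HasMoments.const 1)
  rw [integral_add ((((hFm.mul hlm).mul (h.hasMoments j)).const_mul 2).integrable)
    (((hFm.mul hY2).const_mul d).integrable), integral_const_mul, integral_const_mul]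
  have h1 := h.integral_mul_comp_of_notMem hj (F := fun x => F x * ∑ k ∈ S, u k * x k)
    (G := fun y => y) (by fun_prop) (fun x x' hx => by
      rw [hS x x' hx, Finset.sum_congr rfl fun k hk => by rw [hx k hk]]) measurable_id
  have h2 := h.integral_mul_comp_of_notMem hj hF hS (G := fun y => y ^ 2 - 1) (by fun_prop)
  have h3 : ∫ ω, (Y j ω ^ 2 - 1) ∂P = 0 := by
    rw [integral_sub ((h.hasMoments j).pow 2).integrable (integrable_const 1), h.secondMoment]
    simp
  rw [h1, h2, h.mean, h3]; ring

theorem hasMoments_increment (h : IsEntryModel P Y μ v) (S : Finset (Fin p)) (j : Fin p)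
    (u : Fin p → ℝ) (d : ℝ) :
    HasMoments (fun ω => 2 * ((∑ k ∈ S, u k * Y k ω) * Y j ω) + d * (Y j ω ^ 2 - 1)) P :=
  (((h.hasMoments_linear S u).mul (h.hasMoments j)).const_mul 2).add
    ((((h.hasMoments j).pow 2).sub (HasMoments.const 1)).const_mul d)

theorem integral_pow_le (h : IsEntryModel P Y μ v) (hv : 0 < v) (l : Fin p) (k : ℕ) :
    ∫ ω, Y l ω ^ (2 * k) ∂P ≤ k.factorial * (2 * (Real.exp 1 * v)) ^ k := by
  have hv' : (0 : ℝ) < v := by exact_mod_cast hv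
  have h1 := lintegral_even_pow_le hv' (h.subgaussian l).integrable_exp_mul
    (h.subgaussian l).mgf_le k
  rw [← ofReal_integral_eq_lintegral_ofReal ((h.hasMoments l).pow _).integrable
    (Filter.Eventually.of_forall fun ω => by
      simp only [Pi.zero_apply]; exact (even_two_mul k).pow_nonneg _)] at h1
  rwa [ENNReal.ofReal_le_ofReal_iff (by positivity)] at h1

theorem integral_increment_pow_four_le (h : IsEntryModel P Y μ v) (hv : 0 < v)
    {S : Finset (Fin p)} {j : Fin p} (hj : j ∉ S) (u : Fin p → ℝ) :
    ∫ ω, (2 * ((∑ k ∈ S, u k * Y k ω) * Y j ω) + u j * (Y j ω ^ 2 - 1)) ^ 4 ∂P ≤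
      incrementConst v * (∑ k ∈ insert j S, u k ^ 2) ^ 2 := by
  set R : ℝ := 2 * (Real.exp 1 * v) with hR
  have hR0 : 0 ≤ R := by positivity
  set ℓ : Ω → ℝ := fun ω => ∑ k ∈ S, u k * Y k ω with hℓ
  have hlm : HasMoments ℓ P := h.hasMoments_linear S u
  have hpt : ∀ ω, (2 * (ℓ ω * Y j ω) + u j * (Y j ω ^ 2 - 1)) ^ 4 ≤
      128 * (ℓ ω ^ 4 * Y j ω ^ 4) + 64 * u j ^ 4 * (Y j ω ^ 8 + 1) := by
    intro ω
    have e1 : ∀ a b : ℝ, (a + b) ^ 4 ≤ 8 * a ^ 4 + 8 * b ^ 4 := by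
      intro a b
      nlinarith [sq_nonneg (a - b), sq_nonneg (a + b), sq_nonneg (a ^ 2 - b ^ 2),
        mul_nonneg (sq_nonneg (a - b)) (sq_nonneg (a + b)), mul_nonneg (sq_nonneg (a - b)) (sq_nonneg (a - b)),
        mul_nonneg (sq_nonneg (a - b)) (add_nonneg (sq_nonneg a) (sq_nonneg b))]
    have e2 := e1 (2 * (ℓ ω * Y j ω)) (u j * (Y j ω ^ 2 - 1))
    have e3 := e1 (Y j ω ^ 2) (-1)
    have e4 : 0 ≤ u j ^ 4 := by positivity
    have e5 := mul_le_mul_of_nonneg_left e3 e4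
    nlinarith
  have hi1 : Integrable (fun ω => 128 * (ℓ ω ^ 4 * Y j ω ^ 4)) P :=
    (((hlm.pow 4).mul ((h.hasMoments j).pow 4)).const_mul 128).integrable
  have hi2 : Integrable (fun ω => 64 * u j ^ 4 * (Y j ω ^ 8 + 1)) P :=
    ((((h.hasMoments j).pow 8).add (HasMoments.const 1)).const_mul _).integrable
  refine (integral_mono ((h.hasMoments_increment S j u (u j)).pow 4).integrable (hi1.add hi2)
    hpt).trans ?_
  simp only [Pi.add_apply]
  rw [integral_add hi1 hi2, integral_const_mul, integral_const_mul,
    integral_add ((h.hasMoments j).pow 8).integrable (integrable_const 1)]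
  have h1 := h.integral_mul_comp_of_notMem hj (F := fun x => (∑ k ∈ S, u k * x k) ^ 4)
    (G := fun y => y ^ 4) (by fun_prop) (fun x x' hx => by
      rw [Finset.sum_congr rfl fun k hk => by rw [hx k hk]]) (by fun_prop)
  rw [h1]
  have h2 := h.integral_linear_pow_four_le hv S u
  have h3 := h.integral_pow_le hv j 2
  have h4 := h.integral_pow_le hv j 4
  rw [← hR] at h2 h3 h4
  norm_num [Nat.factorial] at h3 h4
  simp only [integral_const, probReal_univ, one_smul]
  have hlnn : 0 ≤ ∫ ω, (∑ k ∈ S, u k * Y k ω) ^ 4 ∂P := integral_nonneg fun ω => by positivity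
  have hS0 : 0 ≤ ∑ k ∈ S, u k ^ 2 := Finset.sum_nonneg fun _ _ => sq_nonneg _
  have h5 : (∫ ω, (∑ k ∈ S, u k * Y k ω) ^ 4 ∂P) * ∫ ω, Y j ω ^ 4 ∂P ≤
      (2 * R ^ 2 * (∑ k ∈ S, u k ^ 2) ^ 2) * (2 * R ^ 2) :=
    mul_le_mul h2 h3 (integral_nonneg fun ω => by positivity) (by positivity)
  rw [Finset.sum_insert hj, incrementConst, ← hR]
  set s := ∑ k ∈ S, u k ^ 2 with hs
  have h6 : 64 * u j ^ 4 * (∫ ω, Y j ω ^ 8 ∂P + 1) ≤ 64 * u j ^ 4 * (24 * R ^ 4 + 1) := by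
    gcongr
  have h7 : 0 ≤ u j ^ 2 * s := by positivity
  have hR4 : 0 ≤ R ^ 4 := by positivity
  have e1 : (u j ^ 2 + s) ^ 2 = u j ^ 4 + 2 * (u j ^ 2 * s) + s ^ 2 := by ring
  rw [e1]
  nlinarith [mul_nonneg hR4 h7, mul_nonneg hR4 (sq_nonneg s),
    mul_nonneg hR4 (by positivity : 0 ≤ u j ^ 4), sq_nonneg s]

theorem integral_centeredForm (h : IsEntryModel P Y μ v) (hA : A.IsSymm) (S : Finset (Fin p)) :
    ∫ ω, centeredForm A S (fun k => Y k ω) ∂P = 0 := by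
  induction S using Finset.induction_on with
  | empty => simp [centeredForm]
  | insert j S hj ih =>
    simp_rw [centeredForm_insert hA hj]
    rw [integral_add (h.hasMoments_centeredForm A S).integrable
      (h.hasMoments_increment S j (A j) (A j j)).integrable, ih]
    have := h.integral_mul_increment hj (F := fun _ => 1) measurable_const (fun _ _ _ => rfl)
      (HasMoments.const 1) (A j) (A j j)
    simpa using this

/-- Fourth moment of a centered quadratic form. -/
theorem integral_centeredForm_pow_four_le (h : IsEntryModel P Y μ v) (hv : 0 < v) (hA : A.IsSymm)
    (S : Finset (Fin p)) :
    ∫ ω, centeredForm A S (fun k => Y k ω) ^ 4 ∂P ≤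
      (∑ j ∈ S, 4 * (√(incrementConst v) * ∑ k, A j k ^ 2)) ^ 2 := by
  have hQ : 0 ≤ incrementConst v := by unfold incrementConst; positivity
  induction S using Finset.induction_on with
  | empty => simp [centeredForm]
  | insert j S hj ih =>
    simp_rw [centeredForm_insert hA hj]
    rw [Finset.sum_insert hj, add_comm (4 * _)]
    refine integral_add_pow_four_le (h.hasMoments_centeredForm A S)
      (h.hasMoments_increment S j (A j) (A j j)) ?_ (Finset.sum_nonneg fun _ _ => by positivity)
      (by positivity) ih ?_
    · exact h.integral_mul_increment hj (F := fun x => centeredForm A S x ^ 3)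
        ((measurable_centeredForm A S).pow_const 3)
        (fun x x' hx => by rw [centeredForm_congr S hx]) ((h.hasMoments_centeredForm A S).pow 3) _ _
    · refine (h.integral_increment_pow_four_le hv hj (A j)).trans ?_
      rw [mul_pow, Real.sq_sqrt hQ]
      gcongr
      exact Finset.subset_univ _

/-- Second moment of a centered quadratic form. -/
theorem le_integral_centeredForm_sq (h : IsEntryModel P Y μ v) (hA : A.IsSymm) {a : ℝ}
    (ha : a ≤ 2) (haμ : a ≤ μ - 1) (S : Finset (Fin p)) :
    a * ∑ j ∈ S, ∑ k ∈ S, A j k ^ 2 ≤ ∫ ω, centeredForm A S (fun k => Y k ω) ^ 2 ∂P := by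
  induction S using Finset.induction_on with
  | empty => simp [centeredForm]
  | insert j S hj ih =>
    simp_rw [centeredForm_insert hA hj]
    set W : Ω → ℝ := fun ω => centeredForm A S fun k => Y k ω with hW
    set ℓ : Ω → ℝ := fun ω => ∑ k ∈ S, A j k * Y k ω with hℓ
    have hWm : HasMoments W P := h.hasMoments_centeredForm A S
    have hlm : HasMoments ℓ P := h.hasMoments_linear S (A j)
    have hD := h.hasMoments_increment S j (A j) (A j j)
    have hWD := h.integral_mul_increment hj (F := centeredForm A S) (measurable_centeredForm A S)
        (fun x x' hx => by rw [centeredForm_congr S hx]) hWm (A j) (A j j)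
    have hYj := h.hasMoments j
    have hY2 : HasMoments (fun ω => Y j ω ^ 2 - 1) P := (hYj.pow 2).sub (HasMoments.const 1)
    have hcross : ∫ ω, ℓ ω * (Y j ω * (Y j ω ^ 2 - 1)) ∂P = 0 := by
      have h1 := h.integral_mul_comp_of_notMem hj (F := fun x => ∑ k ∈ S, A j k * x k)
        (G := fun y => y * (y ^ 2 - 1)) (by fun_prop) (fun x x' hx => by
          rw [Finset.sum_congr rfl fun k hk => by rw [hx k hk]]) (by fun_prop)
      rw [h.integral_linear, zero_mul] at h1
      exact h1
    have hl2 : ∫ ω, ℓ ω ^ 2 * Y j ω ^ 2 ∂P = ∑ k ∈ S, A j k ^ 2 := by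
      have h1 := h.integral_mul_comp_of_notMem hj (F := fun x => (∑ k ∈ S, A j k * x k) ^ 2)
        (G := fun y => y ^ 2) (by fun_prop) (fun x x' hx => by
          rw [Finset.sum_congr rfl fun k hk => by rw [hx k hk]]) (by fun_prop)
      rw [h.integral_linear_sq, h.secondMoment, mul_one] at h1
      exact h1
    have hY22 : ∫ ω, (Y j ω ^ 2 - 1) ^ 2 ∂P = μ - 1 := by
      have e1 : ∀ ω, (Y j ω ^ 2 - 1) ^ 2 = Y j ω ^ 4 + (-2 * Y j ω ^ 2 + 1) := fun ω => by ring
      simp_rw [e1]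
      rw [integral_add (hYj.pow 4).integrable
        (((hYj.pow 2).const_mul (-2)).add (HasMoments.const 1)).integrable,
        integral_add ((hYj.pow 2).const_mul (-2)).integrable (integrable_const 1),
        integral_const_mul, h.secondMoment, h.fourthMoment]
      simp; ring
    have e2 : ∀ ω, (W ω + (2 * (ℓ ω * Y j ω) + A j j * (Y j ω ^ 2 - 1))) ^ 2 =
        (W ω ^ 2 + 2 * (W ω * (2 * (ℓ ω * Y j ω) + A j j * (Y j ω ^ 2 - 1)))) +
        ((4 * (ℓ ω ^ 2 * Y j ω ^ 2) + 4 * A j j * (ℓ ω * (Y j ω * (Y j ω ^ 2 - 1)))) +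
          A j j ^ 2 * (Y j ω ^ 2 - 1) ^ 2) := fun ω => by ring
    have i1 := (hWm.pow 2).integrable
    have i2 : Integrable (fun ω => 2 * (W ω * (2 * (ℓ ω * Y j ω) + A j j * (Y j ω ^ 2 - 1)))) P :=
      ((hWm.mul hD).const_mul 2).integrable
    have i3 : Integrable (fun ω => 4 * (ℓ ω ^ 2 * Y j ω ^ 2)) P :=
      (((hlm.pow 2).mul (hYj.pow 2)).const_mul 4).integrable
    have i4 : Integrable (fun ω => 4 * A j j * (ℓ ω * (Y j ω * (Y j ω ^ 2 - 1)))) P :=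
      ((hlm.mul (hYj.mul hY2)).const_mul _).integrable
    have i5 : Integrable (fun ω => A j j ^ 2 * (Y j ω ^ 2 - 1) ^ 2) P :=
      ((hY2.pow 2).const_mul _).integrable
    have e3 : ∫ ω, (W ω + (2 * (ℓ ω * Y j ω) + A j j * (Y j ω ^ 2 - 1))) ^ 2 ∂P =
        ∫ ω, W ω ^ 2 ∂P + (4 * ∑ k ∈ S, A j k ^ 2 + A j j ^ 2 * (μ - 1)) := by
      simp_rw [e2]
      have hWD' : ∫ ω, W ω * (2 * (ℓ ω * Y j ω) + A j j * (Y j ω ^ 2 - 1)) ∂P = 0 := hWD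
      have i12 : Integrable (fun ω => W ω ^ 2 +
        2 * (W ω * (2 * (ℓ ω * Y j ω) + A j j * (Y j ω ^ 2 - 1)))) P := i1.add i2
      have i34 : Integrable (fun ω => 4 * (ℓ ω ^ 2 * Y j ω ^ 2) +
        4 * A j j * (ℓ ω * (Y j ω * (Y j ω ^ 2 - 1)))) P := i3.add i4
      have i345 : Integrable (fun ω => (4 * (ℓ ω ^ 2 * Y j ω ^ 2) +
        4 * A j j * (ℓ ω * (Y j ω * (Y j ω ^ 2 - 1)))) + A j j ^ 2 * (Y j ω ^ 2 - 1) ^ 2) P :=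
        i34.add i5
      rw [integral_add i12 i345, integral_add i1 i2, integral_add i34 i5, integral_add i3 i4,
        integral_const_mul, integral_const_mul, integral_const_mul, integral_const_mul, hWD', hl2,
        hcross, hY22]
      ring
    have e4 : ∑ k ∈ S, A k j ^ 2 = ∑ k ∈ S, A j k ^ 2 :=
      Finset.sum_congr rfl fun k _ => by rw [hA.apply j k]
    have e5 : 0 ≤ ∑ k ∈ S, A j k ^ 2 := Finset.sum_nonneg fun _ _ => sq_nonneg _
    rw [e3]
    simp only [Finset.sum_insert hj, Finset.sum_add_distrib]
    rw [e4]
    nlinarith [mul_le_mul_of_nonneg_right haμ (sq_nonneg (A j j)),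
      mul_le_mul_of_nonneg_right ha e5]

end IsEntryModel

section SmallBall

/-- The ratio between the fourth moment of a quadratic form and its squared second moment. -/
noncomputable def kurtosisConst (μ : ℝ) (v : ℝ≥0) : ℝ :=
  8 * (16 * incrementConst v / (min 2 (μ - 1)) ^ 2 + 1)

/-- The small-ball constant of quadratic forms. -/
noncomputable def smallBallConst (μ : ℝ) (v : ℝ≥0) : ℝ :=
  1 / ((1 + 2 / √(min 2 (μ - 1))) * kurtosisConst μ v)

theorem incrementConst_pos (v : ℝ≥0) : 0 < incrementConst v := by
  unfold incrementConst; positivity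

theorem eight_le_kurtosisConst {μ : ℝ} (v : ℝ≥0) : 8 ≤ kurtosisConst μ v := by
  have := incrementConst_pos v
  have h : 0 ≤ 16 * incrementConst v / (min 2 (μ - 1)) ^ 2 := by positivity
  unfold kurtosisConst; linarith

theorem smallBallConst_pos (μ : ℝ) (v : ℝ≥0) : 0 < smallBallConst μ v := by
  have := eight_le_kurtosisConst (μ := μ) v
  unfold smallBallConst
  positivity

theorem add_pow_four_le (a b : ℝ) : (a + b) ^ 4 ≤ 8 * a ^ 4 + 8 * b ^ 4 := by
  nlinarith [mul_nonneg (sq_nonneg (a - b)) (sq_nonneg (a + b)),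
    mul_nonneg (sq_nonneg (a - b)) (sq_nonneg (a - b)),
    mul_nonneg (sq_nonneg (a - b)) (add_nonneg (sq_nonneg a) (sq_nonneg b))]

theorem two_mul_sq_sub_le_one (w : ℝ) : 2 * w ^ 2 - (w ^ 2) ^ 2 ≤ 1 := by
  nlinarith [sq_nonneg (w ^ 2 - 1)]

theorem two_mul_sq_sub_le {w : ℝ} (hw : 0 ≤ w) : 2 * w ^ 2 - (w ^ 2) ^ 2 ≤ 2 * w := by
  rcases le_total w 1 with hw1 | hw1
  · nlinarith [mul_nonneg hw (sub_nonneg.mpr hw1), sq_nonneg (w ^ 2)]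
  · nlinarith [sq_nonneg (w ^ 2 - 1)]

variable {Ω : Type*} [MeasurableSpace Ω] {P : Measure Ω} [IsProbabilityMeasure P] {p : ℕ}
  {Y : Fin p → Ω → ℝ} {μ : ℝ} {v : ℝ≥0} {A : Matrix (Fin p) (Fin p) ℝ}

/-- Small-ball estimate for quadratic forms of independent sub-Gaussian coordinates. -/
theorem IsEntryModel.le_integral_min (h : IsEntryModel P Y μ v) (hv : 0 < v) (hμ : 1 < μ)
    (hA : A.IsSymm) {s : ℝ} (hs : 0 < s) (hsA : s ≤ frobNorm A) :
    smallBallConst μ v * s ≤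
      ∫ ω, min |∑ j, ∑ k, A j k * (Y j ω * Y k ω)| s ∂P := by
  set a : ℝ := min 2 (μ - 1) with ha
  have ha0 : 0 < a := lt_min (by norm_num) (by linarith)
  set W : Ω → ℝ := fun ω => centeredForm A Finset.univ fun k => Y k ω with hW
  set T : ℝ := ∑ j, A j j with hT
  have hWm : HasMoments W P := h.hasMoments_centeredForm A _
  have hξ : ∀ ω, ∑ j, ∑ k, A j k * (Y j ω * Y k ω) = W ω + T := fun ω => by
    simp [hW, hT, centeredForm]
  simp_rw [hξ]
  have hξm : HasMoments (fun ω => W ω + T) P := hWm.add (HasMoments.const T)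
  have hF : frobNorm A ^ 2 = ∑ j, ∑ k, A j k ^ 2 := by
    rw [frobNorm, Real.sq_sqrt (by positivity)]
  have hW0 : ∫ ω, W ω ∂P = 0 := h.integral_centeredForm hA _
  have hW2 : a * frobNorm A ^ 2 ≤ ∫ ω, W ω ^ 2 ∂P := by
    rw [hF]
    exact h.le_integral_centeredForm_sq hA (min_le_left _ _) (min_le_right _ _) Finset.univ
  have hQ := incrementConst_pos v
  have hW4 : ∫ ω, W ω ^ 4 ∂P ≤ 16 * incrementConst v * (frobNorm A ^ 2) ^ 2 := by
    refine (h.integral_centeredForm_pow_four_le hv hA Finset.univ).trans (le_of_eq ?_)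
    rw [← Finset.mul_sum, ← Finset.mul_sum, ← hF, mul_pow, mul_pow, Real.sq_sqrt hQ.le]
    ring
  set q : ℝ := ∫ ω, W ω ^ 2 ∂P + T ^ 2 with hq
  have hqs : a * s ^ 2 ≤ q := by
    have : s ^ 2 ≤ frobNorm A ^ 2 := pow_le_pow_left₀ hs.le hsA 2
    nlinarith [sq_nonneg T, mul_le_mul_of_nonneg_left this ha0.le]
  have hq0 : 0 < q := lt_of_lt_of_le (by positivity) hqs
  have hξ2 : ∫ ω, (W ω + T) ^ 2 ∂P = q := by
    have e1 : ∀ ω, (W ω + T) ^ 2 = W ω ^ 2 + (2 * T * W ω + T ^ 2) := fun ω => by ring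
    simp_rw [e1]
    rw [integral_add (hWm.pow 2).integrable ((hWm.const_mul _).add (HasMoments.const _)).integrable,
      integral_add (hWm.const_mul _).integrable (integrable_const _), integral_const_mul, hW0]
    simp [hq]
  set Γ := kurtosisConst μ v with hΓ
  have hΓ8 : 8 ≤ Γ := eight_le_kurtosisConst v
  have hξ4 : ∫ ω, (W ω + T) ^ 4 ∂P ≤ Γ * q ^ 2 := by
    have e1 : ∀ ω, (W ω + T) ^ 4 ≤ 8 * W ω ^ 4 + 8 * T ^ 4 := fun ω => add_pow_four_le _ _
    have e2 := integral_mono (hξm.pow 4).integrable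
      (((hWm.pow 4).const_mul 8).add (HasMoments.const (8 * T ^ 4))).integrable e1
    rw [integral_add ((hWm.pow 4).const_mul 8).integrable (integrable_const _),
      integral_const_mul] at e2
    simp only [integral_const, probReal_univ, one_smul] at e2
    have e3 : (frobNorm A ^ 2) ^ 2 ≤ (q / a) ^ 2 := by
      refine pow_le_pow_left₀ (by positivity) ?_ 2
      rw [le_div_iff₀ ha0]; nlinarith [sq_nonneg T]
    have e4 : T ^ 4 ≤ q ^ 2 := by
      have : T ^ 2 ≤ q := by
        have : 0 ≤ ∫ ω, W ω ^ 2 ∂P := integral_nonneg fun ω => by positivity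
        linarith
      calc T ^ 4 = (T ^ 2) ^ 2 := by ring
        _ ≤ q ^ 2 := pow_le_pow_left₀ (sq_nonneg T) this 2
    have e5 : 16 * incrementConst v * (frobNorm A ^ 2) ^ 2 ≤
        16 * incrementConst v * (q / a) ^ 2 := mul_le_mul_of_nonneg_left e3 (by positivity)
    have e6 : Γ * q ^ 2 = 8 * (16 * incrementConst v * (q / a) ^ 2) + 8 * q ^ 2 := by
      rw [hΓ, kurtosisConst, ← ha, div_pow]; ring
    rw [e6]
    linarith
  set C : ℝ := 1 + 2 / √a with hC
  have hsa : 0 < √a := Real.sqrt_pos.mpr ha0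
  have hC1 : 1 ≤ C := by rw [hC]; linarith [div_nonneg zero_le_two hsa.le]
  have hpt : ∀ z : ℝ, 2 / (Γ * q) * z ^ 2 - 1 / (Γ * q) ^ 2 * z ^ 4 ≤ C / s * min |z| s := by
    intro z
    have hΓq : 0 < Γ * q := by positivity
    set w : ℝ := |z| / √(Γ * q) with hw
    have hw0 : 0 ≤ w := by positivity
    have hw2 : w ^ 2 = z ^ 2 / (Γ * q) := by
      rw [hw, div_pow, sq_abs, Real.sq_sqrt hΓq.le]
    have e1 : 2 / (Γ * q) * z ^ 2 - 1 / (Γ * q) ^ 2 * z ^ 4 = 2 * w ^ 2 - (w ^ 2) ^ 2 := by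
      rw [hw2, div_pow]; ring
    rw [e1]
    rcases le_total |z| s with hz | hz
    · rw [min_eq_left hz]
      have e2 : 2 * w ≤ C / s * |z| := by
        have : √a * s ≤ √(Γ * q) := by
          refine Real.le_sqrt_of_sq_le ?_
          rw [mul_pow, Real.sq_sqrt ha0.le]
          nlinarith
        calc 2 * w ≤ 2 * (|z| / (√a * s)) := by rw [hw]; gcongr
          _ = 2 / √a / s * |z| := by field_simp
          _ ≤ C / s * |z| := by
            gcongr
            rw [hC]; linarith
      refine le_trans ?_ e2
      exact two_mul_sq_sub_le hw0
    · rw [min_eq_right hz, div_mul_cancel₀ _ hs.ne']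
      exact (two_mul_sq_sub_le_one w).trans hC1
  have hmeasξ : AEStronglyMeasurable (fun ω => W ω + T) P := hξm.integrable.aestronglyMeasurable
  have hmin : Integrable (fun ω => min |W ω + T| s) P := hξm.integrable.abs.inf (integrable_const s)
  have hl1 : Integrable (fun ω => 2 / (Γ * q) * (W ω + T) ^ 2) P :=
    ((hξm.pow 2).const_mul _).integrable
  have hl2 : Integrable (fun ω => 1 / (Γ * q) ^ 2 * (W ω + T) ^ 4) P :=
    ((hξm.pow 4).const_mul _).integrable
  have hfin := integral_mono (hl1.sub hl2) (hmin.const_mul (C / s)) fun ω => hpt (W ω + T)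
  simp only [Pi.sub_apply] at hfin
  rw [integral_sub hl1 hl2, integral_const_mul, integral_const_mul, integral_const_mul, hξ2] at hfin
  have e1 : 1 / (Γ * q) ^ 2 * ∫ ω, (W ω + T) ^ 4 ∂P ≤ 1 / (Γ * q) ^ 2 * (Γ * q ^ 2) :=
    mul_le_mul_of_nonneg_left hξ4 (by positivity)
  have e2 : 1 / (Γ * q) ^ 2 * (Γ * q ^ 2) = 1 / Γ := by field_simp
  have e3 : 2 / (Γ * q) * q = 2 * (1 / Γ) := by field_simp
  rw [e3] at hfin
  have e4 : 1 / Γ ≤ C / s * ∫ ω, min |W ω + T| s ∂P := by linarith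
  rw [smallBallConst, ← ha, ← hC, ← hΓ]
  calc 1 / (C * Γ) * s = (s / C) * (1 / Γ) := by field_simp
    _ ≤ (s / C) * (C / s * ∫ ω, min |W ω + T| s ∂P) :=
      mul_le_mul_of_nonneg_left e4 (by positivity)
    _ = _ := by field_simp

end SmallBall

section Net

variable {E : Type*} [NormedAddCommGroup E] [NormedSpace ℝ E] [FiniteDimensional ℝ E]

theorem exists_half_net :
    ∃ N : Finset E, N.card ≤ 5 ^ Module.finrank ℝ E ∧ (∀ z ∈ N, ‖z‖ ≤ 1) ∧
      ∀ u : E, ‖u‖ ≤ 1 → ∃ z ∈ N, ‖u - z‖ ≤ 1 / 2 := by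
  classical
  let good : Finset E → Prop := fun s =>
    (∀ c ∈ s, ‖c‖ ≤ 2) ∧ ∀ c ∈ s, ∀ d ∈ s, c ≠ d → 1 ≤ ‖c - d‖
  let cards : Set ℕ := {k | ∃ s, good s ∧ s.card = k}
  have hne : cards.Nonempty := ⟨0, ∅, by simp [good], rfl⟩
  have hbdd : BddAbove cards := ⟨5 ^ Module.finrank ℝ E, by
    rintro _ ⟨s, hs, rfl⟩
    exact Besicovitch.card_le_of_separated s hs.1 hs.2⟩
  obtain ⟨s, hs, hcard⟩ := Nat.sSup_mem hne hbdd
  refine ⟨s.image fun z => (1 / 2 : ℝ) • z, ?_, ?_, ?_⟩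
  · exact Finset.card_image_le.trans (Besicovitch.card_le_of_separated s hs.1 hs.2)
  · intro z hz
    obtain ⟨w, hw, rfl⟩ := Finset.mem_image.mp hz
    rw [norm_smul]
    have := hs.1 w hw
    norm_num
    linarith
  · intro u hu
    by_contra! hcon
    have hfar : ∀ w ∈ s, 1 < ‖(2 : ℝ) • u - w‖ := by
      intro w hw
      have h1 := hcon _ (Finset.mem_image_of_mem (fun z => (1 / 2 : ℝ) • z) hw)
      have h2 : (2 : ℝ) • u - w = (2 : ℝ) • (u - (1 / 2 : ℝ) • w) := by
        rw [smul_sub, smul_smul]; norm_num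
      rw [h2, norm_smul]
      norm_num at h1 ⊢
      linarith
    have hnot : (2 : ℝ) • u ∉ s := fun hmem => by
      have := hfar _ hmem
      norm_num at this
    have hgood : good (insert ((2 : ℝ) • u) s) := by
      constructor
      · intro c hc
        rcases Finset.mem_insert.mp hc with rfl | hc
        · rw [norm_smul]; norm_num; linarith
        · exact hs.1 c hc
      · intro c hc d hd hcd
        rcases Finset.mem_insert.mp hc with rfl | hc <;> rcases Finset.mem_insert.mp hd with rfl | hd
        · exact absurd rfl hcd
        · exact (hfar d hd).le
        · rw [norm_sub_rev]; exact (hfar c hc).le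
        · exact hs.2 c hc d hd hcd
    have h1 : (insert ((2 : ℝ) • u) s).card ≤ sSup cards := le_csSup hbdd ⟨_, hgood, rfl⟩
    rw [Finset.card_insert_of_notMem hnot, hcard] at h1
    omega

theorem norm_le_of_half_net {F : Type*} [NormedAddCommGroup F] [NormedSpace ℝ F] {N : Finset E}
    (hN : ∀ u : E, ‖u‖ ≤ 1 → ∃ z ∈ N, ‖u - z‖ ≤ 1 / 2) (T : E →ₗ[ℝ] F) {B : ℝ} (hB : 0 ≤ B)
    (h : ∀ z ∈ N, ‖T z‖ ≤ B) (u : E) : ‖T u‖ ≤ 2 * B * ‖u‖ := by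
  set T' : E →L[ℝ] F := LinearMap.toContinuousLinearMap T with hT'
  have h1 : ‖T'‖ ≤ B + ‖T'‖ / 2 := by
    refine ContinuousLinearMap.opNorm_le_of_unit_norm (by positivity) fun u hu => ?_
    obtain ⟨z, hz, hz'⟩ := hN u hu.le
    have h2 : T' u = T' z + T' (u - z) := by rw [← map_add, add_sub_cancel]
    rw [h2]
    refine (norm_add_le _ _).trans (add_le_add (h z hz) ?_)
    refine (T'.le_opNorm _).trans ?_
    nlinarith [norm_nonneg T']
  have h3 : ‖T'‖ ≤ 2 * B := by linarith
  exact (T'.le_opNorm u).trans (mul_le_mul_of_nonneg_right h3 (norm_nonneg _))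

theorem norm_toLpLin_le_of_half_net {p : ℕ} {N : Finset (EuclideanSpace ℝ (Fin p))}
    (hN : ∀ u : EuclideanSpace ℝ (Fin p), ‖u‖ ≤ 1 → ∃ z ∈ N, ‖u - z‖ ≤ 1 / 2)
    (M : Matrix (Fin p) (Fin p) ℝ) {B : ℝ} (hB : 0 ≤ B)
    (h : ∀ z ∈ N, ∀ w ∈ N, |⟪z, Matrix.toLpLin 2 2 M w⟫| ≤ B) (u : EuclideanSpace ℝ (Fin p)) :
    ‖Matrix.toLpLin 2 2 M u‖ ≤ 4 * B * ‖u‖ := by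
  have h1 : ∀ w ∈ N, ‖Matrix.toLpLin 2 2 M w‖ ≤ 2 * B := by
    intro w hw
    have h2 := norm_le_of_half_net hN (innerₛₗ ℝ (Matrix.toLpLin 2 2 M w)) hB (fun z hz => by
      rw [innerₛₗ_apply_apply, real_inner_comm]; exact h z hz w hw) (Matrix.toLpLin 2 2 M w)
    rw [innerₛₗ_apply_apply, real_inner_self_eq_norm_sq, Real.norm_of_nonneg (sq_nonneg _)] at h2
    by_contra! hcon
    nlinarith [norm_nonneg (Matrix.toLpLin 2 2 M w)]
  have := norm_le_of_half_net hN (Matrix.toLpLin 2 2 M) (by positivity) h1 u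
  linarith

end Net

section Regular

theorem cosh_mul_le {k t : ℝ} (h0 : 0 ≤ k) (h1 : k ≤ 1) :
    Real.cosh (k * t) ≤ 1 - k ^ 2 + k ^ 2 * Real.cosh t := by
  have hs := (Real.hasSum_cosh t).mul_left (k ^ 2)
  have hs' := (hasSum_ite_eq (0 : ℕ) (1 - k ^ 2)).add hs
  refine hasSum_le (fun n => ?_) (Real.hasSum_cosh (k * t)) hs'
  rcases Nat.eq_zero_or_pos n with rfl | hn
  · simp
  · rw [if_neg hn.ne', zero_add, mul_pow, mul_div_assoc]
    refine mul_le_mul_of_nonneg_right ?_ ?_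
    · exact pow_le_pow_of_le_one h0 h1 (by omega)
    · rw [pow_mul]; positivity

variable {p : ℕ}

local notation "𝓔" => EuclideanSpace ℝ (Fin p)
local notation "𝓜" => Matrix (Fin p) (Fin p) ℝ

/-- Sub-Gaussian one-dimensional marginals and a small-ball estimate for quadratic forms. -/
structure IsRegularLaw (ρ : Measure (EuclideanSpace ℝ (Fin p))) (c θ : ℝ) : Prop where
  integrable_exp_sq : ∀ u : 𝓔, ‖u‖ ≤ 1 → Integrable (fun x => Real.exp (c * ⟪x, u⟫ ^ 2)) ρ
  integral_exp_sq_le : ∀ u : 𝓔, ‖u‖ ≤ 1 → ∫ x, Real.exp (c * ⟪x, u⟫ ^ 2) ∂ρ ≤ 2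
  le_integral_min : ∀ A : 𝓜, A.IsSymm → ∀ s, 0 < s → s ≤ frobNorm A →
    θ * s ≤ ∫ x, min |matInner (outer x x) A| s ∂ρ

theorem matInner_outer_self (x : 𝓔) (A : 𝓜) :
    matInner (outer x x) A = ∑ j, ∑ k, A j k * (x j * x k) := by
  simp [matInner, outer, mul_comm]

theorem continuous_matInner_outer (A : 𝓜) : Continuous fun x : 𝓔 => matInner (outer x x) A := by
  simp_rw [matInner_outer_self]; fun_prop

namespace IsRegularLaw

variable {ρ : Measure (EuclideanSpace ℝ (Fin p))} [IsProbabilityMeasure ρ] {c θ : ℝ}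

theorem integrable_inner_sq (h : IsRegularLaw ρ c θ) (hc : 0 < c) {u : 𝓔} (hu : ‖u‖ ≤ 1) :
    Integrable (fun x => ⟪x, u⟫ ^ 2) ρ := by
  refine ((h.integrable_exp_sq u hu).const_mul c⁻¹).mono' (by fun_prop)
    (Filter.Eventually.of_forall fun x => ?_)
  rw [Real.norm_of_nonneg (sq_nonneg _), le_inv_mul_iff₀ hc]
  linarith [Real.add_one_le_exp (c * ⟪x, u⟫ ^ 2)]

theorem integrable_matInner (h : IsRegularLaw ρ c θ) (hc : 0 < c) (A : 𝓜) :
    Integrable (fun x => matInner (outer x x) A) ρ := by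
  simp_rw [matInner_outer_self]
  have hsq : ∀ j, Integrable (fun x : 𝓔 => x j ^ 2) ρ := fun j => by
    have := h.integrable_inner_sq hc (u := EuclideanSpace.single j 1) (by simp)
    simpa [EuclideanSpace.inner_single_right] using this
  refine integrable_finsetSum _ fun j _ => integrable_finsetSum _ fun k _ =>
    Integrable.const_mul ?_ _
  refine ((hsq j).add (hsq k)).mono' (by fun_prop) (Filter.Eventually.of_forall fun x => ?_)
  simp only [Pi.add_apply]
  rw [Real.norm_eq_abs, abs_mul, ← sq_abs (x j), ← sq_abs (x k)]
  nlinarith [sq_nonneg (|x j| - |x k|), sq_nonneg |x j|, sq_nonneg |x k|]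

/-- With overwhelming probability all empirical linear forms are bounded. -/
theorem measureReal_not_linearFormBound_le (h : IsRegularLaw ρ c θ) (hc : 0 < c) {n : ℕ}
    (hpn : p ≤ n) :
    (Measure.pi fun _ : Fin n => ρ).real {x | ¬ LinearFormBound (4 / √c) x} ≤ Real.exp (-n) := by
  obtain ⟨N, hNc, hN1, hN⟩ := exists_half_net (E := 𝓔)
  rw [finrank_euclideanSpace_fin] at hNc
  have hsub : {x : Fin n → 𝓔 | ¬ LinearFormBound (4 / √c) x} ⊆
      ⋃ z ∈ N, {x | Real.exp (4 * n) ≤ ∏ i, Real.exp (c * ⟪x i, z⟫ ^ 2)} := by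
    intro x hx
    by_contra hcon
    apply hx
    simp only [Set.mem_iUnion, not_exists] at hcon
    set T : 𝓔 →ₗ[ℝ] EuclideanSpace ℝ (Fin n) :=
      (WithLp.linearEquiv 2 ℝ (Fin n → ℝ)).symm.toLinearMap ∘ₗ
        LinearMap.pi fun i => innerₛₗ ℝ (x i) with hT
    have hTn : ∀ u, ‖T u‖ ^ 2 = ∑ i, ⟪x i, u⟫ ^ 2 := by
      intro u
      rw [EuclideanSpace.norm_sq_eq]
      simp [hT]
    have h1 : ∀ z ∈ N, ‖T z‖ ≤ 2 / √c * √n := by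
      intro z hz
      have h2 := hcon z hz
      rw [Set.mem_ofPred_eq, not_le, ← Real.exp_sum, Real.exp_lt_exp, ← Finset.mul_sum, ← hTn] at h2
      refine abs_le_of_sq_le_sq' ?_ (by positivity) |>.2
      rw [mul_pow, div_pow, Real.sq_sqrt hc.le, Real.sq_sqrt (by positivity), div_mul_eq_mul_div,
        le_div_iff₀ hc]
      linarith
    intro u
    rw [← hTn]
    have h2 := norm_le_of_half_net hN T (by positivity) h1 u
    refine (pow_le_pow_left₀ (norm_nonneg _) h2 2).trans (le_of_eq ?_)
    rw [mul_pow, mul_pow, mul_pow, Real.sq_sqrt (by positivity), div_pow, div_pow]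
    ring
  refine (measureReal_mono hsub (measure_ne_top _ _)).trans
    ((measureReal_biUnion_finset_le _ _).trans ?_)
  have hz : ∀ z ∈ N, (Measure.pi fun _ : Fin n => ρ).real
      {x | Real.exp (4 * n) ≤ ∏ i, Real.exp (c * ⟪x i, z⟫ ^ 2)} ≤ 2 ^ n * Real.exp (-(4 * n)) := by
    intro z hz
    have hi : Integrable (fun x : Fin n → 𝓔 => ∏ i, Real.exp (c * ⟪x i, z⟫ ^ 2))
        (Measure.pi fun _ => ρ) :=
      Integrable.fintype_prod (f := fun _ x => Real.exp (c * ⟪x, z⟫ ^ 2)) fun _ =>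
        h.integrable_exp_sq z (hN1 z hz)
    have h1 := mul_meas_ge_le_integral_of_nonneg
      (Filter.Eventually.of_forall fun x => Finset.prod_nonneg fun i _ => (Real.exp_pos _).le) hi
      (Real.exp (4 * n))
    rw [integral_fintype_prod_eq_pow (fun x : 𝓔 => Real.exp (c * ⟪x, z⟫ ^ 2)), Fintype.card_fin] at h1
    have h2 : (∫ x, Real.exp (c * ⟪x, z⟫ ^ 2) ∂ρ) ^ n ≤ 2 ^ n :=
      pow_le_pow_left₀ (integral_nonneg fun _ => (Real.exp_pos _).le)
        (h.integral_exp_sq_le z (hN1 z hz)) n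
    rw [Real.exp_neg, ← div_eq_mul_inv, le_div_iff₀ (Real.exp_pos _), mul_comm]
    exact h1.trans h2
  refine (Finset.sum_le_sum hz).trans ?_
  rw [Finset.sum_const, nsmul_eq_mul]
  have h5 : (N.card : ℝ) ≤ 5 ^ n := by
    calc (N.card : ℝ) ≤ ((5 ^ p : ℕ) : ℝ) := by exact_mod_cast hNc
      _ ≤ 5 ^ n := by push_cast; exact pow_le_pow_right₀ (by norm_num) hpn
  have he : (10 : ℝ) ≤ Real.exp 3 := by
    have := Real.exp_one_gt_d9
    have h3 : Real.exp 3 = Real.exp 1 ^ 3 := by rw [← Real.exp_nat_mul]; norm_num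
    rw [h3]
    calc (10 : ℝ) ≤ 2.7 ^ 3 := by norm_num
      _ ≤ _ := pow_le_pow_left₀ (by norm_num) (by linarith) 3
  calc (N.card : ℝ) * (2 ^ n * Real.exp (-(4 * n))) ≤ 5 ^ n * (2 ^ n * Real.exp (-(4 * n))) := by
        gcongr
    _ = 10 ^ n * Real.exp (-(4 * n)) := by rw [← mul_assoc, ← mul_pow]; norm_num
    _ ≤ Real.exp 3 ^ n * Real.exp (-(4 * n)) := by gcongr
    _ = Real.exp (-n) := by rw [← Real.exp_nat_mul, ← Real.exp_add]; congr 1; ring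

/-- Exponential moments of a signed product of two marginals. -/
theorem integral_exp_signed_le (h : IsRegularLaw ρ c θ) {k : ℝ} (hk0 : 0 ≤ k) (hk1 : k ≤ 1)
    {u w : 𝓔} (hu : ‖u‖ ≤ 1) (hw : ‖w‖ ≤ 1) (hc : 0 < c) :
    Integrable (fun q : 𝓔 × ℝ => Real.exp (k * c * (q.2 * (⟪q.1, u⟫ * ⟪q.1, w⟫)))) (signed ρ) ∧
      ∫ q, Real.exp (k * c * (q.2 * (⟪q.1, u⟫ * ⟪q.1, w⟫))) ∂(signed ρ) ≤ Real.exp (k ^ 2) := by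
  set g : 𝓔 → ℝ := fun x => 2⁻¹ * (Real.exp (c * ⟪x, u⟫ ^ 2) + Real.exp (c * ⟪x, w⟫ ^ 2)) with hg
  have hgi : Integrable g ρ :=
    ((h.integrable_exp_sq u hu).add (h.integrable_exp_sq w hw)).const_mul _
  have hg2 : ∫ x, g x ∂ρ ≤ 2 := by
    rw [hg, integral_const_mul,
      integral_add (h.integrable_exp_sq u hu) (h.integrable_exp_sq w hw)]
    linarith [h.integral_exp_sq_le u hu, h.integral_exp_sq_le w hw]
  have hexp : ∀ (x : 𝓔) (ε : ℝ), |ε| ≤ 1 → Real.exp (ε * (c * (⟪x, u⟫ * ⟪x, w⟫))) ≤ g x := by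
    intro x ε hε
    have h1 : ε * (c * (⟪x, u⟫ * ⟪x, w⟫)) ≤ (1 / 2) * (c * ⟪x, u⟫ ^ 2) + (1 / 2) * (c * ⟪x, w⟫ ^ 2) := by
      have e1 : ε * (c * (⟪x, u⟫ * ⟪x, w⟫)) ≤ c * (|⟪x, u⟫| * |⟪x, w⟫|) := by
        refine (le_abs_self _).trans ?_
        rw [abs_mul, abs_mul, abs_of_pos hc, abs_mul]
        exact mul_le_of_le_one_left (by positivity) hε
      rw [← sq_abs ⟪x, u⟫, ← sq_abs ⟪x, w⟫]
      nlinarith [mul_nonneg hc.le (sq_nonneg (|⟪x, u⟫| - |⟪x, w⟫|))]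
    refine (Real.exp_le_exp.mpr h1).trans ?_
    have h2 := convexOn_exp.2 (Set.mem_univ (c * ⟪x, u⟫ ^ 2)) (Set.mem_univ (c * ⟪x, w⟫ ^ 2))
      (by norm_num : (0 : ℝ) ≤ 1 / 2) (by norm_num : (0 : ℝ) ≤ 1 / 2) (by norm_num)
    simp only [smul_eq_mul] at h2
    rw [hg]
    simp only
    linarith
  have hint : ∀ ε : ℝ, |ε| ≤ 1 → Integrable (fun x => Real.exp (ε * (c * (⟪x, u⟫ * ⟪x, w⟫)))) ρ :=
    fun ε hε => hgi.mono' (by fun_prop) (Filter.Eventually.of_forall fun x => by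
      rw [Real.norm_of_nonneg (Real.exp_pos _).le]; exact hexp x ε hε)
  have hka : |k| ≤ 1 := by rwa [abs_of_nonneg hk0]
  have hp := hint k hka
  have hm := hint (-k) (by rwa [abs_neg])
  have hm1 : Integrable (fun x : 𝓔 => Real.exp (k * c * (1 * (⟪x, u⟫ * ⟪x, w⟫)))) ρ := by
    refine hp.congr (Filter.Eventually.of_forall fun x => ?_); simp only; congr 1; ring
  have hm2 : Integrable (fun x : 𝓔 => Real.exp (k * c * (-1 * (⟪x, u⟫ * ⟪x, w⟫)))) ρ := by
    refine hm.congr (Filter.Eventually.of_forall fun x => ?_); simp only; congr 1; ring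
  have hmeas : Measurable fun q : 𝓔 × ℝ => Real.exp (k * c * (q.2 * (⟪q.1, u⟫ * ⟪q.1, w⟫))) := by
    fun_prop
  refine ⟨integrable_signed ρ hmeas hm1 hm2, ?_⟩
  rw [integral_signed ρ hmeas hm1 hm2, ← mul_add, ← integral_add hm1 hm2, ← integral_const_mul]
  calc ∫ x, 2⁻¹ * (Real.exp (k * c * (1 * (⟪x, u⟫ * ⟪x, w⟫))) +
        Real.exp (k * c * (-1 * (⟪x, u⟫ * ⟪x, w⟫)))) ∂ρ
      ≤ ∫ x, (1 - k ^ 2 + k ^ 2 * g x) ∂ρ := by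
        refine integral_mono ((hm1.add hm2).const_mul _)
          ((integrable_const _).add (hgi.const_mul _)) fun x => ?_
        simp only
        have e1 := cosh_mul_le (t := c * (⟪x, u⟫ * ⟪x, w⟫)) hk0 hk1
        rw [Real.cosh_eq, Real.cosh_eq] at e1
        have e2 := hexp x 1 (by simp)
        have e3 := hexp x (-1) (by simp)
        rw [one_mul] at e2
        rw [neg_one_mul] at e3
        have e4 : k ^ 2 * ((Real.exp (c * (⟪x, u⟫ * ⟪x, w⟫)) + Real.exp (-(c * (⟪x, u⟫ * ⟪x, w⟫)))) / 2)
            ≤ k ^ 2 * g x := mul_le_mul_of_nonneg_left (by linarith) (sq_nonneg k)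
        have e5 : k * c * (1 * (⟪x, u⟫ * ⟪x, w⟫)) = k * (c * (⟪x, u⟫ * ⟪x, w⟫)) := by ring
        have e6 : k * c * (-1 * (⟪x, u⟫ * ⟪x, w⟫)) = -(k * (c * (⟪x, u⟫ * ⟪x, w⟫))) := by ring
        rw [e5, e6]
        linarith
    _ = 1 - k ^ 2 + k ^ 2 * ∫ x, g x ∂ρ := by
        rw [integral_add (integrable_const _) (hgi.const_mul _), integral_const_mul]; simp
    _ ≤ 1 + k ^ 2 := by nlinarith [sq_nonneg k]
    _ ≤ Real.exp (k ^ 2) := by linarith [Real.add_one_le_exp (k ^ 2)]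

/-- The Rademacher complexity of a set of matrices of bounded nuclear norm. -/
theorem integral_sup'_signed_le (h : IsRegularLaw ρ c θ) (hc : 0 < c) {m : ℕ} (hp : 0 < p)
    (hpm : p ≤ m) {D : Finset (Matrix (Fin p) (Fin p) ℝ)} (hD : D.Nonempty)
    (h5 : ∀ A ∈ D, nuclearNorm A ≤ 5) :
    ∫ q, D.sup' hD (fun A => ∑ i, 2 * ((q i).2 * matInner (outer (q i).1 (q i).1) A))
        ∂(Measure.pi fun _ : Fin m => signed ρ) ≤ 200 * √(p * m) / c := by
  have hp' : (0 : ℝ) < p := by exact_mod_cast hp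
  have hpm' : (p : ℝ) ≤ m := by exact_mod_cast hpm
  have hm' : (0 : ℝ) < m := hp'.trans_le hpm'
  obtain ⟨N, hNc, hN1, hN⟩ := exists_half_net (E := 𝓔)
  rw [finrank_euclideanSpace_fin] at hNc
  set k : ℝ := √(p / m) with hk
  have hk0 : 0 < k := Real.sqrt_pos.mpr (by positivity)
  have hk2 : k ^ 2 = p / m := Real.sq_sqrt (by positivity)
  have hk1 : k ≤ 1 := by
    rw [hk, Real.sqrt_le_left one_pos.le, one_pow, div_le_one hm']; exact hpm'
  set b : 𝓔 → 𝓔 → (Fin m → 𝓔 × ℝ) → ℝ := fun z w q =>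
    ∑ i, (q i).2 * (⟪(q i).1, z⟫ * ⟪(q i).1, w⟫) with hb
  set K : ℝ := 5 * p with hK
  set l : ℝ := k * c with hl
  have hl0 : 0 < l := by positivity
  set H : (Fin m → 𝓔 × ℝ) → ℝ := fun q => ∑ z ∈ N, ∑ w ∈ N,
    (Real.exp (l * b z w q) + Real.exp (l * b (-z) w q)) with hH
  have hexpI : ∀ z w : 𝓔, ‖z‖ ≤ 1 → ‖w‖ ≤ 1 →
      Integrable (fun q => Real.exp (l * b z w q)) (Measure.pi fun _ : Fin m => signed ρ) ∧
      ∫ q, Real.exp (l * b z w q) ∂(Measure.pi fun _ : Fin m => signed ρ) ≤ Real.exp p := by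
    intro z w hz hw
    obtain ⟨hi, hle⟩ := h.integral_exp_signed_le hk0.le hk1 hz hw hc
    have e1 : ∀ q : Fin m → 𝓔 × ℝ, Real.exp (l * b z w q) =
        ∏ i, Real.exp (k * c * ((q i).2 * (⟪(q i).1, z⟫ * ⟪(q i).1, w⟫))) := by
      intro q
      rw [← Real.exp_sum, ← Finset.mul_sum]
    simp_rw [e1]
    constructor
    · exact Integrable.fintype_prod
        (f := fun _ (q : 𝓔 × ℝ) => Real.exp (k * c * (q.2 * (⟪q.1, z⟫ * ⟪q.1, w⟫)))) fun _ => hi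
    · rw [integral_fintype_prod_eq_pow
        (fun q : 𝓔 × ℝ => Real.exp (k * c * (q.2 * (⟪q.1, z⟫ * ⟪q.1, w⟫)))), Fintype.card_fin]
      refine (pow_le_pow_left₀ (integral_nonneg fun _ => (Real.exp_pos _).le) hle m).trans
        (le_of_eq ?_)
      rw [← Real.exp_nat_mul, hk2]
      congr 1
      field_simp
  have hsum : ∀ z ∈ N, ∀ w ∈ N, Integrable
      (fun q => Real.exp (l * b z w q) + Real.exp (l * b (-z) w q))
      (Measure.pi fun _ : Fin m => signed ρ) := fun z hz w hw =>
    (hexpI z w (hN1 z hz) (hN1 w hw)).1.add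
      (hexpI (-z) w (by rw [norm_neg]; exact hN1 z hz) (hN1 w hw)).1
  have hHi : Integrable H (Measure.pi fun _ : Fin m => signed ρ) :=
    integrable_finsetSum _ fun z hz => integrable_finsetSum _ fun w hw => hsum z hz w hw
  have hHint : ∫ q, H q ∂(Measure.pi fun _ : Fin m => signed ρ) ≤ Real.exp K := by
    simp only [hH]
    rw [integral_finsetSum _ fun z hz => integrable_finsetSum _ fun w hw => hsum z hz w hw]
    have e1 : ∀ z ∈ N, ∫ q, ∑ w ∈ N, (Real.exp (l * b z w q) + Real.exp (l * b (-z) w q))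
        ∂(Measure.pi fun _ : Fin m => signed ρ) ≤ ∑ w ∈ N, 2 * Real.exp p := by
      intro z hz
      rw [integral_finsetSum _ fun w hw => hsum z hz w hw]
      refine Finset.sum_le_sum fun w hw => ?_
      have e2 := hexpI z w (hN1 z hz) (hN1 w hw)
      have e3 := hexpI (-z) w (by rw [norm_neg]; exact hN1 z hz) (hN1 w hw)
      rw [integral_add e2.1 e3.1]
      linarith [e2.2, e3.2]
    refine (Finset.sum_le_sum e1).trans ?_
    rw [Finset.sum_const, Finset.sum_const, nsmul_eq_mul, nsmul_eq_mul]
    have hNc' : (N.card : ℝ) ≤ 5 ^ p := by exact_mod_cast hNc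
    have he : (50 : ℝ) ≤ Real.exp 4 := by
      have := Real.exp_one_gt_d9
      have h3 : Real.exp 4 = Real.exp 1 ^ 4 := by rw [← Real.exp_nat_mul]; norm_num
      rw [h3]
      calc (50 : ℝ) ≤ 2.7 ^ 4 := by norm_num
        _ ≤ _ := pow_le_pow_left₀ (by norm_num) (by linarith) 4
    calc (N.card : ℝ) * (N.card * (2 * Real.exp p)) ≤ 5 ^ p * (5 ^ p * (2 * Real.exp p)) := by gcongr
      _ = (25 ^ p * 2) * Real.exp p := by
          rw [show (25 : ℝ) = 5 * 5 by norm_num, mul_pow]; ring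
      _ ≤ (25 ^ p * 2 ^ p) * Real.exp p := by
          gcongr
          exact le_self_pow₀ (by norm_num) hp.ne'
      _ = 50 ^ p * Real.exp p := by rw [← mul_pow]; norm_num
      _ ≤ Real.exp 4 ^ p * Real.exp p := by gcongr
      _ = Real.exp K := by rw [← Real.exp_nat_mul, ← Real.exp_add, hK]; congr 1; ring
  have hpt : ∀ q : Fin m → 𝓔 × ℝ,
      D.sup' hD (fun A => ∑ i, 2 * ((q i).2 * matInner (outer (q i).1 (q i).1) A)) ≤
        40 / l * (K - 1 + Real.exp (-K) * H q) := by
    intro q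
    set M : 𝓜 := ∑ i, (q i).2 • outer (q i).1 (q i).1 with hM
    have hMA : ∀ A : 𝓜, matInner M A = ∑ i, (q i).2 * matInner (outer (q i).1 (q i).1) A := by
      intro A
      rw [matInner_eq_trace, hM, Matrix.transpose_sum, Finset.sum_mul, Matrix.trace_sum]
      refine Finset.sum_congr rfl fun i _ => ?_
      rw [Matrix.transpose_smul, Matrix.smul_mul, Matrix.trace_smul, ← matInner_eq_trace,
        smul_eq_mul]
    have hbM : ∀ z w : 𝓔, ⟪z, Matrix.toLpLin 2 2 M w⟫ = b z w q := by
      intro z w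
      rw [← matInner_outer_right, hMA, hb]
      exact Finset.sum_congr rfl fun i _ => by rw [matInner_outer_outer]
    set B : ℝ := 1 / l * (K - 1 + Real.exp (-K) * H q) with hB
    have hBle : ∀ z ∈ N, ∀ w ∈ N, |⟪z, Matrix.toLpLin 2 2 M w⟫| ≤ B := by
      intro z hz w hw
      rw [hbM]
      have hneg : b (-z) w q = -b z w q := by
        simp [hb]
      have hterm : Real.exp (l * b z w q) + Real.exp (l * b (-z) w q) ≤ H q := by
        refine (Finset.single_le_sum (f := fun w => Real.exp (l * b z w q) + Real.exp (l * b (-z) w q))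
          (fun _ _ => by positivity) hw).trans ?_
        exact Finset.single_le_sum (f := fun z => ∑ w ∈ N,
          (Real.exp (l * b z w q) + Real.exp (l * b (-z) w q)))
          (fun _ _ => Finset.sum_nonneg fun _ _ => by positivity) hz
      have habs : Real.exp (l * |b z w q|) ≤ H q := by
        refine le_trans ?_ hterm
        rw [hneg]
        rcases abs_cases (b z w q) with ⟨e, _⟩ | ⟨e, _⟩ <;> rw [e]
        · linarith [Real.exp_pos (l * -b z w q)]
        · linarith [Real.exp_pos (l * b z w q)]
      rw [hB, one_div, le_inv_mul_iff₀ hl0]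
      have e1 := Real.add_one_le_exp (l * |b z w q| - K)
      rw [sub_eq_add_neg, Real.exp_add, mul_comm (Real.exp _)] at e1
      have e2 := mul_le_mul_of_nonneg_left habs (Real.exp_pos (-K)).le
      linarith
    obtain ⟨z₀, hz₀, -⟩ := hN 0 (by simp)
    have hB0 : 0 ≤ B := (abs_nonneg _).trans (hBle z₀ hz₀ z₀ hz₀)
    refine Finset.sup'_le hD _ fun A hA => ?_
    rw [← Finset.mul_sum, ← hMA]
    have h1 := matInner_le_mul_nuclearNorm (norm_toLpLin_le_of_half_net hN M hB0 hBle) A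
    have h2 := mul_le_mul_of_nonneg_left (h5 A hA) (by positivity : 0 ≤ 4 * B)
    have e3 : 40 / l * (K - 1 + Real.exp (-K) * H q) = 40 * B := by rw [hB]; ring
    rw [e3]; linarith
  have hψ : ∀ A : 𝓜, Integrable
      (fun q : Fin m → 𝓔 × ℝ => ∑ i, 2 * ((q i).2 * matInner (outer (q i).1 (q i).1) A))
      (Measure.pi fun _ : Fin m => signed ρ) := by
    intro A
    have hi := h.integrable_matInner hc A
    have hcm := (continuous_matInner_outer A).measurable
    have : Integrable (fun q : 𝓔 × ℝ => 2 * (q.2 * matInner (outer q.1 q.1) A)) (signed ρ) := by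
      refine integrable_signed ρ ?_ ((hi.const_mul _).const_mul _) ((hi.const_mul _).const_mul _)
      exact (measurable_snd.mul (hcm.comp measurable_fst)).const_mul 2
    simpa using integrable_sum_pi (signed ρ) (m := m) this 0
  refine (integral_mono (integrable_sup' hD hψ)
    (((integrable_const (K - 1)).add (hHi.const_mul (Real.exp (-K)))).const_mul (40 / l)) hpt).trans ?_
  simp only [Pi.add_apply]
  rw [integral_const_mul, integral_add (integrable_const _) (hHi.const_mul _), integral_const_mul]
  simp only [integral_const, probReal_univ, one_smul]
  have e1 : Real.exp (-K) * ∫ q, H q ∂(Measure.pi fun _ : Fin m => signed ρ) ≤ 1 := by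
    have := mul_le_mul_of_nonneg_left hHint (Real.exp_pos (-K)).le
    rwa [← Real.exp_add, neg_add_cancel, Real.exp_zero] at this
  calc 40 / l * (K - 1 + Real.exp (-K) * ∫ q, H q ∂(Measure.pi fun _ : Fin m => signed ρ))
      ≤ 40 / l * K := mul_le_mul_of_nonneg_left (by linarith) (by positivity)
    _ = 200 * (p / k) / c := by rw [hl, hK]; field_simp; norm_num
    _ = 200 * √(p * m) / c := by
        have : (p : ℝ) / k = √(p * m) := by
          rw [div_eq_iff hk0.ne', hk, ← Real.sqrt_mul (by positivity)]
          have : (p : ℝ) * m * (p / m) = p ^ 2 := by field_simp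
          rw [this, Real.sqrt_sq hp'.le]
        rw [this]

end IsRegularLaw

end Regular

section Uniform

variable {p : ℕ}

local notation "𝓔" => EuclideanSpace ℝ (Fin p)
local notation "𝓜" => Matrix (Fin p) (Fin p) ℝ

theorem sum_update_le {X : Type*} {m : ℕ} {G : X → ℝ} {c : ℝ} (h : ∀ t t', G t ≤ G t' + c)
    (x : Fin m → X) (i : Fin m) (t : X) :
    ∑ j, G (Function.update x i t j) ≤ ∑ j, G (x j) + c := by
  have h1 : ∑ j, (G (Function.update x i t j) - G (x j)) = G t - G (x i) := by
    rw [Finset.sum_eq_single i]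
    · simp
    · intro j _ hj; simp [Function.update_of_ne hj]
    · simp
  rw [Finset.sum_sub_distrib] at h1
  linarith [h t (x i)]

namespace IsRegularLaw

variable {ρ : Measure (EuclideanSpace ℝ (Fin p))} [IsProbabilityMeasure ρ] {c θ : ℝ}

/-- Uniform lower bound for the empirical `ℓ¹` loss over finitely many matrices. -/
theorem measureReal_exists_lt_le (h : IsRegularLaw ρ c θ) (hc : 0 < c) (hθ : 0 < θ) {m : ℕ}
    (hp : 0 < p) (hpm : p ≤ m) {s : ℝ} (hs : 0 < s) (hps : p * (800 / (c * θ)) ^ 2 ≤ s ^ 2 * m)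
    {D : Finset (Matrix (Fin p) (Fin p) ℝ)}
    (hD : ∀ A ∈ D, A.IsSymm ∧ nuclearNorm A ≤ 5 ∧ s ≤ frobNorm A) :
    (Measure.pi fun _ : Fin m => ρ).real
      {x | ∃ A ∈ D, ∑ i, |matInner (outer (x i) (x i)) A| < θ / 2 * s * m} ≤
      Real.exp (-(θ ^ 2 * m / 8)) := by
  rcases D.eq_empty_or_nonempty with rfl | hne
  · simp [Real.exp_nonneg]
  have hm : 0 < m := hp.trans_le hpm
  have hm' : (0 : ℝ) < m := by exact_mod_cast hm
  set φ : 𝓜 → 𝓔 → ℝ := fun A x => min |matInner (outer x x) A| s with hφ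
  have hφ0 : ∀ A x, 0 ≤ φ A x := fun A x => le_min (abs_nonneg _) hs.le
  have hφs : ∀ A x, φ A x ≤ s := fun A x => min_le_right _ _
  have hφm : ∀ A, Measurable (φ A) := fun A =>
    ((continuous_matInner_outer A).abs.min continuous_const).measurable
  have hφi : ∀ A, Integrable (φ A) ρ := fun A =>
    integrable_of_abs_le ρ (hφm A) (B := s) fun x => by
      rw [abs_of_nonneg (hφ0 A x)]; exact hφs A x
  have hE0 : ∀ A, 0 ≤ ∫ y, φ A y ∂ρ := fun A => integral_nonneg (hφ0 A)
  have hEs : ∀ A, ∫ y, φ A y ∂ρ ≤ s := fun A => by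
    simpa using integral_mono (hφi A) (integrable_const s) (hφs A)
  set f : (Fin m → 𝓔) → ℝ :=
    fun x => D.sup' hne (fun A => ∑ i, (∫ y, φ A y ∂ρ - φ A (x i))) with hf
  have hfm : Measurable f := by
    have : f = D.sup' hne fun A x => ∑ i, (∫ y, φ A y ∂ρ - φ A (x i)) := by
      ext x; rw [Finset.sup'_apply]
    rw [this]
    refine Finset.measurable_sup' hne fun A _ => Finset.measurable_fun_sum _ fun i _ => ?_
    exact measurable_const.sub ((hφm A).comp (measurable_pi_apply i))
  have hfE : ∫ x, f x ∂(Measure.pi fun _ : Fin m => ρ) ≤ θ * s * m / 4 := by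
    refine (integral_sup'_sum_sub_le_signed hne ρ (φ := φ)
      (ψ := fun A x => matInner (outer x x) A) hφi
      (fun A => (continuous_matInner_outer A).measurable) (fun A => h.integrable_matInner hc A)
      (fun A B x => ?_) m).trans
      ((h.integral_sup'_signed_le hc hp hpm hne fun A hA => (hD A hA).2.1).trans ?_)
    · refine le_trans ?_ (abs_abs_sub_abs_le _ _)
      simpa using abs_min_sub_min_le_max |matInner (outer x x) A| s |matInner (outer x x) B| s
    · have h1 : 800 / (c * θ) * √(p * m) ≤ s * m := by
        refine abs_le_of_sq_le_sq' ?_ (by positivity) |>.2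
        rw [mul_pow, Real.sq_sqrt (by positivity), mul_pow]
        calc (800 / (c * θ)) ^ 2 * (p * m) = p * (800 / (c * θ)) ^ 2 * m := by ring
          _ ≤ s ^ 2 * m * m := by gcongr
          _ = s ^ 2 * (m : ℝ) ^ 2 := by ring
      calc 200 * √(p * m) / c = θ / 4 * (800 / (c * θ) * √(p * m)) := by field_simp; norm_num
        _ ≤ θ / 4 * (s * m) := by gcongr
        _ = θ * s * m / 4 := by ring
  have hB : ∀ x, |f x| ≤ m * s := by
    intro x
    have h1 : ∀ A, |∑ i, (∫ y, φ A y ∂ρ - φ A (x i))| ≤ m * s := fun A => by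
      refine (Finset.abs_sum_le_sum_abs _ _).trans ((Finset.sum_le_sum (g := fun _ => s)
        fun i _ => abs_le.mpr ⟨?_, ?_⟩).trans (by simp))
      · linarith [hE0 A, hφs A (x i)]
      · linarith [hEs A, hφ0 A (x i)]
    obtain ⟨A, hA⟩ := hne
    refine abs_le.mpr ⟨(neg_le_of_abs_le (h1 A)).trans
      (Finset.le_sup' (fun A => ∑ i, (∫ y, φ A y ∂ρ - φ A (x i))) hA), ?_⟩
    exact Finset.sup'_le _ _ fun A _ => (le_abs_self _).trans (h1 A)
  have hd : ∀ x i t, f (Function.update x i t) ≤ f x + s := by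
    intro x i t
    refine Finset.sup'_le _ _ fun A hA => ?_
    refine (sum_update_le (G := fun z => ∫ y, φ A y ∂ρ - φ A z) (c := s)
      (fun t t' => by linarith [hφ0 A t, hφs A t']) x i t).trans ?_
    gcongr
    exact Finset.le_sup' (fun A => ∑ i, (∫ y, φ A y ∂ρ - φ A (x i))) hA
  have hmc := measureReal_ge_le_of_boundedDifferences ρ hs hm hfm ⟨_, hB⟩ hd
    (t := θ * s * m / 4) (by positivity)
  have e1 : 2 * (θ * s * m / 4) ^ 2 / (m * s ^ 2) = θ ^ 2 * m / 8 := by field_simp; norm_num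
  rw [e1] at hmc
  refine (measureReal_mono ?_ (measure_ne_top _ _)).trans hmc
  rintro x ⟨A, hA, hlt⟩
  have h1 : ∑ i, (∫ y, φ A y ∂ρ - φ A (x i)) ≤ f x :=
    Finset.le_sup' (fun A => ∑ i, (∫ y, φ A y ∂ρ - φ A (x i))) hA
  rw [Finset.sum_sub_distrib, Finset.sum_const, Finset.card_univ, Fintype.card_fin,
    nsmul_eq_mul] at h1
  have h2 : ∑ i, φ A (x i) ≤ ∑ i, |matInner (outer (x i) (x i)) A| :=
    Finset.sum_le_sum fun i _ => min_le_left _ _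
  have h3 : m * (θ * s) ≤ m * ∫ y, φ A y ∂ρ :=
    mul_le_mul_of_nonneg_left (h.le_integral_min A (hD A hA).1 s hs (hD A hA).2.2) hm'.le
  rw [Set.mem_ofPred_eq]
  linarith

/-- Uniform lower bound for the empirical `ℓ¹` loss. -/
theorem measure_not_quadraticLowerBound_le (h : IsRegularLaw ρ c θ) (hc : 0 < c) (hθ : 0 < θ)
    {m : ℕ} (hp : 0 < p) (hpm : p ≤ m) {s : ℝ} (hs : 0 < s)
    (hps : p * (800 / (c * θ)) ^ 2 ≤ s ^ 2 * m) :
    (Measure.pi fun _ : Fin m => ρ) {x | ¬ QuadraticLowerBound (θ / 2) s Finset.univ x} ≤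
      ENNReal.ofReal (Real.exp (-(θ ^ 2 * m / 8))) := by
  have : SecondCountableTopology 𝓜 :=
    inferInstanceAs (SecondCountableTopology (Fin p → Fin p → ℝ))
  set S : Set 𝓜 := {A | A.IsSymm ∧ nuclearNorm A ≤ 5 ∧ s ≤ frobNorm A} with hS
  rcases S.eq_empty_or_nonempty with hSe | hSne
  · have : {x : Fin m → 𝓔 | ¬ QuadraticLowerBound (θ / 2) s Finset.univ x} = ∅ := by
      rw [Set.eq_empty_iff_forall_notMem]
      intro x hx
      refine hx fun A h1 h2 h3 => ?_
      have : A ∈ S := ⟨h1, h2, h3⟩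
      simp [hSe] at this
    simp [this]
  have : Nonempty S := hSne.to_subtype
  classical
  set D : ℕ → Finset 𝓜 :=
    fun k => (Finset.range k).image fun j => (TopologicalSpace.denseSeq S j : 𝓜) with hD
  set B : ℕ → Set (Fin m → 𝓔) :=
    fun k => {x | ∃ A ∈ D k, ∑ i, |matInner (outer (x i) (x i)) A| < θ / 2 * s * m} with hB
  have hsub : {x : Fin m → 𝓔 | ¬ QuadraticLowerBound (θ / 2) s Finset.univ x} ⊆ ⋃ k, B k := by
    intro x hx
    simp only [QuadraticLowerBound, Set.mem_ofPred_eq, not_forall, not_le, Finset.card_univ,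
      Fintype.card_fin] at hx
    obtain ⟨A, h1, h2, h3, h4⟩ := hx
    have hcont : Continuous fun A : S => ∑ i, |matInner (outer (x i) (x i)) (A : 𝓜)| := by
      unfold matInner
      refine continuous_finsetSum _ fun i _ => Continuous.abs ?_
      refine continuous_finsetSum _ fun j _ => continuous_finsetSum _ fun k _ => ?_
      exact continuous_const.mul (continuous_subtype_val.matrix_elem j k)
    obtain ⟨j, hj⟩ := (TopologicalSpace.denseRange_denseSeq S).exists_mem_open
      (hcont.isOpen_preimage _ (isOpen_Iio (a := θ / 2 * s * m))) ⟨⟨A, h1, h2, h3⟩, h4⟩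
    refine Set.mem_iUnion.mpr ⟨j + 1, _, Finset.mem_image.mpr ⟨j, by simp, rfl⟩, hj⟩
  have hmono : Monotone B := by
    rintro k l hkl x ⟨A, hA, hx⟩
    exact ⟨A, Finset.image_subset_image (Finset.range_mono hkl) hA, hx⟩
  refine (measure_mono hsub).trans ?_
  rw [hmono.measure_iUnion]
  refine iSup_le fun k => ?_
  rw [← ofReal_measureReal]
  refine ENNReal.ofReal_le_ofReal (h.measureReal_exists_lt_le hc hθ hp hpm hs hps fun A hA => ?_)
  obtain ⟨j, -, rfl⟩ := Finset.mem_image.mp hA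
  exact (TopologicalSpace.denseSeq S j).2

end IsRegularLaw

end Uniform

section Covariates

/-- A variance proxy for centred variables of sub-Gaussian norm at most `L`. -/
noncomputable def varianceProxy (L : ℝ≥0) : ℝ≥0 :=
  4 / Real.toNNReal (1 / (2 * (2 * (Real.exp 1 * (L ^ 2 + 1)))))

theorem varianceProxy_pos (L : ℝ≥0) : 0 < varianceProxy L := by
  refine div_pos (by norm_num) (Real.toNNReal_pos.mpr (by positivity))

theorem hasSubgaussianMGF_of_subGaussianNorm_le {Ω : Type*} [MeasurableSpace Ω] {P : Measure Ω}
    [IsProbabilityMeasure P] {Y : Ω → ℝ} (hY : Measurable Y) {L : ℝ≥0}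
    (h : subGaussianNorm Y P ≤ L) (h0 : ∫ ω, Y ω ∂P = 0) (h2 : ∫ ω, Y ω ^ 2 ∂P = 1) :
    HasSubgaussianMGF Y (varianceProxy L) P := by
  have hpos : 0 < 1 / (2 * (2 * (Real.exp 1 * ((L : ℝ) ^ 2 + 1)))) := by positivity
  obtain ⟨hi, hle⟩ := integral_exp_sq_le_two_of_moments (P := P) hY
    (R := 2 * (Real.exp 1 * ((L : ℝ) ^ 2 + 1))) (by positivity) fun k =>
      (lintegral_even_pow_le_of_subGaussianNorm_le h k).trans (ENNReal.ofReal_le_ofReal (by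
        gcongr; linarith))
  have e : ∀ ω, Y ω ^ 2 / (2 * (2 * (Real.exp 1 * ((L : ℝ) ^ 2 + 1)))) =
      (Real.toNNReal (1 / (2 * (2 * (Real.exp 1 * ((L : ℝ) ^ 2 + 1))))) : ℝ) * Y ω ^ 2 := by
    intro ω
    rw [Real.coe_toNNReal _ hpos.le, one_div, inv_mul_eq_div]
  simp_rw [e] at hi hle
  have hsq : Integrable (fun ω => Y ω ^ 2) P := by
    by_contra hcon
    rw [integral_undef hcon] at h2
    exact zero_ne_one h2
  exact hasSubgaussianMGF_of_integral_exp_sq hY (Real.toNNReal_pos.mpr hpos) hi hle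
    (((memLp_two_iff_integrable_sq hY.aestronglyMeasurable).mpr hsq).integrable one_le_two) h0

variable {Ω : Type*} [MeasurableSpace Ω] {P : Measure Ω} [IsProbabilityMeasure P] {n p : ℕ}
  {x : Fin n → Ω → EuclideanSpace ℝ (Fin p)} {μ : ℝ} {L : ℝ≥0}

theorem measurable_of_coordinates {X : Ω → EuclideanSpace ℝ (Fin p)}
    (h : ∀ l, Measurable fun ω => X ω l) : Measurable X :=
  (MeasurableEquiv.toLp 2 (Fin p → ℝ)).measurable.comp (measurable_pi_lambda _ h)

theorem IsEntryModel.isRegularLaw {X : Ω → EuclideanSpace ℝ (Fin p)} {v : ℝ≥0}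
    (h : IsEntryModel P (fun l ω => X ω l) μ v) (hv : 0 < v) (hμ : 1 < μ) :
    IsRegularLaw (P.map X) (1 / (2 * (2 * (Real.exp 1 * v)))) (smallBallConst μ v) := by
  have hX : Measurable X := measurable_of_coordinates h.measurable
  have hexp : ∀ u : EuclideanSpace ℝ (Fin p), ‖u‖ ≤ 1 → _ := fun u hu =>
    h.integral_exp_linear_sq_le hv (u := u) (by
      rw [← EuclideanSpace.real_norm_sq_eq]; exact pow_le_one₀ (norm_nonneg _) hu)
  have e : ∀ (u : EuclideanSpace ℝ (Fin p)) ω, (∑ k, u k * X ω k) ^ 2 /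
      (2 * (2 * (Real.exp 1 * v))) = 1 / (2 * (2 * (Real.exp 1 * v))) * ⟪X ω, u⟫ ^ 2 := by
    intro u ω
    rw [one_div, inv_mul_eq_div]
    simp [PiLp.inner_apply]
  simp_rw [e] at hexp
  refine ⟨fun u hu => ?_, fun u hu => ?_, fun A hA s hs hsA => ?_⟩
  · rw [integrable_map_measure (by fun_prop) hX.aemeasurable]
    exact (hexp u hu).1
  · rw [integral_map hX.aemeasurable (by fun_prop)]
    exact (hexp u hu).2
  · rw [integral_map hX.aemeasurable
      ((continuous_matInner_outer A).abs.min continuous_const).aestronglyMeasurable]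
    simp_rw [matInner_outer_self]
    exact h.le_integral_min hv hμ hA hs hsA

namespace IsCovariateModel

theorem isEntryModel (h : IsCovariateModel P x μ L) (i : Fin n) :
    IsEntryModel P (fun l ω => x i ω l) μ (varianceProxy L) where
  measurable := h.measurable i
  indep := h.indep.precomp (g := fun l => (i, l)) fun _ _ hab => (Prod.mk.inj hab).2
  subgaussian l := hasSubgaussianMGF_of_subGaussianNorm_le (h.measurable i l) (h.subGaussian i l)
    (h.mean i l) (h.secondMoment i l)
  mean := h.mean i
  secondMoment := h.secondMoment i
  fourthMoment := h.fourthMoment i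

theorem map_row_eq (h : IsCovariateModel P x μ L) (i i' : Fin n) :
    P.map (x i) = P.map (x i') := by
  have hrow : ∀ i, P.map (x i) = (Measure.pi fun l => P.map fun ω => x i ω l).map
      (MeasurableEquiv.toLp 2 (Fin p → ℝ)) := by
    intro i
    rw [← (iIndepFun_iff_map_fun_eq_pi_map fun l => (h.measurable i l).aemeasurable).mp
      (h.isEntryModel i).indep, Measure.map_map (MeasurableEquiv.measurable _)
        (measurable_pi_lambda _ (h.measurable i))]
    rfl
  rw [hrow i, hrow i']
  congr 2
  ext1 l
  exact (h.identDistrib i l i' l).map_eq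

theorem iIndepFun_rows (h : IsCovariateModel P x μ L) : iIndepFun x P := by
  have hq : ∀ q : Fin n × Fin p, Measurable fun ω => x q.1 ω q.2 := fun q => h.measurable q.1 q.2
  have hrow : ∀ i, Measurable fun ω l => x i ω l := fun i => measurable_pi_lambda _ (h.measurable i)
  have : ∀ i l, IsProbabilityMeasure (P.map fun ω => x i ω l) := fun i l =>
    Measure.isProbabilityMeasure_map (h.measurable i l).aemeasurable
  have h1 : iIndepFun (fun i ω l => x i ω l) P := by
    rw [iIndepFun_iff_map_fun_eq_pi_map fun i => (hrow i).aemeasurable]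
    have h2 : ∀ i, P.map (fun ω l => x i ω l) =
        Measure.infinitePi fun l => P.map fun ω => x i ω l := fun i => by
      rw [(iIndepFun_iff_map_fun_eq_pi_map fun l => (h.measurable i l).aemeasurable).mp
        (h.isEntryModel i).indep, Measure.infinitePi_eq_pi]
    simp_rw [h2]
    rw [← Measure.infinitePi_eq_pi, ← Measure.infinitePi_map_curry, Measure.infinitePi_eq_pi,
      ← (iIndepFun_iff_map_fun_eq_pi_map fun q => (hq q).aemeasurable).mp h.indep,
      Measure.map_map (MeasurableEquiv.measurable _) (measurable_pi_lambda _ hq)]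
    rfl
  exact h1.comp (fun _ => MeasurableEquiv.toLp 2 (Fin p → ℝ)) fun _ => MeasurableEquiv.measurable _

/-- A selection of distinct rows has the product law. -/
theorem measure_rows_le (h : IsCovariateModel P x μ L) (i₀ : Fin n) {m : ℕ} {g : Fin m → Fin n}
    (hg : g.Injective) (B : Set (Fin m → EuclideanSpace ℝ (Fin p))) :
    P {ω | (fun j => x (g j) ω) ∈ B} ≤ (Measure.pi fun _ : Fin m => P.map (x i₀)) B := by
  have hx : ∀ i, Measurable (x i) := fun i => measurable_of_coordinates (h.measurable i)
  have h1 := (iIndepFun_iff_map_fun_eq_pi_map fun j => (hx (g j)).aemeasurable).mp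
    (h.iIndepFun_rows.precomp hg)
  have h2 : (fun j => P.map (x (g j))) = fun _ => P.map (x i₀) :=
    funext fun j => h.map_row_eq _ _
  rw [h2] at h1
  rw [← h1]
  exact Measure.le_map_apply (measurable_pi_lambda _ fun j => hx (g j)).aemeasurable B

end IsCovariateModel

theorem quadraticLowerBound_of_enumeration {c s : ℝ} {I : Finset (Fin n)}
    {X : Fin n → EuclideanSpace ℝ (Fin p)}
    (h : QuadraticLowerBound c s Finset.univ fun j => X (I.equivFin.symm j)) :
    QuadraticLowerBound c s I X := by
  intro A h1 h2 h3
  have h4 := h A h1 h2 h3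
  rw [Finset.card_univ, Fintype.card_fin, Equiv.sum_comp I.equivFin.symm
    fun i : I => |matInner (outer (X i) (X i)) A|] at h4
  rwa [← Finset.sum_coe_sort I fun i => |matInner (outer (X i) (X i)) A|]

end Covariates

theorem theorem1 (κ : ℝ) (L : ℝ≥0) (μ : ℝ) (hμ : 1 < μ) :
    ∃ c₁ c₂ c₃ c₄ c₅ c₆ : ℝ,
      0 < c₁ ∧ 0 < c₂ ∧ 0 < c₃ ∧ 0 < c₄ ∧ 0 < c₅ ∧ 0 < c₆ ∧
      ∀ (n p : ℕ) (Ω : Type*) [MeasurableSpace Ω] (P : Measure Ω) [IsProbabilityMeasure P]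
        (x : Fin n → Ω → EuclideanSpace ℝ (Fin p)) (I₁ : Finset (Fin n))
        (β₁ β₂ : EuclideanSpace ℝ (Fin p)),
        IsCovariateModel P x μ L →
        (I₁.card : ℝ) ≤ κ * (I₁ᶜ.card : ℝ) →
        (I₁ᶜ.card : ℝ) ≤ κ * (I₁.card : ℝ) →
        0 < separation β₁ β₂ →
        c₃ * (1 / separation β₁ β₂) * p ≤ min (I₁.card : ℝ) (I₁ᶜ.card : ℝ) →
        ∃ G : Set Ω, MeasurableSet G ∧
          ENNReal.ofReal (1 - c₁ * Real.exp (-c₂ * n)) ≤ P G ∧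
          ∀ ω ∈ G, ∀ (e : EuclideanSpace ℝ (Fin n)) (η : ℝ),
            c₄ * √(n : ℝ) * ‖e‖ * ‖β₂ - β₁‖ ≤ η →
            ‖e‖ ≤ √(separation β₁ β₂) / c₅ * √(n : ℝ) * (‖β₁‖ + ‖β₂‖) →
            (∀ (K : Matrix (Fin p) (Fin p) ℝ) (g : EuclideanSpace ℝ (Fin p)),
              IsOptimal {A | A.IsSymm} (fun i => x i ω)
                (response I₁ β₁ β₂ (fun i => x i ω) e) η K g →
              frobNorm (K - Kstar β₁ β₂) ≤ c₆ * (1 / (√(separation β₁ β₂) * n)) * η ∧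
              ‖g - gstar β₁ β₂‖ ≤
                c₆ * (1 / (√(separation β₁ β₂) * n * (‖β₁‖ + ‖β₂‖))) * η) ∧
            (∀ (K : Matrix (Fin p) (Fin p) ℝ) (g : EuclideanSpace ℝ (Fin p)),
              IsOptimal Set.univ (fun i => x i ω)
                (response I₁ β₁ β₂ (fun i => x i ω) e) η K g →
              frobNorm (symPart K - Kstar β₁ β₂) ≤ c₆ * (1 / (√(separation β₁ β₂) * n)) * η ∧
              ‖g - gstar β₁ β₂‖ ≤
                c₆ * (1 / (√(separation β₁ β₂) * n * (‖β₁‖ + ‖β₂‖))) * η) := by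
  have hv := varianceProxy_pos L
  obtain ⟨c, hcdef⟩ : ∃ c : ℝ, c = 1 / (2 * (2 * (Real.exp 1 * varianceProxy L))) := ⟨_, rfl⟩
  obtain ⟨θ, hθdef⟩ : ∃ θ : ℝ, θ = smallBallConst μ (varianceProxy L) := ⟨_, rfl⟩
  have hc : 0 < c := by
    have : (0 : ℝ) < varianceProxy L := by exact_mod_cast hv
    rw [hcdef]; positivity
  have hθ : 0 < θ := hθdef ▸ smallBallConst_pos _ _
  set k : ℝ := 1 + |κ| with hk
  have hk0 : 0 < k := by positivity
  set C : ℝ := 4 / √c with hC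
  have hC0 : 0 < C := by positivity
  set c₃ : ℝ := 2 + 36 * (800 / (c * θ)) ^ 2 with hc₃
  refine ⟨3, min 1 (θ ^ 2 / (8 * k)), c₃, C + 2 / (24 * C * k / (θ / 2)), 24 * C * k / (θ / 2),
    24 * k / (θ / 2), by norm_num, by positivity, by positivity, by positivity, by positivity,
    by positivity, ?_⟩
  intro n p Ω _ P _ x I₁ β₁ β₂ h hκ₁ hκ₂ hα hmin
  set α := separation β₁ β₂ with hαdef
  have hsmall : ∀ m : ℕ, c₃ * (1 / α) * p ≤ m →
      p ≤ m ∧ p * (800 / (c * θ)) ^ 2 ≤ (√α / 6) ^ 2 * m := by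
    intro m hm
    rw [mul_one_div, div_mul_eq_mul_div, div_le_iff₀ hα] at hm
    have h2 : α ≤ 2 := separation_le_two β₁ β₂
    have h3 : 0 ≤ p * (800 / (c * θ)) ^ 2 := by positivity
    have h4 : (0 : ℝ) ≤ p := Nat.cast_nonneg p
    have h5 : c₃ * p = 2 * p + 36 * (p * (800 / (c * θ)) ^ 2) := by rw [hc₃]; ring
    have h6 : (m : ℝ) * α ≤ m * 2 := mul_le_mul_of_nonneg_left h2 (Nat.cast_nonneg m)
    refine ⟨by exact_mod_cast (by linarith : (p : ℝ) ≤ m), ?_⟩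
    rw [div_pow (√α), Real.sq_sqrt hα.le]
    linarith
  have hp : 0 < p := by
    rcases Nat.eq_zero_or_pos p with rfl | hp
    · have : β₁ = β₂ := Subsingleton.elim _ _
      simp [hαdef, separation, this] at hα
    · exact hp
  have hcard : (I₁.card : ℝ) + I₁ᶜ.card = n := by
    exact_mod_cast (Finset.card_add_card_compl I₁).trans (Fintype.card_fin n)
  have hn₁ : (n : ℝ) ≤ k * I₁.card := by
    have := mul_le_mul_of_nonneg_right (le_abs_self κ) (Nat.cast_nonneg (α := ℝ) I₁.card)
    rw [hk, add_mul]; linarith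
  have hn₂ : (n : ℝ) ≤ k * I₁ᶜ.card := by
    have := mul_le_mul_of_nonneg_right (le_abs_self κ) (Nat.cast_nonneg (α := ℝ) I₁ᶜ.card)
    rw [hk, add_mul]; linarith
  obtain ⟨hp₁, hs₁⟩ := hsmall I₁.card (hmin.trans (min_le_left _ _))
  obtain ⟨hp₂, hs₂⟩ := hsmall I₁ᶜ.card (hmin.trans (min_le_right _ _))
  have hpn : p ≤ n := hp₁.trans ((Finset.card_le_univ _).trans (Fintype.card_fin n).le)
  have hn : 0 < n := hp.trans_le hpn
  have hn' : (0 : ℝ) < n := by exact_mod_cast hn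
  have i₀ : Fin n := ⟨0, hn⟩
  have hlaw : IsRegularLaw (P.map (x i₀)) c θ := by
    rw [hcdef, hθdef]; exact (h.isEntryModel i₀).isRegularLaw hv hμ
  have : IsProbabilityMeasure (P.map (x i₀)) := Measure.isProbabilityMeasure_map
    (measurable_of_coordinates (h.measurable i₀)).aemeasurable
  set s : ℝ := √α / 6 with hs
  have hs0 : 0 < s := by have := Real.sqrt_pos.mpr hα; positivity
  obtain ⟨b, hb⟩ : ∃ b : ℝ, b = Real.exp (-min 1 (θ ^ 2 / (8 * k)) * n) := ⟨_, rfl⟩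
  have hblock : ∀ I : Finset (Fin n), p ≤ I.card → p * (800 / (c * θ)) ^ 2 ≤ s ^ 2 * I.card →
      (n : ℝ) ≤ k * I.card →
      P {ω | ¬ QuadraticLowerBound (θ / 2) s I fun i => x i ω} ≤ ENNReal.ofReal b := by
    intro I h1 h2 h3
    refine (measure_mono ?_).trans ((h.measure_rows_le i₀ (g := fun j => (I.equivFin.symm j : Fin n))
      (Subtype.val_injective.comp I.equivFin.symm.injective)
      {X | ¬ QuadraticLowerBound (θ / 2) s Finset.univ X}).trans
      ((hlaw.measure_not_quadraticLowerBound_le hc hθ hp h1 hs0 h2).trans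
        (ENNReal.ofReal_le_ofReal ?_)))
    · exact fun ω hω hcon => hω (quadraticLowerBound_of_enumeration hcon)
    · rw [hb, Real.exp_le_exp, neg_mul, neg_le_neg_iff]
      calc min 1 (θ ^ 2 / (8 * k)) * n ≤ θ ^ 2 / (8 * k) * (k * I.card) :=
            mul_le_mul (min_le_right _ _) h3 hn'.le (by positivity)
        _ = θ ^ 2 * I.card / 8 := by field_simp
  have hlinear : P {ω | ¬ LinearFormBound C fun i => x i ω} ≤ ENNReal.ofReal b := by
    refine (h.measure_rows_le i₀ (g := id) Function.injective_id
      {X | ¬ LinearFormBound C X}).trans ?_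
    rw [← ofReal_measureReal]
    refine ENNReal.ofReal_le_ofReal ((hlaw.measureReal_not_linearFormBound_le hc hpn).trans ?_)
    rw [hb, Real.exp_le_exp, neg_mul, neg_le_neg_iff]
    exact mul_le_of_le_one_left hn'.le (min_le_left _ _)
  set B : Set Ω := {ω | ¬ LinearFormBound C fun i => x i ω} ∪
    ({ω | ¬ QuadraticLowerBound (θ / 2) s I₁ fun i => x i ω} ∪
      {ω | ¬ QuadraticLowerBound (θ / 2) s I₁ᶜ fun i => x i ω}) with hB
  have hPB : P B ≤ ENNReal.ofReal (3 * b) := by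
    have hb0 : 0 ≤ b := hb ▸ Real.exp_nonneg _
    rw [show 3 * b = b + (b + b) by ring, ENNReal.ofReal_add hb0 (by linarith),
      ENNReal.ofReal_add hb0 hb0]
    exact (measure_union_le _ _).trans (add_le_add hlinear ((measure_union_le _ _).trans
      (add_le_add (hblock I₁ hp₁ hs₁ hn₁) (hblock I₁ᶜ hp₂ hs₂ hn₂))))
  refine ⟨(toMeasurable P B)ᶜ, (measurableSet_toMeasurable P B).compl, ?_, ?_⟩
  · rw [prob_compl_eq_one_sub (measurableSet_toMeasurable P B), measure_toMeasurable, ← hb,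
      ENNReal.ofReal_sub _ (by rw [hb]; positivity), ENNReal.ofReal_one]
    exact tsub_le_tsub_left hPB 1
  intro ω hω e η hη he
  have hωB : ω ∉ B := fun hcon => hω (subset_toMeasurable P B hcon)
  simp only [hB, Set.mem_union, Set.mem_ofPred_eq, not_or, not_not] at hωB
  obtain ⟨hω0, hω1, hω2⟩ := hωB
  have hβ := norm_add_norm_pos hα
  have hαn : 0 < √α * n := mul_pos (Real.sqrt_pos.mpr hα) hn'
  have key : ∀ (K : Matrix (Fin p) (Fin p) ℝ) (g : EuclideanSpace ℝ (Fin p)),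
      IsOptimal {A | A.IsSymm} (fun i => x i ω) (response I₁ β₁ β₂ (fun i => x i ω) e) η K g →
      frobNorm (K - Kstar β₁ β₂) ≤ 24 * k / (θ / 2) * (1 / (√α * n)) * η ∧
      ‖g - gstar β₁ β₂‖ ≤ 24 * k / (θ / 2) * (1 / (√α * n * (‖β₁‖ + ‖β₂‖))) * η := by
    intro K g hK
    have hle := error_le_of_isOptimal hC0 (half_pos hθ) hk0 hn hα hω0 hω1 hω2 hn₁ hn₂ hη he hK
    have e1 : 24 * k / (θ / 2) * (η / (√α * n)) = 24 * k / (θ / 2) * (1 / (√α * n)) * η := by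
      ring
    have h1 : 0 ≤ (‖β₁‖ + ‖β₂‖) * ‖g - gstar β₁ β₂‖ := by positivity
    have h2 := frobNorm_nonneg (K - Kstar β₁ β₂)
    rw [e1] at hle
    refine ⟨by linarith, ?_⟩
    have e2 : 24 * k / (θ / 2) * (1 / (√α * n * (‖β₁‖ + ‖β₂‖))) * η =
        24 * k / (θ / 2) * (1 / (√α * n)) * η / (‖β₁‖ + ‖β₂‖) := by
      field_simp
    rw [e2, le_div_iff₀ hβ]
    linarith
  exact ⟨key, fun K g hK => key (symPart K) g hK.symPart⟩
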